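/- \textsc{Directed Maximum Leaf Spanning Tree} is the following problem. Given a digraph $G$ on the vertex set $\{0,\dots,n-1\}$, find an out-branching of $G$ with the maximum number of leaves, or report that $G$ has no out-branching. Here an \emph{out-branching} of $G$ with root $r$ is a spanning subgraph $T$ of $G$ in which $r$ has in-degree $0$, every other vertex has in-degree $1$, and every vertex is reachable from $r$ by a directed path; its \emph{leaves} are the vertices of out-degree $0$ in $T$. The maximum is taken over all out-branchings of $G$, with all possible roots. \textbf{Theorem.} \textsc{Directed Maximum Leaf Spanning Tree} can be solved exactly by a deterministic algorithm that uses polynomial space and runs in time $\mathcal{O}^*(1.9043^n)$. That is, there are one program for the word RAM and two polynomials $p,q$ with coefficients in $\mathbb{N}$ such that, for every $n$ and every digraph $G$ on $n$ vertices, given as its adjacency matrix, the program halts on $G$ after at most $p(n)\cdot 1.9043^n$ steps on a machine with $q(n)$ memory cells, all of whose registers and cells hold only natural numbers smaller than $q(n)$; it outputs the root and the parent of every other vertex in an out-branching of $G$ with the maximum number of leaves if $G$ has an out-branching, and otherwise reports that it has none. -/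

import Mathlib

/-! ### Out-branchings -/

namespace Digraph

variable {V : Type*}

/-- `T` is an out-branching (spanning directed tree) of `G` with root `r`: a spanning subgraph of
`G` in which the root has in-degree `0`, every other vertex has in-degree `1` (its unique
in-neighbour is its parent), and every vertex is reached from the root by a directed path. -/
structure IsOutBranching (G T : Digraph V) (r : V) : Prop where
  arc_mem : ∀ u v, T.Adj u v → G.Adj u v
  root : ∀ u, ¬ T.Adj u r
  parent : ∀ v, v ≠ r → ∃! u, T.Adj u v
  reachable : ∀ v, Relation.ReflTransGen T.Adj r v

/-- The leaves of an out-branching: the vertices of out-degree zero. -/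
def leaves (T : Digraph V) : Set V := {v | ∀ w, ¬ T.Adj v w}

/-- `T` is an out-branching of `G` with root `r` which has the maximum number of leaves among all
out-branchings of `G`, whatever their roots. -/
def IsMaxLeafOutBranching (G T : Digraph V) (r : V) : Prop :=
  G.IsOutBranching T r ∧
    ∀ (T' : Digraph V) (r' : V), G.IsOutBranching T' r' → T'.leaves.ncard ≤ T.leaves.ncard

end Digraph

/-! ### The word RAM

A machine has registers and a memory; registers and memory cells hold natural numbers. A program
is a finite piece of text in a structured imperative language, so it mentions only finitely many
registers and constants. -/

namespace RAM

/-- The binary operations of the machine. -/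
inductive Op
  | add | sub | mul | div | mod | lt | eq

/-- Subtraction is truncated, and the two tests return `1` for true and `0` for false. -/
def Op.eval : Op → ℕ → ℕ → ℕ
  | add, a, b => a + b
  | sub, a, b => a - b
  | mul, a, b => a * b
  | div, a, b => a / b
  | mod, a, b => a % b
  | lt, a, b => if a < b then 1 else 0
  | eq, a, b => if a = b then 1 else 0

/-- Expressions: constants, the content of a register, the content of the memory cell with a
computed address, and binary operations. -/
inductive Expr
  | const (k : ℕ)
  | reg (x : ℕ)
  | load (addr : Expr)
  | op (o : Op) (e₁ e₂ : Expr)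

/-- The contents of the registers and of the memory cells. -/
structure State where
  reg : ℕ → ℕ
  mem : ℕ → ℕ

/-- The value of an expression. -/
def Expr.eval (s : State) : Expr → ℕ
  | const k => k
  | reg x => s.reg x
  | load a => s.mem (a.eval s)
  | op o e₁ e₂ => o.eval (e₁.eval s) (e₂.eval s)

/-- The number of steps taken by the evaluation of an expression: one for each constant, register
access, memory access and operation in it. -/
def Expr.cost : Expr → ℕ
  | const _ => 1
  | reg _ => 1
  | load a => a.cost + 1
  | op _ e₁ e₂ => e₁.cost + e₂.cost + 1

/-- Programs. In tests, `0` stands for false and every other value for true. -/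
inductive Prog
  | skip
  | assign (x : ℕ) (e : Expr)
  | store (addr e : Expr)
  | seq (p q : Prog)
  | ite (e : Expr) (p q : Prog)
  | while (e : Expr) (p : Prog)

/-- `Exec M p s s' t`: on a machine whose memory consists of the `M` cells with addresses below `M`,
and whose registers and cells can hold only numbers below `M`, the program `p` started in the
state `s` halts in the state `s'` after exactly `t` steps.
An attempt to write a number `≥ M`, or to write to an address `≥ M`, gets the machine stuck. (A cell
with address `≥ M` is thus never changed. As an expression of the program has a fixed size, the
intermediate results in its evaluation are bounded by a fixed power of `M` up to a fixed factor.) -/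
inductive Exec (M : ℕ) : Prog → State → State → ℕ → Prop
  | skip (s : State) : Exec M .skip s s 1
  | assign (s : State) (x : ℕ) (e : Expr) (hv : e.eval s < M) :
      Exec M (.assign x e) s ⟨Function.update s.reg x (e.eval s), s.mem⟩ (e.cost + 1)
  | store (s : State) (a e : Expr) (ha : a.eval s < M) (hv : e.eval s < M) :
      Exec M (.store a e) s ⟨s.reg, Function.update s.mem (a.eval s) (e.eval s)⟩
        (a.cost + e.cost + 1)
  | seq {p q : Prog} {s s' s'' : State} {t t' : ℕ} (hp : Exec M p s s' t)
      (hq : Exec M q s' s'' t') : Exec M (.seq p q) s s'' (t + t')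
  | ite_true {e : Expr} {p q : Prog} {s s' : State} {t : ℕ} (he : e.eval s ≠ 0)
      (hp : Exec M p s s' t) : Exec M (.ite e p q) s s' (e.cost + 1 + t)
  | ite_false {e : Expr} {p q : Prog} {s s' : State} {t : ℕ} (he : e.eval s = 0)
      (hq : Exec M q s s' t) : Exec M (.ite e p q) s s' (e.cost + 1 + t)
  | while_true {e : Expr} {p : Prog} {s s' s'' : State} {t t' : ℕ} (he : e.eval s ≠ 0)
      (hp : Exec M p s s' t) (hw : Exec M (.while e p) s' s'' t') :
      Exec M (.while e p) s s'' (e.cost + 1 + t + t')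
  | while_false {e : Expr} {p : Prog} {s : State} (he : e.eval s = 0) :
      Exec M (.while e p) s s (e.cost + 1)

/-- The state fits into a machine with `M` memory cells and numbers below `M`. -/
def State.Fits (M : ℕ) (s : State) : Prop :=
  (∀ x, s.reg x < M) ∧ (∀ a, s.mem a < M) ∧ ∀ a, M ≤ a → s.mem a = 0

/-- `p` turns the state `s` into the state `s'` in `t` steps on a machine with `M` memory cells, each
holding a number below `M`. -/
def Runs (M : ℕ) (p : Prog) (s s' : State) (t : ℕ) : Prop :=
  s.Fits M ∧ Exec M p s s' t

open Classical in
/-- The input: register `0` contains the number `n` of vertices, and the memory cells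
`0, …, n ^ 2 - 1` contain the adjacency matrix of the digraph row by row; all the rest is `0`. -/
noncomputable def input {n : ℕ} (G : Digraph (Fin n)) : State where
  reg x := if x = 0 then n else 0
  mem a := if ∃ i j : Fin n, a = i * n + j ∧ G.Adj i j then 1 else 0

/-- The state `s` contains the arcs of the digraph `T` with root `r` as a list of parents: register
`1` contains `r`, and for every other vertex `v` the memory cell `v` contains the parent of `v`. -/
def Represents {n : ℕ} (s : State) (T : Digraph (Fin n)) (r : Fin n) : Prop :=
  s.reg 1 = r ∧ ∀ u v : Fin n, T.Adj u v ↔ v ≠ r ∧ s.mem v = u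

/-- A correct output for the problem Directed Maximum Leaf Spanning Tree: register `0` contains `1`
and the state contains an out-branching of `G` with the maximum number of leaves, or register `0`
contains `0` and `G` has no out-branching. -/
def IsMaxLeafOutput {n : ℕ} (G : Digraph (Fin n)) (s : State) : Prop :=
  (s.reg 0 = 1 ∧ ∃ T r, G.IsMaxLeafOutBranching T r ∧ Represents s T r) ∨
    (s.reg 0 = 0 ∧ ∀ T r, ¬ G.IsOutBranching T r)

end RAM

/-! ### Terms with bounded sums and their compilation -/

namespace RAM

/-! Out-branchings are traded for vertex sets. Call `S` feasible for the root `r` if `r ∈ S` and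
every vertex is reached from `r` along arcs leaving `S`. The internal vertices of an out-branching,
together with its root, form a feasible set (`exists_feasible_of_outBranching`). Conversely, if
every vertex takes as its parent a vertex of `S` that is nearer to `r`, the result is an
out-branching in which all vertices outside `S` are leaves (`isMaxLeafOutBranching_of_parents`). So
it suffices to minimise the size of `S`, for each root; only for `n = 1`, where the root itself is a
leaf, do the two counts differ.

Let `I` be the vertices already chosen as internal and `U` the undecided ones. What is missing is
measured by the source components: the strong components, for the arcs leaving `I`, that no such arc
enters and that do not contain `r`. A set between `I` and `I ∪ U` is feasible when its new vertices
can be attached to `r` one after the other and every source component is hit. Such sets are detected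
by counting branching walks from `r`, tree-shaped walks that may repeat vertices. The walks that hit
all components are counted by inclusion–exclusion over the set of components to be avoided
(`sum_powerset_numWalks`), and the avoiding walks are counted by a polynomial recursion. A positive
count of walks with `k` steps means that a feasible set with at most `k` additional vertices exists,
and a feasible set produces a walk of its own size (`exists_feasible_of_numCovering`,
`numCovering_pos`).

Inclusion–exclusion costs `2` to the number of source components, so branching on undecided vertices
comes first. The measure is `1.1747 ^ (3 * |U| + number of components)`. A decision removes a vertex
from `U`, and an internal vertex entering `d ≥ 1` components destroys at least `d - 1` of them
(`card_reps_insert`). Components with few entering vertices give extra savings, which are stored in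
the factors of `weight`; `weight_add_le` is the resulting recursion. When no branching rule applies,
a discharging argument bounds the number of components by `6 / 7` of `|U|`
(`seven_mul_card_reps_le`), and then the `2 ^ |reps|` subsets are within the measure
(`two_pow_le_weight`). At the start the measure is at most `(1.1747 ^ 4) ^ n ≤ 1.9043 ^ n`.

Both phases are one binary tree of depth at most `2 n` (`exists_tree`), traversed with a stack. The
counts are too large for the machine, so they are computed modulo each `m ≤ 2 (n + 2) ^ 2`. A
positive number of their size is not divisible by all these `m`, because otherwise a central
binomial coefficient would divide it (`exists_not_dvd`). The counts of all leaf problems are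
nonnegative, so nothing cancels. An optimal set is recovered by excluding vertices greedily as long
as the optimum does not change (`feasible_kept`), and breadth-first layers give the parents.

For the machine, the algorithm is written with commands over terms with bounded sums. As the program
is fixed, compiling it costs only a polynomial factor in time and space (`Tm.exec_compile`,
`HExec.exec`). -/

/-- Arithmetic terms with bounded sums: `sum x b e` is the sum of `e` over all values of the
register `x` below `b`. -/
inductive Tm
  | const (k : ℕ)
  | reg (x : ℕ)
  | load (a : Tm)
  | op (o : Op) (a b : Tm)
  | sum (x : ℕ) (b e : Tm)

/-- Overwrite a register. -/
def State.set (h : State) (x v : ℕ) : State := ⟨Function.update h.reg x v, h.mem⟩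

/-- Overwrite a memory cell. -/
def State.put (h : State) (a v : ℕ) : State := ⟨h.reg, Function.update h.mem a v⟩

@[simp] theorem State.set_mem (h : State) (x v : ℕ) : (h.set x v).mem = h.mem := rfl
@[simp] theorem State.put_reg (h : State) (x v : ℕ) : (h.put x v).reg = h.reg := rfl
@[simp] theorem State.set_reg_self (h : State) (x v : ℕ) : (h.set x v).reg x = v := by
  simp [State.set]
theorem State.set_reg (h : State) (x v y : ℕ) :
    (h.set x v).reg y = if y = x then v else h.reg y := by
  simp [State.set, Function.update_apply]
theorem State.put_mem (h : State) (x v y : ℕ) :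
    (h.put x v).mem y = if y = x then v else h.mem y := by
  simp [State.put, Function.update_apply]

/-- The value of a term. -/
def Tm.eval : Tm → State → ℕ
  | const k, _ => k
  | reg x, h => h.reg x
  | load a, h => h.mem (a.eval h)
  | op o a b, h => o.eval (a.eval h) (b.eval h)
  | sum x b e, h => ∑ i ∈ Finset.range (b.eval h), e.eval (h.set x i)

/-- Registers from `numVars` on are used by compiled terms for intermediate results. -/
def numVars : ℕ := 64

/-- All registers of the term are below `numVars`. -/
def Tm.wf : Tm → Bool
  | const _ => true
  | reg x => x.blt numVars
  | load a => a.wf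
  | op _ a b => a.wf && b.wf
  | sum x b e => x.blt numVars && (b.wf && e.wf)

/-- The exponent in the bounds for the value and the evaluation time. -/
def Tm.exp : Tm → ℕ
  | const k => k + 1
  | reg _ => 1
  | load a => a.exp + 2
  | op _ a b => a.exp + b.exp + 1
  | sum _ b e => b.exp + b.exp * e.exp + 4

/-- A program that evaluates the term into the register `d`, using registers from `d` on. -/
def Tm.compile : Tm → ℕ → Prog
  | const k, d => .assign d (.const k)
  | reg x, d => .assign d (.reg x)
  | load a, d => .seq (a.compile d) (.assign d (.load (.reg d)))
  | op o a b, d =>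
      .seq (a.compile d) (.seq (b.compile (d + 1)) (.assign d (.op o (.reg d) (.reg (d + 1)))))
  | sum x b e, d =>
      .seq (b.compile d) <| .seq (.assign (d + 2) (.reg x)) <| .seq (.assign x (.const 0)) <|
      .seq (.assign (d + 1) (.const 0)) <|
      .seq (.while (.op .lt (.reg x) (.reg d)) <|
        .seq (e.compile (d + 3)) <|
        .seq (.assign (d + 1) (.op .add (.reg (d + 1)) (.reg (d + 3)))) <|
          .assign x (.op .add (.reg x) (.const 1))) <|
      .seq (.assign d (.reg (d + 1))) (.assign x (.reg (d + 2)))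

/-- Registers below `numVars` and the memory hold numbers up to `N`. -/
def State.Bdd (N : ℕ) (h : State) : Prop := (∀ x < numVars, h.reg x ≤ N) ∧ ∀ a, h.mem a ≤ N

/-- The states agree on the registers below `numVars` and on the memory. -/
def State.Agree (s h : State) : Prop := (∀ x < numVars, s.reg x = h.reg x) ∧ s.mem = h.mem

theorem State.Bdd.set {N : ℕ} {h : State} (H : h.Bdd N) {x v : ℕ} (hv : v ≤ N) :
    (h.set x v).Bdd N := by
  refine ⟨fun y hy => ?_, H.2⟩
  rw [State.set_reg]; split_ifs
  · exact hv
  · exact H.1 y hy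

theorem State.Bdd.put {N : ℕ} {h : State} (H : h.Bdd N) {x v : ℕ} (hv : v ≤ N) :
    (h.put x v).Bdd N := by
  refine ⟨H.1, fun y => ?_⟩
  rw [State.put_mem]; split_ifs
  · exact hv
  · exact H.2 y

theorem State.Bdd.mono {N N' : ℕ} {h : State} (H : h.Bdd N) (hN : N ≤ N') : h.Bdd N' :=
  ⟨fun x hx => (H.1 x hx).trans hN, fun a => (H.2 a).trans hN⟩

theorem Tm.exp_pos : ∀ e : Tm, 0 < e.exp
  | const _ => by simp [exp]
  | reg _ => by simp [exp]
  | load _ => by simp [exp]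
  | op _ _ _ => by simp [exp]
  | sum _ _ _ => by simp [exp]

/-- The bounds are taken to be at least `2` so that their product dominates the sum as well. -/
theorem Op.eval_le (o : Op) {a b x y : ℕ} (ha : a ≤ x) (hb : b ≤ y) (hx : 2 ≤ x) (hy : 2 ≤ y) :
    o.eval a b ≤ x * y := by
  have h1 : x ≤ x * y := Nat.le_mul_of_pos_right _ (by omega)
  cases o <;> simp only [Op.eval]
  · nlinarith
  · omega
  · exact Nat.mul_le_mul ha hb
  · exact (Nat.div_le_self a b).trans (ha.trans h1)
  · exact (Nat.mod_le a b).trans (ha.trans h1)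
  · split_ifs <;> omega
  · split_ifs <;> omega

theorem Tm.two_le_pow {N : ℕ} (hN : 2 ≤ N) (e : Tm) : 2 ≤ N ^ e.exp :=
  hN.trans (Nat.le_self_pow e.exp_pos.ne' N)

/-- Inside a bounded sum the summation variable may be as large as the value of the upper limit. So
the body is estimated with `N ^ b.exp` in place of `N`, which is why exponents are multiplied in
`Tm.exp`. -/
theorem Tm.eval_le (e : Tm) : ∀ {N : ℕ} {h : State}, 2 ≤ N → e.wf → h.Bdd N →
    e.eval h ≤ N ^ e.exp := by
  induction e with
  | const k =>
    intro N h hN _ _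
    exact (Nat.lt_two_pow_self.le).trans ((Nat.pow_le_pow_left hN k).trans
      (Nat.pow_le_pow_right (by omega) (by simp [exp])))
  | reg x =>
    intro N h hN hw H
    simpa [eval, exp] using H.1 x (by simpa [wf, Nat.blt_eq] using hw)
  | load a _ =>
    intro N h hN hw H
    exact (H.2 _).trans (Nat.le_self_pow (by simp [exp]) N)
  | op o a b iha ihb =>
    intro N h hN hw H
    simp only [wf, Bool.and_eq_true] at hw
    have := o.eval_le (iha hN hw.1 H) (ihb hN hw.2 H) (two_le_pow hN a) (two_le_pow hN b)
    rw [← pow_add] at this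
    exact this.trans (Nat.pow_le_pow_right (by omega) (by simp [exp]))
  | sum x b e ihb ihe =>
    intro N h hN hw H
    simp only [wf, Bool.and_eq_true] at hw
    have hb := ihb hN hw.2.1 H
    have hNB : N ≤ N ^ b.exp := Nat.le_self_pow b.exp_pos.ne' N
    calc eval (sum x b e) h ≤ ∑ i ∈ Finset.range (b.eval h), (N ^ b.exp) ^ e.exp := by
          refine Finset.sum_le_sum fun i hi => ihe (hN.trans hNB) hw.2.2 ((H.mono hNB).set ?_)
          exact (Finset.mem_range.1 hi).le.trans hb
      _ = b.eval h * (N ^ b.exp) ^ e.exp := by simp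
      _ ≤ N ^ b.exp * (N ^ b.exp) ^ e.exp := Nat.mul_le_mul_right _ hb
      _ = N ^ (b.exp + b.exp * e.exp) := by rw [← pow_mul, ← pow_add]
      _ ≤ _ := Nat.pow_le_pow_right (by omega) (by simp [exp])

theorem Exec.of_eq {M : ℕ} {p : Prog} {s s' s'' : State} {t t' : ℕ} (H : Exec M p s s' t)
    (hs : s' = s'') (ht : t = t') : Exec M p s s'' t' := hs ▸ ht ▸ H

theorem Exec.set {M x : ℕ} {s : State} {e : Expr} {v : ℕ} (hv : e.eval s = v) (hM : v < M) :
    Exec M (.assign x e) s (s.set x v) (e.cost + 1) := by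
  subst hv; exact Exec.assign s x e hM

/-- What the compiled term does in the state `s`, for a term of value `v`. -/
def EvalsTo (M : ℕ) (p : Prog) (d : ℕ) (s : State) (v T : ℕ) : Prop :=
  ∃ s' t, Exec M p s s' t ∧ t ≤ T ∧ s'.mem = s.mem ∧ s'.reg d = v ∧
    ∀ y < d, s'.reg y = s.reg y

/-- Loop invariant of a compiled sum: `i` iterations are done, `k` are left, and register `d + 1`
holds the partial sum. The number `y` bounds both a summand and the time for it; an iteration adds
`12` steps, four each for the test and the two assignments, and the final failing test takes `4`. -/
theorem exec_sum_loop {M d x B y : ℕ} {p : Prog} {s₀ : State} {b : ℕ} {f : ℕ → ℕ} (hx : x < d)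
    (hb : b ≤ B) (hM : B * y + B + 1 < M)
    (hf : ∀ i < b, f i ≤ y)
    (hp : ∀ i < b, ∀ s : State, s.mem = s₀.mem → (∀ z < d, z ≠ x → s.reg z = s₀.reg z) →
      s.reg x = i → EvalsTo M p (d + 3) s (f i) y) :
    ∀ k i : ℕ, i + k = b → ∀ s : State, s.mem = s₀.mem →
      (∀ z < d, z ≠ x → s.reg z = s₀.reg z) → s.reg x = i → s.reg d = b →
      s.reg (d + 1) = ∑ j ∈ Finset.range i, f j →
      ∃ s' t, Exec M (.while (.op .lt (.reg x) (.reg d)) <| .seq p <|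
        .seq (.assign (d + 1) (.op .add (.reg (d + 1)) (.reg (d + 3)))) <|
          .assign x (.op .add (.reg x) (.const 1))) s s' t ∧ t ≤ k * (y + 12) + 4 ∧
        s'.mem = s.mem ∧ s'.reg (d + 1) = ∑ j ∈ Finset.range b, f j ∧
        s'.reg (d + 2) = s.reg (d + 2) ∧ (∀ z < d, z ≠ x → s'.reg z = s.reg z) := by
  intro k
  induction k with
  | zero =>
    intro i hi s hm hr h1 h2 h3
    refine ⟨s, _, Exec.while_false ?_, ?_, rfl, ?_, rfl, fun _ _ _ => rfl⟩
    · simp [Expr.eval, Op.eval, h1, h2]; omega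
    · simp [Expr.cost]
    · rw [h3]; simp at hi; rw [hi]
  | succ k ih =>
    intro i hi s hm hr h1 h2 h3
    have hib : i < b := by omega
    obtain ⟨s1, t1, e1, ht1, hm1, hv1, hr1⟩ := hp i hib s hm hr h1
    have hsum : ∑ j ∈ Finset.range (i + 1), f j ≤ B * y := by
      calc _ ≤ ∑ j ∈ Finset.range (i + 1), y :=
            Finset.sum_le_sum fun j hj => hf j (by simp at hj; omega)
        _ = (i + 1) * y := by simp
        _ ≤ _ := Nat.mul_le_mul_right _ (by omega)
    set s2 := s1.set (d + 1) (∑ j ∈ Finset.range (i + 1), f j) with hs2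
    have e2 : Exec M (.assign (d + 1) (.op .add (.reg (d + 1)) (.reg (d + 3)))) s1 s2 4 := by
      refine Exec.of_eq (Exec.set ?_ (by omega)) rfl rfl
      simp [Expr.eval, Op.eval, hv1, hr1 (d + 1) (by omega), h3, Finset.sum_range_succ]
    have e3 : Exec M (.assign x (.op .add (.reg x) (.const 1))) s2 (s2.set x (i + 1)) 4 := by
      refine Exec.of_eq (Exec.set ?_ (by omega)) rfl rfl
      have : x ≠ d + 1 := by omega
      simp [Expr.eval, Op.eval, hs2, State.set_reg, this, hr1 x (by omega), h1]
    set s3 := s2.set x (i + 1) with hs3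
    have hk : ∀ z, z < d + 3 → z ≠ x → z ≠ d + 1 → s3.reg z = s.reg z := by
      intro z hz hzx hzd
      simp [hs3, hs2, State.set_reg, hzx, hzd, hr1 z hz]
    obtain ⟨s4, t4, e4, ht4, hm4, hv4, hr4, hr4'⟩ := ih (i + 1) (by omega) s3
      (by simp [hs3, hs2, hm1, hm]) (fun z hz hzx => by
        rw [hk z (by omega) hzx (by omega), hr z hz hzx]) (by simp [hs3])
      (by rw [hk d (by omega) (by omega) (by omega), h2])
      (by have : d + 1 ≠ x := by omega
          simp [hs3, hs2, State.set_reg, this])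
    refine ⟨s4, _, Exec.while_true ?_ (Exec.seq e1 (Exec.seq e2 e3)) e4, ?_, ?_, hv4, ?_, ?_⟩
    · simp [Expr.eval, Op.eval, h1, h2, hib]
    · simp only [Expr.cost]; nlinarith
    · rw [hm4]; simp [hs3, hs2, hm1]
    · rw [hr4, hk _ (by omega) (by omega) (by omega)]
    · intro z hz hzx
      rw [hr4' z hz hzx, hk z (by omega) hzx (by omega)]

/-- Registers from `d` on serve as a stack of intermediate results, so evaluating a subterm disturbs
nothing below its own base. The summation variable of a sum is the one exception; it is saved in `d
+ 2` and restored. One and the same power of `N` bounds the value and the time. -/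
theorem Tm.exec_compile (e : Tm) : ∀ {N M d : ℕ} {s h : State}, 2 ≤ N → e.wf → h.Bdd N →
    s.Agree h → numVars ≤ d → N ^ e.exp < M →
    EvalsTo M (e.compile d) d s (e.eval h) (N ^ e.exp) := by
  induction e with
  | const k =>
    intro N M d s h hN hw H hs hd hM
    refine ⟨s.set d k, _, Exec.set rfl ?_, ?_, rfl, by simp [eval], fun y hy => ?_⟩
    · exact (Tm.eval_le (.const k) (h := h) hN hw H).trans_lt hM
    · exact two_le_pow hN (.const k)
    · simp [State.set_reg, hy.ne]
  | reg x =>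
    intro N M d s h hN hw H hs hd hM
    have hx : x < numVars := by simpa [wf, Nat.blt_eq] using hw
    refine ⟨s.set d (h.reg x), _, Exec.set (hs.1 x hx) ?_, ?_, rfl, by simp [eval], fun y hy => ?_⟩
    · exact (Tm.eval_le (.reg x) (h := h) hN hw H).trans_lt hM
    · exact two_le_pow hN (.reg x)
    · simp [State.set_reg, hy.ne]
  | load a ih =>
    intro N M d s h hN hw H hs hd hM
    have hM' : N ^ a.exp < M :=
      (Nat.pow_le_pow_right (by omega) (by simp [exp])).trans_lt hM
    obtain ⟨s1, t1, e1, ht1, hm1, hv1, hr1⟩ := ih hN hw H hs hd hM'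
    refine ⟨s1.set d (h.mem (a.eval h)), _, Exec.seq e1 (Exec.set ?_ ?_), ?_, hm1,
      by simp [eval], fun y hy => ?_⟩
    · simp [Expr.eval, hv1, hm1, hs.2]
    · exact (Tm.eval_le (.load a) (h := h) hN hw H).trans_lt hM
    · have := two_le_pow hN a
      simp only [exp, pow_add, Expr.cost]
      nlinarith [Nat.mul_le_mul hN hN]
    · simp [State.set_reg, hy.ne, hr1 y hy]
  | op o a b iha ihb =>
    intro N M d s h hN hw H hs hd hM
    have hw' := hw
    simp only [wf, Bool.and_eq_true] at hw'
    have hMa : N ^ a.exp < M :=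
      (Nat.pow_le_pow_right (by omega) (by simp only [exp]; omega)).trans_lt hM
    have hMb : N ^ b.exp < M :=
      (Nat.pow_le_pow_right (by omega) (by simp only [exp]; omega)).trans_lt hM
    obtain ⟨s1, t1, e1, ht1, hm1, hv1, hr1⟩ := iha hN hw'.1 H hs hd hMa
    have hs1 : s1.Agree h := ⟨fun x hx => by rw [hr1 x (by omega), hs.1 x hx], by rw [hm1, hs.2]⟩
    obtain ⟨s2, t2, e2, ht2, hm2, hv2, hr2⟩ := ihb hN hw'.2 H hs1 (d := d + 1) (by omega) hMb
    refine ⟨s2.set d (o.eval (a.eval h) (b.eval h)), _,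
      Exec.seq e1 (Exec.seq e2 (Exec.set ?_ ?_)), ?_, ?_, by simp [eval], fun y hy => ?_⟩
    · simp [Expr.eval, hv2, hr2 d (by omega), hv1]
    · exact (Tm.eval_le (.op o a b) (h := h) hN hw H).trans_lt hM
    · have h1 := two_le_pow hN a
      have h2 := two_le_pow hN b
      have h3 : N ^ a.exp * N ^ b.exp * 2 ≤ N ^ a.exp * N ^ b.exp * N := Nat.mul_le_mul_left _ hN
      simp only [exp, pow_add, Expr.cost, pow_one]
      nlinarith
    · simp [hm2, hm1]
    · simp [State.set_reg, hy.ne, hr2 y (by omega), hr1 y hy]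
  | sum x b e ihb ihe =>
    intro N M d s h hN hw H hs hd hM
    have hval := (Tm.eval_le (.sum x b e) (h := h) hN hw H)
    have hw' := hw
    simp only [wf, Bool.and_eq_true, Nat.blt_eq] at hw'
    obtain ⟨hx, hwb, hwe⟩ := hw'
    have hMb : N ^ b.exp < M :=
      (Nat.pow_le_pow_right (by omega) (by simp only [exp]; omega)).trans_lt hM
    have hB2 : 2 ≤ N ^ b.exp := two_le_pow hN b
    have hy2 : 2 ≤ (N ^ b.exp) ^ e.exp := two_le_pow hB2 e
    have hNB : N ≤ N ^ b.exp := Nat.le_self_pow b.exp_pos.ne' N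
    have hbB := Tm.eval_le b hN hwb H
    -- The summand `4` in the exponent of a sum pays for the `12` extra steps per iteration and for
    -- the steps outside the loop.
    have h16 : 16 ≤ N ^ 4 := by
      calc 16 = 2 ^ 4 := by norm_num
        _ ≤ _ := Nat.pow_le_pow_left hN 4
    have hE : N ^ (Tm.sum x b e).exp = N ^ b.exp * (N ^ b.exp) ^ e.exp * N ^ 4 := by
      rw [← pow_mul, ← pow_add, ← pow_add]; rfl
    rw [hE] at hM hval ⊢
    generalize hB : N ^ b.exp = B at *
    generalize hY : B ^ e.exp = Y at *
    have h16' : B * Y * 16 ≤ B * Y * N ^ 4 := Nat.mul_le_mul_left _ h16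
    have hYM : Y < M := by nlinarith
    have hloopM : B * Y + B + 1 < M := by nlinarith
    have hf : ∀ i < b.eval h, e.eval (h.set x i) ≤ Y := fun i hi => hY ▸
      Tm.eval_le e hB2 hwe ((H.mono hNB).set (hi.le.trans hbB))
    obtain ⟨s1, t1, e1, ht1, hm1, hv1, hr1⟩ := ihb hN hwb H hs hd (hB ▸ hMb)
    have hxd : x < d := by omega
    set s2 := s1.set (d + 2) (h.reg x) with hs2
    have hxB : h.reg x ≤ B := (H.1 x hx).trans hNB
    have e2 : Exec M (.assign (d + 2) (.reg x)) s1 s2 2 := by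
      refine Exec.of_eq (Exec.set ?_ (by omega)) rfl rfl
      simp [Expr.eval, hr1 x hxd, hs.1 x hx]
    set s3 := s2.set x 0 with hs3
    have e3 : Exec M (.assign x (.const 0)) s2 s3 2 := Exec.set rfl (by omega)
    set s4 := s3.set (d + 1) 0 with hs4
    have e4 : Exec M (.assign (d + 1) (.const 0)) s3 s4 2 := Exec.set rfl (by omega)
    have hr4 : ∀ z ≤ d, z ≠ x → s4.reg z = s1.reg z := by
      intro z hz hzx
      have h1 : z ≠ d + 1 := by omega
      have h2 : z ≠ d + 2 := by omega
      simp [hs4, hs3, hs2, State.set_reg, h1, h2, hzx]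
    have hm4 : s4.mem = h.mem := by simp [hs4, hs3, hs2, hm1, hs.2]
    obtain ⟨s5, t5, e5, ht5, hm5, hv5, hr5, hr5'⟩ := exec_sum_loop (M := M) (d := d) (x := x)
      (B := B) (y := Y) (p := e.compile (d + 3)) (s₀ := s4) (b := b.eval h)
      (f := fun i => e.eval (h.set x i)) hxd hbB hloopM hf
      (by
        intro i hi s' hm' hr' hx'
        have := ihe (N := B) (M := M) (d := d + 3) (s := s') (h := h.set x i) hB2 hwe
          ((H.mono hNB).set (hi.le.trans hbB)) ?_ (by omega) (by rwa [hY])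
        · rwa [hY] at this
        · refine ⟨fun z hz => ?_, by rw [hm', hm4]; rfl⟩
          rw [State.set_reg]
          split_ifs with hzx
          · rw [hzx, hx']
          · rw [hr' z (by omega) hzx, hr4 z (by omega) hzx, hr1 z (by omega), hs.1 z hz])
      (b.eval h) 0 (by simp) s4 rfl (fun _ _ _ => rfl)
      (by have : x ≠ d + 1 := by omega
          simp [hs4, hs3, State.set_reg, this])
      (by rw [hr4 d le_rfl (by omega), hv1]) (by simp [hs4])
    have hfin : ∑ j ∈ Finset.range (b.eval h), e.eval (h.set x j) = (Tm.sum x b e).eval h := rfl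
    rw [hfin] at hv5
    set s6 := s5.set d ((Tm.sum x b e).eval h) with hs6
    have e6 : Exec M (.assign d (.reg (d + 1))) s5 s6 2 := by
      refine Exec.of_eq (Exec.set ?_ (by omega)) rfl rfl
      simp [Expr.eval, hv5]
    set s7 := s6.set x (h.reg x) with hs7
    have e7 : Exec M (.assign x (.reg (d + 2))) s6 s7 2 := by
      refine Exec.of_eq (Exec.set ?_ (by omega)) rfl rfl
      have h1 : d + 2 ≠ x := by omega
      simp [Expr.eval, hs6, State.set_reg, hr5, hs4, hs3, hs2, h1]
    refine ⟨s7, _, Exec.seq e1 (Exec.seq e2 (Exec.seq e3 (Exec.seq e4 (Exec.seq e5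
      (Exec.seq e6 e7))))), ?_, ?_, ?_, fun z hz => ?_⟩
    · have : b.eval h * (Y + 12) ≤ B * (Y + 12) := Nat.mul_le_mul_right _ hbB
      nlinarith
    · simp [hs7, hs6, hm5, hm4, hs.2]
    · have h1 : d ≠ x := by omega
      simp [hs7, hs6, State.set_reg, h1]
    · by_cases hzx : z = x
      · subst hzx; simp [hs7, hs.1 z hx]
      · simp [hs7, hs6, State.set_reg, hz.ne, hzx, hr5' z hz hzx, hr4 z hz.le hzx, hr1 z hz]

/-! ### Commands -/

/-- Commands over terms with bounded sums. -/
inductive Cmd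
  | skip
  | assign (x : ℕ) (e : Tm)
  | store (a e : Tm)
  | seq (p q : Cmd)
  | ite (e : Tm) (p q : Cmd)
  | while (e : Tm) (p : Cmd)

/-- All registers of the command are below `numVars`. -/
def Cmd.wf : Cmd → Bool
  | skip => true
  | assign x e => x.blt numVars && e.wf
  | store a e => a.wf && e.wf
  | seq p q => p.wf && q.wf
  | ite e p q => e.wf && (p.wf && q.wf)
  | .while e p => e.wf && p.wf

/-- The exponent in the bounds for the space and for the time of an elementary step. -/
def Cmd.exp : Cmd → ℕ
  | skip => 1
  | assign _ e => e.exp + 4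
  | store a e => a.exp + e.exp + 4
  | seq p q => p.exp + q.exp
  | ite e p q => e.exp + p.exp + q.exp + 4
  | .while e p => e.exp + p.exp + 4

/-- Translation of commands into programs. -/
def Cmd.compile : Cmd → Prog
  | skip => .skip
  | assign x e => .seq (e.compile numVars) (.assign x (.reg numVars))
  | store a e => .seq (a.compile numVars) (.seq (e.compile (numVars + 1))
      (.store (.reg numVars) (.reg (numVars + 1))))
  | seq p q => .seq p.compile q.compile
  | ite e p q => .seq (e.compile numVars) (.ite (.reg numVars) p.compile q.compile)
  | .while e p => .seq (e.compile numVars)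
      (.while (.reg numVars) (.seq p.compile (e.compile numVars)))

/-- Execution of a command with values up to `N`; the last argument counts elementary steps. -/
inductive HExec (N : ℕ) : Cmd → State → State → ℕ → Prop
  | skip (h : State) : HExec N .skip h h 1
  | assign (h : State) (x : ℕ) (e : Tm) (hv : e.eval h ≤ N) :
      HExec N (.assign x e) h (h.set x (e.eval h)) 1
  | store (h : State) (a e : Tm) (hv : e.eval h ≤ N) :
      HExec N (.store a e) h (h.put (a.eval h) (e.eval h)) 1
  | seq {p q : Cmd} {h h' h'' : State} {k k' : ℕ} (hp : HExec N p h h' k)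
      (hq : HExec N q h' h'' k') : HExec N (.seq p q) h h'' (k + k')
  | ite_true {e : Tm} {p q : Cmd} {h h' : State} {k : ℕ} (he : e.eval h ≠ 0)
      (hp : HExec N p h h' k) : HExec N (.ite e p q) h h' (k + 1)
  | ite_false {e : Tm} {p q : Cmd} {h h' : State} {k : ℕ} (he : e.eval h = 0)
      (hq : HExec N q h h' k) : HExec N (.ite e p q) h h' (k + 1)
  | while_true {e : Tm} {p : Cmd} {h h' h'' : State} {k k' : ℕ} (he : e.eval h ≠ 0)
      (hp : HExec N p h h' k) (hw : HExec N (.while e p) h' h'' k') :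
      HExec N (.while e p) h h'' (k + k' + 1)
  | while_false {e : Tm} {p : Cmd} {h : State} (he : e.eval h = 0) :
      HExec N (.while e p) h h 1

/-! ### Simulation of commands by programs -/

theorem HExec.bdd {N : ℕ} {c : Cmd} {h h' : State} {k : ℕ} (H : HExec N c h h' k) :
    h.Bdd N → h'.Bdd N := by
  induction H with
  | skip => exact id
  | assign h x e hv => exact fun H => H.set hv
  | store h a e hv => exact fun H => H.put hv
  | seq _ _ ih1 ih2 => exact fun H => ih2 (ih1 H)
  | ite_true _ _ ih => exact ih
  | ite_false _ _ ih => exact ih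
  | while_true _ _ _ ih1 ih2 => exact fun H => ih2 (ih1 H)
  | while_false _ => exact id

theorem State.Agree.of_evalsTo {s s' h : State} (hs : s.Agree h) {d : ℕ} (hd : numVars ≤ d)
    (hm : s'.mem = s.mem) (hr : ∀ y < d, s'.reg y = s.reg y) : s'.Agree h :=
  ⟨fun x hx => by rw [hr x (by omega), hs.1 x hx], by rw [hm, hs.2]⟩

theorem State.Agree.set {s h : State} (hs : s.Agree h) (x v : ℕ) :
    (s.set x v).Agree (h.set x v) :=
  ⟨fun y hy => by simp only [State.set_reg]; split_ifs; exacts [rfl, hs.1 y hy], hs.2⟩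

/-- Commands are compiled correctly, with polynomial overhead in time and space. -/
theorem HExec.exec {N M : ℕ} (hN : 2 ≤ N) {c : Cmd} {h h' : State} {k : ℕ}
    (H : HExec N c h h' k) : c.wf → h.Bdd N → N ^ c.exp < M → ∀ s : State, s.Agree h →
    ∃ s' t, Exec M c.compile s s' t ∧ t ≤ k * N ^ c.exp ∧ s'.Agree h' := by
  have hpow : ∀ {a b : ℕ}, a ≤ b → N ^ a ≤ N ^ b := fun h => Nat.pow_le_pow_right (by omega) h
  have h16 : 16 ≤ N ^ 4 := by
    calc 16 = 2 ^ 4 := by norm_num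
      _ ≤ _ := Nat.pow_le_pow_left hN 4
  have h1N : ∀ a, 1 ≤ N ^ a := fun a => Nat.one_le_pow _ _ (by omega)
  induction H with
  | skip h =>
    intro _ _ hM s hs
    exact ⟨s, 1, .skip s, by simp [Cmd.exp]; omega, hs⟩
  | assign h x e hv =>
    intro hw hb hM s hs
    simp only [Cmd.wf, Bool.and_eq_true, Nat.blt_eq] at hw
    simp only [Cmd.exp] at hM
    obtain ⟨s1, t1, e1, ht1, hm1, hv1, hr1⟩ := e.exec_compile hN hw.2 hb hs le_rfl
      ((hpow (by omega)).trans_lt hM)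
    have hNM : N < M := (Nat.le_self_pow (by omega) N).trans_lt hM
    refine ⟨_, _, .seq e1 (Exec.set (s := s1) (e := .reg numVars) hv1 (hv.trans_lt hNM)), ?_,
      (hs.of_evalsTo le_rfl hm1 hr1).set _ _⟩
    have := Tm.two_le_pow hN e
    rw [Cmd.exp, pow_add]
    simp only [Expr.cost]; nlinarith
  | store h a e hv =>
    intro hw hb hM s hs
    simp only [Cmd.wf, Bool.and_eq_true] at hw
    simp only [Cmd.exp] at hM
    obtain ⟨s1, t1, e1, ht1, hm1, hv1, hr1⟩ := a.exec_compile hN hw.1 hb hs le_rfl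
      ((hpow (by omega)).trans_lt hM)
    have hs1 := hs.of_evalsTo le_rfl hm1 hr1
    obtain ⟨s2, t2, e2, ht2, hm2, hv2, hr2⟩ := e.exec_compile (d := numVars + 1) hN hw.2 hb hs1
      (by omega) ((hpow (by omega)).trans_lt hM)
    have hs2 := hs1.of_evalsTo (by omega) hm2 hr2
    have hNM : N < M := (Nat.le_self_pow (by omega) N).trans_lt hM
    have ha : (Expr.reg numVars).eval s2 = a.eval h := by
      simp [Expr.eval, hr2 numVars (by omega), hv1]
    have he : (Expr.reg (numVars + 1)).eval s2 = e.eval h := hv2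
    refine ⟨_, _, .seq e1 (.seq e2 (.store s2 _ _ ?_ ?_)), ?_, ?_, ?_⟩
    · rw [ha]
      exact (a.eval_le hN hw.1 hb).trans_lt ((hpow (by omega)).trans_lt hM)
    · rw [he]; omega
    · have h1 := Tm.two_le_pow hN e
      have h2 := Tm.two_le_pow hN a
      have h3 : N ^ a.exp * N ^ e.exp * 16 ≤ N ^ a.exp * N ^ e.exp * N ^ 4 :=
        Nat.mul_le_mul_left _ h16
      simp only [Cmd.exp, pow_add, Expr.cost]; nlinarith
    · exact hs2.1
    · rw [ha, he]; simp only [State.put]; rw [hs2.2]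
  | @seq p q h h' h'' k k' hp hq ihp ihq =>
    intro hw hb hM s hs
    simp only [Cmd.wf, Bool.and_eq_true] at hw
    simp only [Cmd.exp] at hM
    obtain ⟨s1, t1, e1, ht1, hs1⟩ := ihp hw.1 hb ((hpow (by omega)).trans_lt hM) s hs
    obtain ⟨s2, t2, e2, ht2, hs2⟩ := ihq hw.2 (hp.bdd hb) ((hpow (by omega)).trans_lt hM) s1 hs1
    refine ⟨s2, _, .seq e1 e2, ?_, hs2⟩
    have h1 : k * N ^ p.exp ≤ k * N ^ (p.exp + q.exp) := Nat.mul_le_mul_left _ (hpow (by omega))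
    have h2 : k' * N ^ q.exp ≤ k' * N ^ (p.exp + q.exp) := Nat.mul_le_mul_left _ (hpow (by omega))
    simp only [Cmd.exp]; nlinarith
  | @ite_true e p q h h' k he hp ih =>
    intro hw hb hM s hs
    simp only [Cmd.wf, Bool.and_eq_true] at hw
    simp only [Cmd.exp] at hM
    obtain ⟨s1, t1, e1, ht1, hm1, hv1, hr1⟩ := e.exec_compile hN hw.1 hb hs le_rfl
      ((hpow (by omega)).trans_lt hM)
    obtain ⟨s2, t2, e2, ht2, hs2⟩ := ih hw.2.1 hb ((hpow (by omega)).trans_lt hM) s1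
      (hs.of_evalsTo le_rfl hm1 hr1)
    refine ⟨s2, _, .seq e1 (.ite_true ?_ e2), ?_, hs2⟩
    · rwa [Expr.eval, hv1]
    · have h0 := Tm.two_le_pow hN e
      have h1 : k * N ^ p.exp ≤ k * N ^ (e.exp + p.exp + q.exp + 4) :=
        Nat.mul_le_mul_left _ (hpow (by omega))
      have h2 : N ^ (e.exp + 4) ≤ N ^ (e.exp + p.exp + q.exp + 4) := hpow (by omega)
      rw [pow_add] at h2
      simp only [Cmd.exp, Expr.cost]; nlinarith
  | @ite_false e p q h h' k he hp ih =>
    intro hw hb hM s hs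
    simp only [Cmd.wf, Bool.and_eq_true] at hw
    simp only [Cmd.exp] at hM
    obtain ⟨s1, t1, e1, ht1, hm1, hv1, hr1⟩ := e.exec_compile hN hw.1 hb hs le_rfl
      ((hpow (by omega)).trans_lt hM)
    obtain ⟨s2, t2, e2, ht2, hs2⟩ := ih hw.2.2 hb ((hpow (by omega)).trans_lt hM) s1
      (hs.of_evalsTo le_rfl hm1 hr1)
    refine ⟨s2, _, .seq e1 (.ite_false ?_ e2), ?_, hs2⟩
    · rwa [Expr.eval, hv1]
    · have h0 := Tm.two_le_pow hN e
      have h1 : k * N ^ q.exp ≤ k * N ^ (e.exp + p.exp + q.exp + 4) :=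
        Nat.mul_le_mul_left _ (hpow (by omega))
      have h2 : N ^ (e.exp + 4) ≤ N ^ (e.exp + p.exp + q.exp + 4) := hpow (by omega)
      rw [pow_add] at h2
      simp only [Cmd.exp, Expr.cost]; nlinarith
  | @while_true e p h h' h'' k k' he hp hw' ih1 ih2 =>
    intro hw hb hM s hs
    have hw0 := hw
    simp only [Cmd.wf, Bool.and_eq_true] at hw
    have hM0 := hM
    simp only [Cmd.exp] at hM
    obtain ⟨s1, t1, e1, ht1, hm1, hv1, hr1⟩ := e.exec_compile hN hw.1 hb hs le_rfl
      ((hpow (by omega)).trans_lt hM)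
    obtain ⟨s2, t2, e2, ht2, hs2⟩ := ih1 hw.2 hb ((hpow (by omega)).trans_lt hM) s1
      (hs.of_evalsTo le_rfl hm1 hr1)
    obtain ⟨s3, t3, e3, ht3, hs3⟩ := ih2 hw0 (hp.bdd hb) hM0 s2 hs2
    -- A compiled loop evaluates its condition once in front and again at the end of the body. The
    -- evaluation that opens the remaining run is therefore regrouped as the end of the current
    -- iteration.
    cases e3 with
    | @seq _ _ _ s2' _ t2' t3' hA hB =>
      refine ⟨s3, _, .seq e1 (.while_true ?_ (.seq e2 hA) hB), ?_, hs3⟩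
      · rwa [Expr.eval, hv1]
      · have h0 := Tm.two_le_pow hN e
        have h1 : k * N ^ p.exp ≤ k * N ^ (e.exp + p.exp + 4) :=
          Nat.mul_le_mul_left _ (hpow (by omega))
        have h2 : N ^ (e.exp + 4) ≤ N ^ (e.exp + p.exp + 4) := hpow (by omega)
        rw [pow_add] at h2
        simp only [Cmd.exp, Expr.cost] at ht3 ⊢
        nlinarith
  | @while_false e p h he =>
    intro hw hb hM s hs
    simp only [Cmd.wf, Bool.and_eq_true] at hw
    simp only [Cmd.exp] at hM
    obtain ⟨s1, t1, e1, ht1, hm1, hv1, hr1⟩ := e.exec_compile hN hw.1 hb hs le_rfl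
      ((hpow (by omega)).trans_lt hM)
    refine ⟨s1, _, .seq e1 (.while_false ?_), ?_, hs.of_evalsTo le_rfl hm1 hr1⟩
    · rwa [Expr.eval, hv1]
    · have h0 := Tm.two_le_pow hN e
      have h2 : N ^ (e.exp + 4) ≤ N ^ (e.exp + p.exp + 4) := hpow (by omega)
      rw [pow_add] at h2
      simp only [Cmd.exp, Expr.cost]; nlinarith

end RAM

/-! ### Source components -/

namespace MaxLeaf

open Classical in
/-- The number of elements of a finite set with a property. -/
noncomputable def count (s : Finset ℕ) (p : ℕ → Prop) : ℕ := (s.filter p).card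

section

variable {n : ℕ} {g : ℕ → ℕ → Prop} {I J U S : Finset ℕ} {r t v w x : ℕ}

/-- Reachability along arcs that leave vertices of `I`. -/
def Reach (g : ℕ → ℕ → Prop) (I : Finset ℕ) : ℕ → ℕ → Prop :=
  Relation.ReflTransGen fun a b => a ∈ I ∧ g a b

theorem Reach.mono (h : I ⊆ J) (H : Reach g I v w) : Reach g J v w :=
  Relation.ReflTransGen.mono (p := fun a b => a ∈ J ∧ g a b) (fun _ _ hab => ⟨h hab.1, hab.2⟩) _ _ H

theorem Reach.trans (h₁ : Reach g I v w) (h₂ : Reach g I w x) : Reach g I v x :=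
  Relation.ReflTransGen.trans h₁ h₂

/-- With the vertices of `S` as internal vertices every vertex is reached from the root `r`. -/
def Feasible (n : ℕ) (g : ℕ → ℕ → Prop) (r : ℕ) (S : Finset ℕ) : Prop :=
  r ∈ S ∧ ∀ x < n, Reach g S r x

/-- `t` is the least vertex of a strong component that is not entered by arcs leaving `I` and does
not contain the root. -/
def IsRep (n : ℕ) (g : ℕ → ℕ → Prop) (I : Finset ℕ) (r t : ℕ) : Prop :=
  t < n ∧ ¬ Reach g I r t ∧ ∀ w < n, Reach g I w t → Reach g I t w ∧ t ≤ w

/-- `v` has an arc into the source component of `t`. -/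
def Enters (n : ℕ) (g : ℕ → ℕ → Prop) (I : Finset ℕ) (v t : ℕ) : Prop :=
  v ≠ t ∧ ∃ w < n, Reach g I w t ∧ g v w

open Classical in
/-- The representatives of the source components. -/
noncomputable def reps (n : ℕ) (g : ℕ → ℕ → Prop) (I : Finset ℕ) (r : ℕ) : Finset ℕ :=
  (Finset.range n).filter (IsRep n g I r)

/-- The number of vertices of `U` which enter the source component of `t`. -/
noncomputable def inDeg (n : ℕ) (g : ℕ → ℕ → Prop) (I U : Finset ℕ) (t : ℕ) : ℕ :=
  count U fun v => Enters n g I v t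

/-- The number of source components entered by `v`. -/
noncomputable def outDeg (n : ℕ) (g : ℕ → ℕ → Prop) (I : Finset ℕ) (r v : ℕ) : ℕ :=
  count (reps n g I r) fun t => Enters n g I v t

theorem mem_reps : t ∈ reps n g I r ↔ IsRep n g I r t := by
  simp only [reps, Finset.mem_filter, Finset.mem_range, and_iff_right_iff_imp]
  exact fun h => h.1

/-- Take an ancestor of `x` with as few ancestors as possible, and the least such vertex; `key`
orders lexicographically because vertices are below `n`. Every ancestor of it has the same set of
ancestors and is therefore reached back from it. -/
theorem exists_rep (hx : x < n) (h : ¬ Reach g I r x) :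
    ∃ t, IsRep n g I r t ∧ Reach g I t x := by
  classical
  let anc : ℕ → Finset ℕ := fun w => (Finset.range n).filter fun z => Reach g I z w
  let key : ℕ → ℕ := fun w => (anc w).card * n + w
  obtain ⟨w, hw, hmin⟩ := Finset.exists_min_image (anc x) key
    ⟨x, by simp only [anc, Finset.mem_filter, Finset.mem_range]; exact ⟨hx, .refl⟩⟩
  simp only [anc, Finset.mem_filter, Finset.mem_range] at hw
  refine ⟨w, ⟨hw.1, fun hr => h (hr.trans hw.2), fun z hz hzw => ?_⟩, hw.2⟩
  have hk : key w ≤ key z := hmin z (by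
    simp only [anc, Finset.mem_filter, Finset.mem_range]; exact ⟨hz, hzw.trans hw.2⟩)
  have hsub : anc z ⊆ anc w := fun y hy => by
    simp only [anc, Finset.mem_filter] at hy ⊢
    exact ⟨hy.1, hy.2.trans hzw⟩
  have hle := Finset.card_le_card hsub
  simp only [key] at hk
  have hcard : (anc w).card ≤ (anc z).card := by
    by_contra hlt
    have : ((anc z).card + 1) * n ≤ (anc w).card * n := Nat.mul_le_mul_right _ (by omega)
    rw [add_mul] at this
    omega
  have heq := Finset.eq_of_subset_of_card_le hsub hcard
  constructor
  · have : w ∈ anc z := by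
      rw [heq]; simp only [anc, Finset.mem_filter, Finset.mem_range]; exact ⟨hw.1, .refl⟩
    exact (Finset.mem_filter.1 this).2
  · rw [heq] at hk; omega

theorem IsRep.eq_of_reach {t' : ℕ} (h : IsRep n g I r t) (h' : IsRep n g I r t')
    (H : Reach g I t t') : t = t' :=
  le_antisymm (h.2.2 t' h'.1 (h'.2.2 t h.1 H).1).2 (h'.2.2 t h.1 H).2

/-- Every new representative is reached from an old one. Choosing such an old representative is
injective, since a new representative reaches back to everything that reaches it. At most one of the
old components entered by `v` is chosen, so all the others have disappeared. -/
theorem card_reps_insert (hg : ∀ a b, g a b → a < n ∧ b < n) (v : ℕ) :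
    (reps n g (insert v I) r).card ≤ (reps n g I r).card ∧
    (reps n g (insert v I) r).card + outDeg n g I r v ≤ (reps n g I r).card + 1 := by
  classical
  have hsub : I ⊆ insert v I := Finset.subset_insert _ _
  have hex : ∀ t' ∈ reps n g (insert v I) r, ∃ t, IsRep n g I r t ∧ Reach g I t t' :=
    fun t' ht' => by
      have h := mem_reps.1 ht'
      exact exists_rep h.1 fun hr => h.2.1 (hr.mono hsub)
  choose! f hf hft using hex
  have hinj : Set.InjOn f (reps n g (insert v I) r) := by
    intro a ha b hb hab
    have ha' := mem_reps.1 ha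
    have hb' := mem_reps.1 hb
    have h1 := (hft a ha).mono hsub
    have h2 := (hft b hb).mono hsub
    rw [← hab] at h2
    have h3 := (ha'.2.2 _ (hf a ha).1 h1).1
    exact ha'.eq_of_reach hb' (h3.trans h2)
  have himg : (reps n g (insert v I) r).image f ⊆ reps n g I r := by
    intro t ht
    obtain ⟨a, ha, rfl⟩ := Finset.mem_image.1 ht
    exact mem_reps.2 (hf a ha)
  have hcard := Finset.card_image_of_injOn hinj
  refine ⟨hcard ▸ Finset.card_le_card himg, ?_⟩
  set D := (reps n g I r).filter fun t => Enters n g I v t with hD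
  have hDc : outDeg n g I r v = D.card := by
    simp only [outDeg, count, hD]
  -- If `v` enters the old components below `a'` and `b'`, then `v` now reaches both. As `a'`
  -- represents a source component it reaches `v`, hence `b'`, and the two representatives coincide.
  have hint : ((reps n g (insert v I) r).image f ∩ D).card ≤ 1 := by
    rw [Finset.card_le_one]
    intro a ha b hb
    simp only [Finset.mem_inter, Finset.mem_image, hD, Finset.mem_filter] at ha hb
    obtain ⟨⟨a', ha', rfl⟩, -, -, x, -, hx, hvx⟩ := ha
    obtain ⟨⟨b', hb', rfl⟩, -, -, y, -, hy, hvy⟩ := hb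
    have hva : Reach g (insert v I) v a' := Relation.ReflTransGen.head
      ⟨Finset.mem_insert_self _ _, hvx⟩ ((hx.trans (hft a' ha')).mono hsub)
    have hvb : Reach g (insert v I) v b' := Relation.ReflTransGen.head
      ⟨Finset.mem_insert_self _ _, hvy⟩ ((hy.trans (hft b' hb')).mono hsub)
    have hvn := (hg _ _ hvx).1
    have h1 := ((mem_reps.1 ha').2.2 v hvn hva).1
    rw [(mem_reps.1 ha').eq_of_reach (mem_reps.1 hb') (h1.trans hvb)]
  have hun : ((reps n g (insert v I) r).image f ∪ D).card ≤ (reps n g I r).card :=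
    Finset.card_le_card (Finset.union_subset himg (Finset.filter_subset _ _))
  have := Finset.card_union_add_card_inter ((reps n g (insert v I) r).image f) D
  omega

theorem inDeg_erase (h : v ∈ U) (he : Enters n g I v t) :
    inDeg n g I (U.erase v) t + 1 = inDeg n g I U t := by
  classical
  unfold inDeg count
  rw [Finset.filter_erase]
  exact Finset.card_erase_add_one (Finset.mem_filter.2 ⟨h, he⟩)

theorem exists_enters_of_inDeg_pos (h : 0 < inDeg n g I U t) : ∃ v ∈ U, Enters n g I v t := by
  classical
  unfold inDeg count at h
  obtain ⟨v, hv⟩ := Finset.card_pos.1 h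
  exact ⟨v, Finset.mem_filter.1 hv⟩

/-- Some source component cannot be entered any more. -/
def Bad (n : ℕ) (g : ℕ → ℕ → Prop) (I U : Finset ℕ) (r : ℕ) : Prop :=
  ∃ t ∈ reps n g I r, inDeg n g I U t = 0

/-- Along a path from the root, the inability to reach `t` through `I` is never lost. An arc leaving
`I` cannot change it, and an arc leaving `U` that did would start at an undecided vertex entering
the component of `t`. -/
theorem Bad.not_feasible (hg : ∀ a b, g a b → a < n ∧ b < n) (h : Bad n g I U r)
    (hS : S ⊆ I ∪ U) : ¬ Feasible n g r S := by
  classical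
  rintro ⟨-, hall⟩
  obtain ⟨t, ht, h0⟩ := h
  have ht' := mem_reps.1 ht
  have key : ∀ x, Reach g S r x → ¬ Reach g I x t := by
    intro x hx
    induction hx with
    | refl => exact ht'.2.1
    | @tail b c _ hbc ih =>
      intro hc
      rcases Finset.mem_union.1 (hS hbc.1) with hb | hb
      · exact ih (Relation.ReflTransGen.head ⟨hb, hbc.2⟩ hc)
      · have : Enters n g I b t := by
          refine ⟨?_, c, (hg _ _ hbc.2).2, hc, hbc.2⟩
          rintro rfl
          exact ih .refl
        rw [inDeg, count, Finset.card_eq_zero, Finset.filter_eq_empty_iff] at h0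
        exact h0 hb this
  exact key t (hall t ht'.1) .refl

/-- If every source component is entered by at least three vertices, every vertex enters at most
three of them, and no component is entered only by three vertices of the latter kind, then there
are few source components. -/
theorem seven_mul_card_reps_le (h3 : ∀ t ∈ reps n g I r, 3 ≤ inDeg n g I U t)
    (hd : ∀ v ∈ U, outDeg n g I r v ≤ 3)
    (hex : ∀ t ∈ reps n g I r, inDeg n g I U t = 3 →
      ∃ v ∈ U, Enters n g I v t ∧ outDeg n g I r v ≤ 2) :
    7 * (reps n g I r).card ≤ 6 * U.card := by
  classical
  set R := reps n g I r
  have hin : ∀ t, inDeg n g I U t = (U.filter fun v => Enters n g I v t).card := fun t => by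
    simp only [inDeg, count]
  have hout : ∀ v, outDeg n g I r v = (R.filter fun t => Enters n g I v t).card := fun v => by
    simp only [outDeg, count]; congr!
  have hpos : ∀ t ∈ R, ∀ v ∈ U.filter (fun v => Enters n g I v t), 2 ≤ 6 / outDeg n g I r v := by
    intro t ht v hv
    rw [Finset.mem_filter] at hv
    have h1 : 0 < outDeg n g I r v := by
      rw [hout]; exact Finset.card_pos.2 ⟨t, Finset.mem_filter.2 ⟨ht, hv.2⟩⟩
    have h2 := hd v hv.1
    interval_cases outDeg n g I r v <;> simp
  -- Discharging: a vertex of `U` entering `d` components sends `6 / d` to each, which is exact for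
  -- `d ≤ 3`. A component receives `2` from each of at least four vertices, or at least `3 + 2 + 2`.
  calc 7 * R.card = ∑ t ∈ R, 7 := by simp [mul_comm]
    _ ≤ ∑ t ∈ R, ∑ v ∈ U.filter (fun v => Enters n g I v t), 6 / outDeg n g I r v := by
        refine Finset.sum_le_sum fun t ht => ?_
        have h3t := h3 t ht
        have hlow := Finset.card_nsmul_le_sum _ _ 2 (hpos t ht)
        rw [← hin, smul_eq_mul] at hlow
        rcases Nat.lt_or_ge 3 (inDeg n g I U t) with h4 | h4
        · omega
        · obtain ⟨v, hvU, hvt, hv2⟩ := hex t ht (by omega)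
          have hvm : v ∈ U.filter (fun v => Enters n g I v t) := Finset.mem_filter.2 ⟨hvU, hvt⟩
          rw [← Finset.add_sum_erase _ _ hvm]
          have h6 : 3 ≤ 6 / outDeg n g I r v := by
            have h1 : 0 < outDeg n g I r v := by
              rw [hout]; exact Finset.card_pos.2 ⟨t, Finset.mem_filter.2 ⟨ht, hvt⟩⟩
            interval_cases outDeg n g I r v <;> simp
          have hrest := Finset.card_nsmul_le_sum
            ((U.filter (fun v => Enters n g I v t)).erase v) (fun v => 6 / outDeg n g I r v) 2
            fun w hw => hpos t ht w (Finset.mem_of_mem_erase hw)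
          rw [Finset.card_erase_of_mem hvm, ← hin, smul_eq_mul] at hrest
          omega
    _ = ∑ v ∈ U, ∑ t ∈ R.filter (fun t => Enters n g I v t), 6 / outDeg n g I r v := by
        simp only [Finset.sum_filter]
        exact Finset.sum_comm
    _ ≤ ∑ v ∈ U, 6 := by
        refine Finset.sum_le_sum fun v _ => ?_
        rw [Finset.sum_const, ← hout, smul_eq_mul]
        exact Nat.mul_div_le 6 _
    _ = 6 * U.card := by simp [mul_comm]

/-! ### Branching walks -/

/-- `v` reaches `w` if `v` is added to `I`. -/
def Hits (g : ℕ → ℕ → Prop) (I : Finset ℕ) (v w : ℕ) : Prop :=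
  v = w ∨ ∃ x, g v x ∧ Reach g I x w

open Classical in
/-- The vertex sets of the branching walks from `v` with `k` steps. -/
noncomputable def walks (g : ℕ → ℕ → Prop) (I U : Finset ℕ) : ℕ → ℕ → Multiset (Finset ℕ)
  | 0, v => {{v}}
  | k + 1, v => ∑ w ∈ U.filter (Hits g I v), ∑ i : Fin (k + 1),
      (walks g I U i w).bind fun A => (walks g I U (k - i) v).map fun B => A ∪ B

open Classical in
/-- The number of branching walks from `v` with `k` steps which do not hit `X`. -/
noncomputable def numWalks (g : ℕ → ℕ → Prop) (I U X : Finset ℕ) : ℕ → ℕ → ℕ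
  | 0, v => if ∃ t ∈ X, Hits g I v t then 0 else 1
  | k + 1, v => ∑ w ∈ U.filter (Hits g I v), ∑ i : Fin (k + 1),
      numWalks g I U X i w * numWalks g I U X (k - i) v

theorem mem_walks_succ {k : ℕ} {N : Finset ℕ} : N ∈ walks g I U (k + 1) v ↔
    ∃ w ∈ U, Hits g I v w ∧ ∃ i j, i + j = k ∧ ∃ A ∈ walks g I U i w, ∃ B ∈ walks g I U j v,
      A ∪ B = N := by
  classical
  rw [walks]
  simp only [Multiset.mem_sum, Finset.mem_filter, Finset.mem_univ, true_and, Multiset.mem_bind,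
    Multiset.mem_map]
  constructor
  · rintro ⟨w, ⟨hw, hh⟩, i, A, hA, B, hB, h⟩
    exact ⟨w, hw, hh, i, k - i, by omega, A, hA, B, hB, h⟩
  · rintro ⟨w, hw, hh, i, j, hij, A, hA, B, hB, h⟩
    refine ⟨w, ⟨hw, hh⟩, ⟨i, by omega⟩, A, hA, B, ?_, h⟩
    rwa [show k - (⟨i, by omega⟩ : Fin (k + 1)) = j from by simp; omega]

-- A union of two vertex sets avoids `X` exactly if both sets do, so the indicator is multiplicative
-- and the sum over all walks obeys the product recursion of `numWalks`.
open Classical in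
theorem numWalks_eq (X : Finset ℕ) (k : ℕ) : ∀ v, numWalks g I U X k v =
    ((walks g I U k v).map fun N => if ∃ t ∈ X, ∃ a ∈ N, Hits g I a t then 0 else 1).sum := by
  induction k using Nat.strong_induction_on with
  | _ k ih =>
  intro v
  cases k with
  | zero => simp [numWalks, walks]
  | succ k =>
    rw [numWalks, walks]
    simp only [← Multiset.coe_mapAddMonoidHom, map_sum]
    rw [show ∀ s : Finset ℕ, ∀ F : ℕ → Multiset ℕ, (∑ w ∈ s, F w).sum = ∑ w ∈ s, (F w).sum from
      fun s F => map_sum Multiset.sumAddMonoidHom F s]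
    refine Finset.sum_congr rfl fun w _ => ?_
    rw [show ∀ F : Fin (k + 1) → Multiset ℕ, (∑ i, F i).sum = ∑ i, (F i).sum from
      fun F => map_sum Multiset.sumAddMonoidHom F _]
    refine Finset.sum_congr rfl fun i _ => ?_
    rw [ih i (by omega), ih (k - i) (by omega)]
    simp only [Multiset.coe_mapAddMonoidHom, Multiset.map_bind, Multiset.map_map,
      Multiset.sum_bind, Function.comp_def]
    rw [← Multiset.sum_map_mul_right]
    congr 1
    refine Multiset.map_congr rfl fun A _ => ?_
    rw [← Multiset.sum_map_mul_left]
    congr 1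
    refine Multiset.map_congr rfl fun B _ => ?_
    by_cases h1 : ∃ t ∈ X, ∃ a ∈ A, Hits g I a t
    · have h3 : ∃ t ∈ X, ∃ a ∈ A ∪ B, Hits g I a t := by
        obtain ⟨t, ht, a, ha, h⟩ := h1
        exact ⟨t, ht, a, Finset.mem_union_left _ ha, h⟩
      simp only [h1, h3, if_true, zero_mul]
    · by_cases h2 : ∃ t ∈ X, ∃ a ∈ B, Hits g I a t
      · obtain ⟨t, ht, a, ha, h⟩ := h2
        have h2 : ∃ t ∈ X, ∃ a ∈ B, Hits g I a t := ⟨t, ht, a, ha, h⟩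
        have h3 : ∃ t ∈ X, ∃ a ∈ A ∪ B, Hits g I a t :=
          ⟨t, ht, a, Finset.mem_union_right _ ha, h⟩
        simp only [h2, h3, if_true, mul_zero]
      · have h3 : ¬ ∃ t ∈ X, ∃ a ∈ A ∪ B, Hits g I a t := by
          rintro ⟨t, ht, a, ha, h⟩
          rcases Finset.mem_union.1 ha with ha | ha
          · exact h1 ⟨t, ht, a, ha, h⟩
          · exact h2 ⟨t, ht, a, ha, h⟩
        simp only [h1, h2, h3, if_false, mul_one]

/-- The set `N` hits all of `R`. -/
def Covers (g : ℕ → ℕ → Prop) (I R N : Finset ℕ) : Prop := ∀ t ∈ R, ∃ a ∈ N, Hits g I a t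

open Classical in
/-- The number of branching walks from `v` with `k` steps that hit all of `R`. -/
noncomputable def numCovering (g : ℕ → ℕ → Prop) (I U R : Finset ℕ) (k v : ℕ) : ℕ :=
  (walks g I U k v).countP (Covers g I R)

/-- Inclusion–exclusion for covering branching walks. -/
theorem sum_powerset_numWalks (R : Finset ℕ) (k v : ℕ) :
    ∑ X ∈ R.powerset, (-1 : ℤ) ^ X.card * numWalks g I U X k v = numCovering g I U R k v := by
  classical
  simp only [numWalks_eq, numCovering, Covers]
  generalize walks g I U k v = s
  induction s using Multiset.induction_on with
  | empty => simp
  | cons N s ih =>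
    simp only [Multiset.map_cons, Multiset.sum_cons, Nat.cast_add, mul_add,
      Finset.sum_add_distrib, ih, Multiset.countP_cons]
    rw [add_comm]
    congr 1
    -- For a fixed walk only the subsets of the unhit representatives survive. Their alternating sum
    -- is zero unless there is no unhit representative.
    have h1 : ∀ X ∈ R.powerset, (-1 : ℤ) ^ X.card *
        ((if ∃ t ∈ X, ∃ a ∈ N, Hits g I a t then 0 else 1 : ℕ) : ℤ) =
        if X ⊆ R.filter (fun t => ¬ ∃ a ∈ N, Hits g I a t) then (-1 : ℤ) ^ X.card else 0 := by
      intro X hX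
      rw [Finset.mem_powerset] at hX
      by_cases h : ∃ t ∈ X, ∃ a ∈ N, Hits g I a t
      · rw [if_pos h, if_neg]
        · simp
        · intro hsub
          obtain ⟨t, ht, h⟩ := h
          exact (Finset.mem_filter.1 (hsub ht)).2 h
      · rw [if_neg h, if_pos]
        · simp
        · intro t ht
          exact Finset.mem_filter.2 ⟨hX ht, fun h' => h ⟨t, ht, h'⟩⟩
    rw [Finset.sum_congr rfl h1, ← Finset.sum_filter]
    rw [show R.powerset.filter (fun X => X ⊆ R.filter (fun t => ¬ ∃ a ∈ N, Hits g I a t)) =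
      (R.filter (fun t => ¬ ∃ a ∈ N, Hits g I a t)).powerset from ?_,
      Finset.sum_powerset_neg_one_pow_card]
    · have : R.filter (fun t => ¬ ∃ a ∈ N, Hits g I a t) = ∅ ↔ Covers g I R N := by
        simp only [Finset.filter_eq_empty_iff, not_not, Covers]
      simp only [this]
      split_ifs <;> rfl
    · ext X
      simp only [Finset.mem_filter, Finset.mem_powerset]
      exact ⟨fun h => h.2, fun h => ⟨h.trans (Finset.filter_subset _ _), h⟩⟩

/-- Each step contributes the choice of a vertex and of a way to split the remaining steps, hence a
factor of at most `n * n`. This bounds the counts that have to be told from zero modulo small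
numbers. -/
theorem card_walks_le (hU : U.card ≤ n) (k : ℕ) : ∀ v, k ≤ n →
    (walks g I U k v).card ≤ (n * n) ^ k := by
  induction k using Nat.strong_induction_on with
  | _ k ih =>
  intro v hk
  cases k with
  | zero => simp [walks]
  | succ k =>
    classical
    rw [walks]
    rw [show ∀ F : ℕ → Multiset (Finset ℕ), (∑ w ∈ U.filter (Hits g I v), F w).card =
      ∑ w ∈ U.filter (Hits g I v), (F w).card from fun F => map_sum Multiset.cardHom F _]
    simp only [show ∀ F : Fin (k + 1) → Multiset (Finset ℕ), (∑ i, F i).card = ∑ i, (F i).card from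
      fun F => map_sum Multiset.cardHom F _, Multiset.card_bind, Function.comp_def, Multiset.card_map,
      Multiset.map_const', Multiset.sum_replicate, smul_eq_mul]
    calc _ ≤ ∑ w ∈ U.filter (Hits g I v), ∑ i : Fin (k + 1), (n * n) ^ k := by
          refine Finset.sum_le_sum fun w _ => Finset.sum_le_sum fun i _ => ?_
          calc _ ≤ (n * n) ^ (i : ℕ) * (n * n) ^ (k - i) :=
                Nat.mul_le_mul (ih i (by omega) w (by omega)) (ih (k - i) (by omega) v (by omega))
            _ = _ := by rw [← pow_add]; congr 1; omega
      _ = (U.filter (Hits g I v)).card * ((k + 1) * (n * n) ^ k) := by simp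
      _ ≤ n * (n * (n * n) ^ k) := Nat.mul_le_mul ((Finset.card_filter_le _ _).trans hU)
          (Nat.mul_le_mul_right _ hk)
      _ = _ := by ring

open Classical in
theorem numCovering_pos_iff {R : Finset ℕ} {k : ℕ} : 0 < numCovering g I U R k v ↔
    ∃ N ∈ walks g I U k v, Covers g I R N := by
  unfold numCovering
  exact Multiset.countP_pos

open Classical in
theorem numCovering_le (hU : U.card ≤ n) (R : Finset ℕ) {k : ℕ} (hk : k ≤ n) (v : ℕ) :
    numCovering g I U R k v ≤ (n * n) ^ k := by
  unfold numCovering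
  exact (Multiset.countP_le_card _ _).trans (card_walks_le hU k v hk)

/-! ### Covering walks and feasible sets -/

theorem Hits.reach (h : Hits g I v w) (hI : I ⊆ J) (hv : v ∈ J) : Reach g J v w := by
  obtain rfl | ⟨x, hx, h⟩ := h
  · exact .refl
  · exact Relation.ReflTransGen.head ⟨hv, hx⟩ (h.mono hI)

theorem Hits.tail (h : Hits g I v w) (hw : w ∈ I) (hx : g w x) : Hits g I v x := by
  obtain rfl | ⟨y, hy, h⟩ := h
  · exact .inr ⟨x, hx, .refl⟩
  · exact .inr ⟨y, hy, Relation.ReflTransGen.tail h ⟨hw, hx⟩⟩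

theorem of_mem_walks (k : ℕ) : ∀ v N, N ∈ walks g I U k v →
    v ∈ N ∧ N ⊆ insert v U ∧ N.card ≤ k + 1 ∧ ∀ a ∈ N, Reach g (I ∪ N) v a := by
  induction k using Nat.strong_induction_on with
  | _ k ih =>
  intro v N hN
  cases k with
  | zero =>
    simp only [walks, Multiset.mem_singleton] at hN
    subst hN
    simp only [Finset.mem_singleton, Finset.card_singleton, true_and, forall_eq]
    exact ⟨by simp, le_rfl, .refl⟩
  | succ k =>
    obtain ⟨w, hw, hh, i, j, hij, A, hA, B, hB, rfl⟩ := mem_walks_succ.1 hN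
    obtain ⟨a1, a2, a3, a4⟩ := ih i (by omega) w A hA
    obtain ⟨b1, b2, b3, b4⟩ := ih j (by omega) v B hB
    have hIA : I ∪ A ⊆ I ∪ (A ∪ B) := Finset.union_subset_union_right Finset.subset_union_left
    have hIB : I ∪ B ⊆ I ∪ (A ∪ B) := Finset.union_subset_union_right Finset.subset_union_right
    refine ⟨Finset.mem_union_right _ b1, Finset.union_subset (a2.trans ?_) b2, ?_, ?_⟩
    · exact Finset.insert_subset (Finset.mem_insert_of_mem hw) (Finset.subset_insert _ _)
    · have := Finset.card_union_le A B
      omega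
    · intro a ha
      rcases Finset.mem_union.1 ha with ha | ha
      · exact (hh.reach Finset.subset_union_left (by simp [b1])).trans ((a4 a ha).mono hIA)
      · exact (b4 a ha).mono hIB

/-- The new vertex is attached inside the half of the walk that contains `a`. Hence every set grown
by hit vertices, one at a time, is the vertex set of a branching walk. -/
theorem insert_mem_walks (k : ℕ) : ∀ v N, N ∈ walks g I U k v → ∀ a ∈ N, ∀ w ∈ U, Hits g I a w →
    insert w N ∈ walks g I U (k + 1) v := by
  induction k using Nat.strong_induction_on with
  | _ k ih =>
  intro v N hN a ha w hw haw
  cases k with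
  | zero =>
    simp only [walks, Multiset.mem_singleton] at hN
    subst hN
    obtain rfl := Finset.mem_singleton.1 ha
    exact mem_walks_succ.2 ⟨w, hw, haw, 0, 0, rfl, {w}, by simp [walks], {a}, by simp [walks], rfl⟩
  | succ k =>
    obtain ⟨x, hx, hh, i, j, hij, A, hA, B, hB, rfl⟩ := mem_walks_succ.1 hN
    rcases Finset.mem_union.1 ha with ha | ha
    · exact mem_walks_succ.2 ⟨x, hx, hh, i + 1, j, by omega, _,
        ih i (by omega) x A hA a ha w hw haw, B, hB, by rw [Finset.insert_union]⟩
    · exact mem_walks_succ.2 ⟨x, hx, hh, i, j + 1, by omega, A, hA, _,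
        ih j (by omega) v B hB a ha w hw haw, by rw [Finset.union_insert]⟩

/-- Add a covering walk to `I`. A vertex not yet reached from `r` lies below some representative,
which the walk hits. The walk has at most `k + 1` vertices, one of which is `r` and already belongs
to `I`. -/
theorem exists_feasible_of_numCovering (hr : r ∈ I) {k : ℕ}
    (h : 0 < numCovering g I U (reps n g I r) k r) :
    ∃ S, I ⊆ S ∧ S ⊆ I ∪ U ∧ Feasible n g r S ∧ S.card ≤ I.card + k := by
  classical
  obtain ⟨N, hN, hcov⟩ := numCovering_pos_iff.1 h
  obtain ⟨h1, h2, h3, h4⟩ := of_mem_walks k r N hN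
  refine ⟨I ∪ N, Finset.subset_union_left, ?_, ⟨Finset.mem_union_left _ hr, fun x hx => ?_⟩, ?_⟩
  · refine Finset.union_subset Finset.subset_union_left (h2.trans ?_)
    exact Finset.insert_subset (Finset.mem_union_left _ hr) Finset.subset_union_right
  · by_cases hrx : Reach g I r x
    · exact hrx.mono Finset.subset_union_left
    · obtain ⟨t, ht, htx⟩ := exists_rep hx hrx
      obtain ⟨a, ha, hat⟩ := hcov t (mem_reps.2 ht)
      exact ((h4 a ha).trans (hat.reach Finset.subset_union_left (by simp [ha]))).trans
        (htx.mono Finset.subset_union_left)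
  · have hi := Finset.card_union_add_card_inter I N
    have : 0 < (I ∩ N).card := Finset.card_pos.2 ⟨r, by simp [hr, h1]⟩
    omega

/-- Follow a path from `r` in `S`: being hit is passed on by vertices of `I` and, by closedness, a
vertex of `S \ I` that is hit is itself in `N`. -/
theorem exists_hits_of_closed {N : Finset ℕ} (hr : r ∈ N)
    (hN : ∀ w ∈ S \ I, (∃ a ∈ N, Hits g I a w) → w ∈ N) (h : Reach g S r x) :
    ∃ a ∈ N, Hits g I a x := by
  induction h with
  | refl => exact ⟨r, hr, .inl rfl⟩
  | @tail b c _ hbc ih =>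
    obtain ⟨a, ha, hab⟩ := ih
    by_cases hb : b ∈ I
    · exact ⟨a, ha, hab.tail hb hbc.2⟩
    · exact ⟨b, hN b (Finset.mem_sdiff.2 ⟨hbc.1, hb⟩) ⟨a, ha, hab⟩, .inr ⟨c, hbc.2, .refl⟩⟩

/-- Starting from `{r}`, attach vertices of `S \ I` one by one. The process cannot stop early: by
`exists_hits_of_closed` a set closed under hits contains all of `S \ I`. The final walk has exactly
the vertices of `S \ I` and `r`, so it covers. -/
theorem numCovering_pos (hr : r ∈ I) (hI : I ⊆ S) (hS : S ⊆ I ∪ U) (hSn : ∀ x ∈ S, x < n)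
    (hF : Feasible n g r S) :
    0 < numCovering g I U (reps n g I r) (S.card - I.card) r := by
  classical
  have hcard : (S \ I).card = S.card - I.card := Finset.card_sdiff_of_subset hI
  have hrS : r ∉ S \ I := by simp [hr]
  have key : ∀ j ≤ (S \ I).card, ∃ N ∈ walks g I U j r, N ⊆ insert r (S \ I) ∧
      N.card = j + 1 := by
    intro j
    induction j with
    | zero => exact fun _ => ⟨{r}, by simp [walks], by simp, by simp⟩
    | succ j ih =>
      intro hj
      obtain ⟨N, hN, hsub, hc⟩ := ih (by omega)
      have hrN := (of_mem_walks j r N hN).1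
      by_cases hcl : ∀ w ∈ S \ I, (∃ a ∈ N, Hits g I a w) → w ∈ N
      · have : insert r (S \ I) ⊆ N := by
          refine Finset.insert_subset hrN fun w hw => hcl w hw ?_
          exact exists_hits_of_closed hrN hcl
            (hF.2 w (hSn w (Finset.mem_sdiff.1 hw).1))
        have := Finset.card_le_card this
        rw [Finset.card_insert_of_notMem hrS] at this
        omega
      · push Not at hcl
        obtain ⟨w, hw, ⟨a, ha, haw⟩, hwN⟩ := hcl
        have hwU : w ∈ U := by
          obtain ⟨h1, h2⟩ := Finset.mem_sdiff.1 hw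
          exact (Finset.mem_union.1 (hS h1)).resolve_left h2
        refine ⟨_, insert_mem_walks j r N hN a ha w hwU haw,
          Finset.insert_subset (Finset.mem_insert_of_mem hw) hsub, ?_⟩
        rw [Finset.card_insert_of_notMem hwN, hc]
  obtain ⟨N, hN, hsub, hc⟩ := key _ le_rfl
  rw [← hcard]
  refine numCovering_pos_iff.2 ⟨N, hN, fun t ht => ?_⟩
  have hNe : N = insert r (S \ I) := Finset.eq_of_subset_of_card_le hsub (by
    rw [Finset.card_insert_of_notMem hrS, hc])
  refine exists_hits_of_closed (S := S) (r := r) (by simp [hNe]) (fun w hw _ => ?_)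
    (hF.2 t (mem_reps.1 ht).1)
  rw [hNe]; exact Finset.mem_insert_of_mem hw

end

end MaxLeaf

/-! ### The search tree -/

namespace MaxLeaf

/-- The least number below `b` with a property, or `b` if there is none. -/
noncomputable def least (b : ℕ) (p : ℕ → Prop) : ℕ :=
  open Classical in Nat.find (⟨b, .inl le_rfl⟩ : ∃ z, b ≤ z ∨ p z)

theorem least_le (b : ℕ) (p : ℕ → Prop) : least b p ≤ b := by
  classical
  exact Nat.find_min' _ (.inl le_rfl)

theorem least_spec {b : ℕ} {p : ℕ → Prop} (h : least b p < b) : p (least b p) := by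
  classical
  have := Nat.find_spec (⟨b, .inl le_rfl⟩ : ∃ z, b ≤ z ∨ p z)
  exact this.resolve_left (not_le.2 h)

theorem not_of_lt_least {b z : ℕ} {p : ℕ → Prop} (h : z < least b p) : ¬ p z := by
  classical
  exact fun hp => Nat.find_min _ h (.inr hp)

theorem least_le_of {b z : ℕ} {p : ℕ → Prop} (h : p z) : least b p ≤ z := by
  by_contra hlt
  exact not_of_lt_least (not_le.1 hlt) h

theorem least_congr {b : ℕ} {p q : ℕ → Prop} (h : ∀ z < b, (p z ↔ q z)) :
    least b p = least b q := by
  refine le_antisymm ?_ ?_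
  · rcases (least_le b q).lt_or_eq with h1 | h1
    · exact least_le_of ((h _ h1).2 (least_spec h1))
    · exact (least_le b p).trans h1.ge
  · rcases (least_le b p).lt_or_eq with h1 | h1
    · exact least_le_of ((h _ h1).1 (least_spec h1))
    · exact (least_le b q).trans h1.ge

/-- The classes of vertices to branch on, in order of priority. -/
def Branch (n : ℕ) (g : ℕ → ℕ → Prop) (r : ℕ) (I U : Finset ℕ) : ℕ → ℕ → Prop
  | 0, v => v ∈ U ∧ ∃ t ∈ reps n g I r, Enters n g I v t ∧ inDeg n g I U t = 1
  | 1, v => v ∈ U ∧ 3 ≤ outDeg n g I r v ∧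
      ∃ t ∈ reps n g I r, Enters n g I v t ∧ inDeg n g I U t = 2
  | 2, v => v ∈ U ∧ ∃ t ∈ reps n g I r, Enters n g I v t ∧ inDeg n g I U t = 2
  | 3, v => v ∈ U ∧ 4 ≤ outDeg n g I r v
  | 4, v => v ∈ U ∧ ∃ t ∈ reps n g I r, Enters n g I v t ∧ inDeg n g I U t = 3 ∧
      ∀ w ∈ U, Enters n g I w t → 3 ≤ outDeg n g I r w
  | _, _ => False

/-- The vertices with status `1`, which are internal. -/
def inSet (n : ℕ) (σ : ℕ → ℕ) : Finset ℕ := (Finset.range n).filter fun v => σ v = 1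

/-- The vertices with status `0`, which are undecided. -/
def undec (n : ℕ) (σ : ℕ → ℕ) : Finset ℕ := (Finset.range n).filter fun v => σ v = 0

/-- The representatives with tag `k`. -/
noncomputable def tagged (n : ℕ) (g : ℕ → ℕ → Prop) (r k : ℕ) (σ : ℕ → ℕ) : Finset ℕ :=
  (reps n g (inSet n σ) r).filter fun t => σ (n + t) = k

/-- The items which can be selected in class `p`: the number `i` stands for the vertex `i` if
`i < n`, and for the tag of the representative `i - n` otherwise. -/
def Sel (n : ℕ) (g : ℕ → ℕ → Prop) (r : ℕ) (σ : ℕ → ℕ) (p i : ℕ) : Prop :=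
  Branch n g r (inSet n σ) (undec n σ) p i ∨
    p = 5 ∧ ∃ t ∈ reps n g (inSet n σ) r, i = n + t ∧ σ i = 0

/-- The selected class and item, encoded as a single number, or `12 * n` if there is none. -/
noncomputable def pickKey (n : ℕ) (g : ℕ → ℕ → Prop) (r : ℕ) (σ : ℕ → ℕ) : ℕ :=
  least (12 * n) fun z => ¬ Bad n g (inSet n σ) (undec n σ) r ∧
    Sel n g r σ (z / (2 * n)) (z % (2 * n))

open Classical in
/-- The contribution of a leaf of the search tree to the number of covering walks of size `c`. -/
noncomputable def leafVal (n : ℕ) (g : ℕ → ℕ → Prop) (r : ℕ) (σ : ℕ → ℕ) (c : ℕ) : ℤ :=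
  if Bad n g (inSet n σ) (undec n σ) r then 0 else if (inSet n σ).card ≤ c then
    (-1) ^ (tagged n g r 2 σ).card *
      (numWalks g (inSet n σ) (undec n σ) (tagged n g r 2 σ) (c - (inSet n σ).card) r : ℤ)
  else 0

/-- The search tree below the state `σ`, the sum of the contributions of its leaves, and the number
of steps in a traversal. -/
inductive Tree (n : ℕ) (g : ℕ → ℕ → Prop) (r : ℕ) : (ℕ → ℕ) → (ℕ → ℤ) → ℕ → Prop
  | leaf (σ : ℕ → ℕ) (h : pickKey n g r σ = 12 * n) : Tree n g r σ (leafVal n g r σ) 1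
  | node (σ : ℕ → ℕ) (a b : ℕ → ℤ) (k l : ℕ) (h : pickKey n g r σ < 12 * n)
      (h₁ : Tree n g r (Function.update σ (pickKey n g r σ % (2 * n)) 1) a k)
      (h₂ : Tree n g r (Function.update σ (pickKey n g r σ % (2 * n)) 2) b l) :
      Tree n g r σ (a + b) (k + l + 3)

section

variable {n : ℕ} {g : ℕ → ℕ → Prop} {I U S : Finset ℕ} {r t v : ℕ} {σ : ℕ → ℕ}

/-! ### Changing the status of an item -/

theorem mem_inSet : v ∈ inSet n σ ↔ v < n ∧ σ v = 1 := by simp [inSet]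

theorem mem_undec : v ∈ undec n σ ↔ v < n ∧ σ v = 0 := by simp [undec]

theorem inSet_update_one (hv : v < n) : inSet n (Function.update σ v 1) = insert v (inSet n σ) := by
  ext x
  simp only [mem_inSet, Finset.mem_insert, Function.update_apply]
  split_ifs with h <;> simp [h, hv]

theorem inSet_update_two (hv : σ v = 0) : inSet n (Function.update σ v 2) = inSet n σ := by
  ext x
  simp only [mem_inSet, Function.update_apply]
  split_ifs with h
  · subst h; simp [hv]
  · simp

theorem undec_update {k : ℕ} (hk : k ≠ 0) :
    undec n (Function.update σ v k) = (undec n σ).erase v := by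
  ext x
  simp only [mem_undec, Finset.mem_erase, Function.update_apply]
  split_ifs with h <;> simp [h, hk]

theorem inSet_update_tag {k : ℕ} : inSet n (Function.update σ (n + t) k) = inSet n σ := by
  ext x
  simp only [mem_inSet, Function.update_apply]
  refine and_congr_right fun h => ?_
  rw [if_neg (by omega)]

theorem undec_update_tag {k : ℕ} : undec n (Function.update σ (n + t) k) = undec n σ := by
  ext x
  simp only [mem_undec, Function.update_apply]
  refine and_congr_right fun h => ?_
  rw [if_neg (by omega)]

theorem mem_tagged {k : ℕ} :
    t ∈ tagged n g r k σ ↔ t ∈ reps n g (inSet n σ) r ∧ σ (n + t) = k := by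
  simp [tagged]

theorem tagged_update {j k : ℕ} (ht : t ∈ reps n g (inSet n σ) r) :
    tagged n g r k (Function.update σ (n + t) j) =
      if j = k then insert t (tagged n g r k σ) else (tagged n g r k σ).erase t := by
  ext x
  rw [mem_tagged, inSet_update_tag, Function.update_apply]
  by_cases hx : x = t
  · subst hx; split_ifs <;> simp_all
  · split_ifs <;> simp_all [mem_tagged]

theorem Branch.class_lt {p : ℕ} (h : Branch n g r I U p v) : p < 5 := by
  match p, h with
  | 0, _ => norm_num
  | 1, _ => norm_num
  | 2, _ => norm_num
  | 3, _ => norm_num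
  | 4, _ => norm_num

theorem Branch.mem {p : ℕ} (h : Branch n g r I U p v) : v ∈ U := by
  match p, h with
  | 0, h => exact h.1
  | 1, h => exact h.1
  | 2, h => exact h.1
  | 3, h => exact h.1
  | 4, h => exact h.1

theorem least_eq_of_forall {b : ℕ} {p : ℕ → Prop} (h : ∀ z < b, ¬ p z) : least b p = b :=
  (least_le b p).eq_of_not_lt fun hlt => h _ hlt (least_spec hlt)

/-- The pair of class `p` and item `i < 2 * n` is encoded with `p` as the leading digit, so the
least key respects the priority of the classes. Six classes make `12 * n` keys. -/
theorem pickKey_lt {p i : ℕ} (hb : ¬ Bad n g (inSet n σ) (undec n σ) r)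
    (h : Sel n g r σ p i) : pickKey n g r σ < 12 * n ∧ pickKey n g r σ / (2 * n) ≤ p := by
  have hi : i < 2 * n ∧ p ≤ 5 := by
    rcases h with h | ⟨rfl, t, ht, rfl, -⟩
    · have := (mem_undec.1 h.mem).1
      have := h.class_lt
      omega
    · have := (mem_reps.1 ht).1
      omega
  have hz1 : (i + 2 * n * p) / (2 * n) = p := by
    rw [Nat.add_mul_div_left _ _ (by omega), Nat.div_eq_of_lt hi.1, zero_add]
  have hz2 : (i + 2 * n * p) % (2 * n) = i := by
    rw [Nat.add_mul_mod_self_left, Nat.mod_eq_of_lt hi.1]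
  have hle : pickKey n g r σ ≤ i + 2 * n * p := least_le_of ⟨hb, by rwa [hz1, hz2]⟩
  have : 2 * n * p ≤ 2 * n * 5 := Nat.mul_le_mul_left _ hi.2
  exact ⟨by omega, hz1 ▸ Nat.div_le_div_right hle⟩

theorem pickKey_spec (h : pickKey n g r σ < 12 * n) :
    ¬ Bad n g (inSet n σ) (undec n σ) r ∧
      Sel n g r σ (pickKey n g r σ / (2 * n)) (pickKey n g r σ % (2 * n)) :=
  least_spec h

/-- The search tree of a state in which no vertex is to be branched on. -/
theorem exists_tree_of_no_branch (m : ℕ) : ∀ σ : ℕ → ℕ,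
    ¬ Bad n g (inSet n σ) (undec n σ) r →
    (∀ p v, ¬ Branch n g r (inSet n σ) (undec n σ) p v) → (tagged n g r 0 σ).card = m →
    ∃ a s, Tree n g r σ a s ∧ s + 3 = 4 * 2 ^ m ∧ ∀ c, a c =
      if (inSet n σ).card ≤ c then ∑ X ∈ (tagged n g r 0 σ).powerset,
        (-1) ^ (tagged n g r 2 σ ∪ X).card *
        (numWalks g (inSet n σ) (undec n σ) (tagged n g r 2 σ ∪ X) (c - (inSet n σ).card) r : ℤ)
      else 0 := by
  induction m with
  | zero =>
    intro σ hb hn hc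
    rw [Finset.card_eq_zero] at hc
    refine ⟨_, 1, .leaf σ ?_, rfl, fun c => ?_⟩
    · refine least_eq_of_forall fun z hz h => ?_
      rcases h.2 with h | ⟨-, t, ht, hi, h0⟩
      · exact hn _ _ h
      · rw [hi] at h0
        have := mem_tagged.2 ⟨ht, h0⟩
        simp [hc] at this
    · simp only [leafVal, hb, if_false, hc, Finset.powerset_empty, Finset.sum_singleton,
        Finset.union_empty]
  | succ m ih =>
    intro σ hb hn hc
    obtain ⟨t₀, ht₀⟩ := Finset.card_pos.1 (by omega : 0 < (tagged n g r 0 σ).card)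
    obtain ⟨ht₀, h₀⟩ := mem_tagged.1 ht₀
    obtain ⟨hk, -⟩ := pickKey_lt hb (p := 5) (i := n + t₀) (.inr ⟨rfl, t₀, ht₀, rfl, h₀⟩)
    obtain ⟨-, hs⟩ := pickKey_spec hk
    obtain ⟨-, t, ht, hi, h0⟩ := hs.resolve_left (hn _ _)
    rw [hi] at h0
    have htY : t ∈ tagged n g r 0 σ := mem_tagged.2 ⟨ht, h0⟩
    have htX : t ∉ tagged n g r 2 σ := fun h => by have := (mem_tagged.1 h).2; omega
    -- Tag `1` leaves `t` out of the set to be avoided and tag `2` puts it in; in both cases `t` is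
    -- no longer open.
    have hstep : ∀ k, k ≠ 0 → ∃ a s, Tree n g r (Function.update σ (n + t) k) a s ∧
        s + 3 = 4 * 2 ^ m ∧ ∀ c, a c = if (inSet n σ).card ≤ c then
          ∑ X ∈ ((tagged n g r 0 σ).erase t).powerset,
          (-1) ^ (tagged n g r 2 (Function.update σ (n + t) k) ∪ X).card *
          (numWalks g (inSet n σ) (undec n σ) (tagged n g r 2 (Function.update σ (n + t) k) ∪ X)
            (c - (inSet n σ).card) r : ℤ) else 0 := by
      intro k hk0
      have := ih (Function.update σ (n + t) k) (by rwa [inSet_update_tag, undec_update_tag])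
        (by rwa [inSet_update_tag, undec_update_tag])
        (by rw [tagged_update ht, if_neg hk0, Finset.card_erase_of_mem htY]; omega)
      rwa [inSet_update_tag, undec_update_tag, tagged_update (k := 0) ht, if_neg hk0] at this
    obtain ⟨a, k, h1, hk1, ha⟩ := hstep 1 (by norm_num)
    obtain ⟨b, l, h2, hk2, hb'⟩ := hstep 2 (by norm_num)
    -- A node has three steps more than its two subtrees together, so the size plus `3` doubles with
    -- every open representative.
    refine ⟨a + b, k + l + 3, .node σ a b k l hk (hi ▸ h1) (hi ▸ h2), by rw [pow_succ]; omega,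
      fun c => ?_⟩
    rw [Pi.add_apply, ha, hb']
    split_ifs with hle
    · rw [tagged_update ht, tagged_update ht, if_neg (by norm_num), if_pos rfl,
        Finset.erase_eq_of_notMem htX]
      conv_rhs => rw [← Finset.insert_erase htY]
      rw [Finset.sum_powerset_insert (Finset.notMem_erase _ _)]
      congr 1
      refine Finset.sum_congr rfl fun X hX => ?_
      rw [Finset.insert_union, Finset.union_insert]
    · simp

/-! ### The weight of a state -/

/-- The reciprocal of the basis of the weights. -/
noncomputable def zeta : ℝ := 1 / 1.1747

theorem zeta_pos : 0 < zeta := by norm_num [zeta]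

/-- The weight of a state without particular components. -/
noncomputable def baseWeight (n : ℕ) (g : ℕ → ℕ → Prop) (r : ℕ) (I U : Finset ℕ) : ℝ :=
  (1.1747 : ℝ) ^ (3 * U.card + (reps n g I r).card)

open Classical in
/-- An upper bound for the size of the search tree, up to a linear factor. -/
noncomputable def weight (n : ℕ) (g : ℕ → ℕ → Prop) (r : ℕ) (I U : Finset ℕ) : ℝ :=
  if Bad n g I U r then 0 else baseWeight n g r I U *
    if ∃ v, Branch n g r I U 0 v then zeta ^ 3
    else if ∃ v, Branch n g r I U 1 v then zeta ^ 5 + zeta ^ 6 else 1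

theorem baseWeight_pos : 0 < baseWeight n g r I U := by
  unfold baseWeight; positivity

theorem weight_le_of_branch_zero (h : Branch n g r I U 0 v) :
    weight n g r I U ≤ baseWeight n g r I U * zeta ^ 3 := by
  have := baseWeight_pos (n := n) (g := g) (r := r) (I := I) (U := U)
  have hz := zeta_pos
  unfold weight
  split_ifs with h1 h2
  · positivity
  · exact le_rfl
  · exact absurd ⟨v, h⟩ h2
  · exact absurd ⟨v, h⟩ h2

theorem weight_le_of_branch_one (h : Branch n g r I U 1 v) :
    weight n g r I U ≤ baseWeight n g r I U * (zeta ^ 5 + zeta ^ 6) := by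
  have := baseWeight_pos (n := n) (g := g) (r := r) (I := I) (U := U)
  have hz := zeta_pos
  unfold weight
  split_ifs with h1 h2 h3
  · positivity
  · refine mul_le_mul_of_nonneg_left ?_ this.le
    norm_num [zeta]
  · exact le_rfl
  · exact absurd ⟨v, h⟩ h3

theorem weight_le : weight n g r I U ≤ baseWeight n g r I U := by
  have := baseWeight_pos (n := n) (g := g) (r := r) (I := I) (U := U)
  unfold weight
  split_ifs with h1 h2 h3
  · positivity
  · refine mul_le_of_le_one_right this.le ?_
    norm_num [zeta]
  · refine mul_le_of_le_one_right this.le ?_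
    norm_num [zeta]
  · rw [mul_one]

theorem weight_nonneg : 0 ≤ weight n g r I U := by
  have := baseWeight_pos (n := n) (g := g) (r := r) (I := I) (U := U)
  have := zeta_pos
  unfold weight
  split_ifs <;> positivity

/-- The decided vertex lowers the exponent by `3`. By `card_reps_insert` the components lower it by
another `j` if `v` enters at least `j + 1` of them, and never raise it. -/
theorem baseWeight_insert_le (hg : ∀ a b, g a b → a < n ∧ b < n) (hv : v ∈ U) {j : ℕ}
    (hj : j = 0 ∨ j + 1 ≤ outDeg n g I r v) :
    baseWeight n g r (insert v I) (U.erase v) ≤ baseWeight n g r I U * zeta ^ (3 + j) := by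
  have h1 := card_reps_insert (I := I) (r := r) hg v
  have h2 := Finset.card_erase_add_one hv
  have h3 : 3 * (U.erase v).card + (reps n g (insert v I) r).card + (3 + j) ≤
    3 * U.card + (reps n g I r).card := by omega
  unfold baseWeight
  rw [zeta, one_div, inv_pow, ← div_eq_mul_inv, le_div_iff₀ (by positivity), ← pow_add]
  exact pow_le_pow_right₀ (by norm_num) h3

theorem baseWeight_erase (hv : v ∈ U) :
    baseWeight n g r I (U.erase v) = baseWeight n g r I U * zeta ^ 3 := by
  have h2 := Finset.card_erase_add_one hv
  unfold baseWeight
  rw [zeta, one_div, inv_pow, ← div_eq_mul_inv, eq_div_iff (by positivity), ← pow_add]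
  congr 1
  omega

/-- This pays for the constant cost of an inner node. The vertex to branch on contributes `3` to the
exponent, which outweighs even the smallest factor `zeta ^ 3`. -/
theorem one_le_weight (hb : ¬ Bad n g I U r) {p : ℕ} (h : Branch n g r I U p v) :
    1 ≤ weight n g r I U := by
  have hU : 0 < U.card := Finset.card_pos.2 ⟨v, h.mem⟩
  have h3 : (1.1747 : ℝ) ^ 3 ≤ baseWeight n g r I U :=
    pow_le_pow_right₀ (by norm_num) (by omega)
  unfold weight
  rw [if_neg hb]
  split_ifs with h1 h2
  · refine le_trans ?_ (mul_le_mul_of_nonneg_right h3 (by have := zeta_pos; positivity))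
    norm_num [zeta]
  · refine le_trans ?_ (mul_le_mul_of_nonneg_right h3 (by have := zeta_pos; positivity))
    norm_num [zeta]
  · norm_num at h3 ⊢
    linarith

/-- The weights of the two subproblems add up to at most the weight of the problem. -/
theorem weight_add_le (hg : ∀ a b, g a b → a < n ∧ b < n) (hb : ¬ Bad n g I U r) {p : ℕ}
    (h : Branch n g r I U p v) (hmin : ∀ q < p, ∀ w, ¬ Branch n g r I U q w) :
    weight n g r (insert v I) (U.erase v) + weight n g r I (U.erase v) ≤ weight n g r I U := by
  have hW := baseWeight_pos (n := n) (g := g) (r := r) (I := I) (U := U)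
  have hv := h.mem
  have hout := baseWeight_erase (n := n) (g := g) (r := r) (I := I) hv
  set W := baseWeight n g r I U
  have hin : ∀ j, j = 0 ∨ j + 1 ≤ outDeg n g I r v →
      weight n g r (insert v I) (U.erase v) ≤ W * zeta ^ (3 + j) := fun j hj =>
    weight_le.trans (baseWeight_insert_le hg hv hj)
  have hw1 : (∀ w, ¬ Branch n g r I U 0 w) → (∀ w, ¬ Branch n g r I U 1 w) →
      weight n g r I U = W := by
    intro h0 h1
    simp [weight, hb, h0, h1, W]
  have hdeg : ∀ t, Enters n g I v t → ∀ k, inDeg n g I U t = k + 1 →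
      inDeg n g I (U.erase v) t = k := fun t ht k hk => by
    have := inDeg_erase hv ht; omega
  have hz := zeta_pos
  match p, h with
  | 0, h =>
    obtain ⟨-, t, ht, hvt, hd⟩ := id h
    -- Discarding the only vertex that enters `t` gives a state of weight `0`, so nothing but the
    -- first subproblem counts.
    have hbad : Bad n g I (U.erase v) r := ⟨t, ht, hdeg t hvt 0 hd⟩
    have h2 : weight n g r I (U.erase v) = 0 := by simp [weight, hbad]
    have h3 : weight n g r I U = W * zeta ^ 3 := by
      have : ∃ v, Branch n g r I U 0 v := ⟨v, h⟩
      simp [weight, hb, this, W]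
    have := hin 0 (.inl rfl)
    rw [h2, h3]; simpa using this
  | 1, h =>
    obtain ⟨-, h3, t, ht, hvt, hd⟩ := id h
    obtain ⟨w, hw, hwt⟩ := exists_enters_of_inDeg_pos (U := U.erase v) (I := I) (n := n) (g := g)
      (t := t) (by rw [hdeg t hvt 1 hd]; norm_num)
    -- Once `v` is discarded, `w` alone enters `t`, so the second subproblem has the factor `zeta ^
    -- 3` as well, `zeta ^ 6` in all. The first one has `zeta ^ 5`; the factor in `weight` for class
    -- `1` is exactly this sum.
    have hbr : Branch n g r I (U.erase v) 0 w := ⟨hw, t, ht, hwt, hdeg t hvt 1 hd⟩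
    have h2 := weight_le_of_branch_zero hbr
    have h4 : weight n g r I U = W * (zeta ^ 5 + zeta ^ 6) := by
      have h0 : ¬ ∃ v, Branch n g r I U 0 v := fun ⟨w, hw⟩ => hmin 0 (by norm_num) w hw
      have h1 : ∃ v, Branch n g r I U 1 v := ⟨v, h⟩
      simp only [weight, hb, h0, h1, W, if_false, if_true]
    have h1 : _ ≤ W * zeta ^ 5 := hin 2 (.inr (by omega))
    rw [hout] at h2
    rw [h4]; linarith
  | 2, h =>
    obtain ⟨-, t, ht, hvt, hd⟩ := id h
    obtain ⟨w, hw, hwt⟩ := exists_enters_of_inDeg_pos (U := U.erase v) (I := I) (n := n) (g := g)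
      (t := t) (by rw [hdeg t hvt 1 hd]; norm_num)
    have hbr : Branch n g r I (U.erase v) 0 w := ⟨hw, t, ht, hwt, hdeg t hvt 1 hd⟩
    have h2 := weight_le_of_branch_zero hbr
    have h1 : _ ≤ W * zeta ^ 3 := hin 0 (.inl rfl)
    rw [hout] at h2
    rw [hw1 (hmin 0 (by norm_num)) (hmin 1 (by norm_num))]
    -- This is the strictest requirement on the base: its cube has to be at least the golden ratio.
    have : W * (zeta ^ 3 + zeta ^ 6) ≤ W * 1 :=
      mul_le_mul_of_nonneg_left (by norm_num [zeta]) hW.le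
    linarith
  | 3, h =>
    -- At least four entered components mean that at least three disappear if `v` becomes internal.
    have h1 : _ ≤ W * zeta ^ 6 := hin 3 (.inr h.2)
    have h2 : weight n g r I (U.erase v) ≤ W * zeta ^ 3 := hout ▸ weight_le
    rw [hw1 (hmin 0 (by norm_num)) (hmin 1 (by norm_num))]
    have : W * (zeta ^ 3 + zeta ^ 6) ≤ W * 1 :=
      mul_le_mul_of_nonneg_left (by norm_num [zeta]) hW.le
    linarith
  | 4, h =>
    obtain ⟨-, t, ht, hvt, hd, hall⟩ := id h
    obtain ⟨w, hw, hwt⟩ := exists_enters_of_inDeg_pos (U := U.erase v) (I := I) (n := n) (g := g)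
      (t := t) (by rw [hdeg t hvt 2 hd]; norm_num)
    -- Discarding `v` leaves `t` with in-degree `2`. The out-degrees do not depend on `U`, so `w`
    -- still enters three components and the second subproblem gets the factor for class `1`.
    have hbr : Branch n g r I (U.erase v) 1 w :=
      ⟨hw, hall w (Finset.mem_of_mem_erase hw) hwt, t, ht, hwt, hdeg t hvt 2 hd⟩
    have h2 := weight_le_of_branch_one hbr
    have h1 : _ ≤ W * zeta ^ 5 := hin 2 (.inr (by have := hall v hv hvt; omega))
    rw [hout] at h2
    rw [hw1 (hmin 0 (by norm_num)) (hmin 1 (by norm_num))]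
    have : W * (zeta ^ 5 + zeta ^ 3 * (zeta ^ 5 + zeta ^ 6)) ≤ W * 1 :=
      mul_le_mul_of_nonneg_left (by norm_num [zeta]) hW.le
    linarith

/-- If there is no vertex to branch on, then enumerating the sets of representatives is cheap. -/
theorem two_pow_le_weight (hb : ¬ Bad n g I U r) (hn : ∀ p v, ¬ Branch n g r I U p v) :
    (2 : ℝ) ^ (reps n g I r).card ≤ weight n g r I U := by
  have hw : weight n g r I U = baseWeight n g r I U := by
    simp [weight, hb, hn]
  have h7 : 7 * (reps n g I r).card ≤ 6 * U.card := by
    refine seven_mul_card_reps_le (fun t ht => ?_) (fun v hv => ?_) fun t ht h3 => ?_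
    · by_contra hlt
      have h0 : inDeg n g I U t ≠ 0 := fun h => hb ⟨t, ht, h⟩
      obtain ⟨v, hv, hvt⟩ := exists_enters_of_inDeg_pos (Nat.pos_of_ne_zero h0)
      have : inDeg n g I U t = 1 ∨ inDeg n g I U t = 2 := by omega
      rcases this with h | h
      · exact hn 0 v ⟨hv, t, ht, hvt, h⟩
      · exact hn 2 v ⟨hv, t, ht, hvt, h⟩
    · by_contra hlt
      exact hn 3 v ⟨hv, by omega⟩
    · by_contra hno
      push Not at hno
      obtain ⟨v, hv, hvt⟩ := exists_enters_of_inDeg_pos (by omega : 0 < inDeg n g I U t)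
      exact hn 4 v ⟨hv, t, ht, hvt, h3, fun w hw hwt => hno w hw hwt⟩
  rw [hw]
  -- Squaring avoids half-integral exponents. From `7 * |reps| ≤ 6 * |U|` twice the exponent of the
  -- base weight is at least `9 * |reps|`, and `4 ≤ 1.1747 ^ 9`.
  have hsq : ((2 : ℝ) ^ (reps n g I r).card) ^ 2 ≤ baseWeight n g r I U ^ 2 := by
    calc ((2 : ℝ) ^ (reps n g I r).card) ^ 2 = 4 ^ (reps n g I r).card := by
          rw [← pow_mul, mul_comm, pow_mul]; norm_num
      _ ≤ ((1.1747 : ℝ) ^ 9) ^ (reps n g I r).card :=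
          pow_le_pow_left₀ (by norm_num) (by norm_num) _
      _ = (1.1747 : ℝ) ^ (9 * (reps n g I r).card) := by rw [← pow_mul]
      _ ≤ (1.1747 : ℝ) ^ ((3 * U.card + (reps n g I r).card) * 2) :=
          pow_le_pow_right₀ (by norm_num) (by omega)
      _ = _ := by rw [baseWeight, ← pow_mul]
  exact (pow_le_pow_iff_left₀ (by positivity) baseWeight_pos.le two_ne_zero).1 hsq

/-- The search tree of a state without tags: its size, and what the sum over its leaves says about
the feasible sets between the set of internal vertices and the complement of the set of leaves. -/
theorem exists_tree (hg : ∀ a b, g a b → a < n ∧ b < n) (hr : r < n) (u : ℕ) : ∀ σ : ℕ → ℕ,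
    σ r = 1 → (∀ t < n, σ (n + t) = 0) → (undec n σ).card = u →
    ∃ a s, Tree n g r σ a s ∧
      (s : ℝ) ≤ 1 + 5 * (u + 1) * weight n g r (inSet n σ) (undec n σ) ∧
      (∀ c, 0 ≤ a c) ∧ (∀ c ≤ n, a c ≤ 2 ^ u * (n * n) ^ n) ∧
      (∀ c, a c ≠ 0 → ∃ S, inSet n σ ⊆ S ∧ S ⊆ inSet n σ ∪ undec n σ ∧ Feasible n g r S ∧
        S.card ≤ c) ∧
      ∀ S, inSet n σ ⊆ S → S ⊆ inSet n σ ∪ undec n σ → Feasible n g r S → 0 < a S.card := by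
  induction u using Nat.strong_induction_on with
  | _ u ih =>
  intro σ hσr hσt hu
  set I := inSet n σ with hI
  set U := undec n σ with hU
  have hrI : r ∈ I := mem_inSet.2 ⟨hr, hσr⟩
  have hUn : U.card ≤ n := (Finset.card_filter_le _ _).trans_eq (Finset.card_range n)
  by_cases hb : Bad n g I U r
  · refine ⟨_, 1, .leaf σ (least_eq_of_forall fun z _ h => h.1 hb), ?_, ?_, ?_, ?_, ?_⟩
    · simp [weight, hb]
    · intro c; simp [leafVal, ← hI, ← hU, hb]
    · intro c _; simp only [leafVal, ← hI, ← hU, hb, if_true]; positivity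
    · intro c h; simp [leafVal, ← hI, ← hU, hb] at h
    · intro S _ hS hF; exact absurd hF (hb.not_feasible hg hS)
  by_cases hn : ∀ p v, ¬ Branch n g r I U p v
  · obtain ⟨a, s, hT, hs, ha⟩ := exists_tree_of_no_branch _ σ hb hn rfl
    have h0 : tagged n g r 0 σ = reps n g I r := by
      ext t
      rw [mem_tagged]
      exact ⟨fun h => h.1, fun h => ⟨h, hσt t (mem_reps.1 h).1⟩⟩
    have h2 : tagged n g r 2 σ = ∅ := by
      ext t
      rw [mem_tagged]
      simp only [Finset.notMem_empty, iff_false, not_and]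
      intro h
      rw [hσt t (mem_reps.1 h).1]; norm_num
    rw [h0] at hs
    -- With all tags still open the leaves below add up to a number of covering walks. It is
    -- nonnegative, which excludes cancellation higher up in the tree.
    have ha' : ∀ c, a c = if I.card ≤ c then
        (numCovering g I U (reps n g I r) (c - I.card) r : ℤ) else 0 := by
      intro c
      rw [ha, h0, h2, ← sum_powerset_numWalks]
      simp only [Finset.empty_union, ← hI, ← hU]
    refine ⟨a, s, hT, ?_, ?_, ?_, ?_, ?_⟩
    · have h1 := two_pow_le_weight hb hn
      have h3 : (s : ℝ) + 3 = 4 * 2 ^ (reps n g I r).card := by exact_mod_cast hs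
      have h4 := weight_nonneg (n := n) (g := g) (r := r) (I := I) (U := U)
      nlinarith [mul_nonneg (Nat.cast_nonneg (α := ℝ) u) h4]
    · intro c; rw [ha']; split_ifs <;> positivity
    · intro c hc
      rw [ha']
      split_ifs
      · have h1 := numCovering_le (g := g) (I := I) hUn (reps n g I r)
          (k := c - I.card) (by omega) r
        have h3 : (n * n) ^ (c - I.card) ≤ (n * n) ^ n :=
          Nat.pow_le_pow_right (Nat.mul_pos (by omega) (by omega)) (by omega)
        have h4 : (numCovering g I U (reps n g I r) (c - I.card) r : ℤ) ≤ (n * n) ^ n := by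
          exact_mod_cast h1.trans h3
        exact h4.trans (le_mul_of_one_le_left (by positivity) (one_le_pow₀ (by norm_num)))
      · positivity
    · intro c hc
      rw [ha'] at hc
      split_ifs at hc with hle
      · obtain ⟨S, h1, h3, h4, h5⟩ := exists_feasible_of_numCovering hrI
          (Nat.pos_of_ne_zero (by exact_mod_cast hc) :
            0 < numCovering g I U (reps n g I r) (c - I.card) r)
        exact ⟨S, h1, h3, h4, by omega⟩
      · exact absurd rfl hc
    · intro S h1 h3 hF
      have hSn : ∀ x ∈ S, x < n := fun x hx => by
        rcases Finset.mem_union.1 (h3 hx) with h | h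
        · exact (mem_inSet.1 h).1
        · exact (mem_undec.1 h).1
      rw [ha', if_pos (Finset.card_le_card h1)]
      exact_mod_cast numCovering_pos hrI h1 h3 hSn hF
  push Not at hn
  obtain ⟨p₀, v₀, hbr₀⟩ := hn
  have hu0 := Finset.card_pos.2 ⟨v₀, hbr₀.mem⟩
  cases u with
  | zero => omega
  | succ u =>
    obtain ⟨hk, hp₀⟩ := pickKey_lt hb (p := p₀) (i := v₀) (.inl hbr₀)
    have hsel := (pickKey_spec hk).2
    -- The least key has class at most `p₀ < 5`, so no representative is tagged while some vertex
    -- can still be branched on.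
    have hbr : Branch n g r I U (pickKey n g r σ / (2 * n)) (pickKey n g r σ % (2 * n)) := by
      rcases hsel with h | ⟨h, -⟩
      · exact h
      · have := hbr₀.class_lt; omega
    have hmin : ∀ q < pickKey n g r σ / (2 * n), ∀ w, ¬ Branch n g r I U q w := fun q hq w hw => by
      have := (pickKey_lt hb (p := q) (i := w) (.inl hw)).2
      omega
    have hadd := weight_add_le hg hb hbr hmin
    have h1w := one_le_weight hb hbr
    set v := pickKey n g r σ % (2 * n) with hv
    have hvU := hbr.mem
    obtain ⟨hvn, hv0⟩ := mem_undec.1 hvU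
    have hvI : v ∉ I := fun h => by have := (mem_inSet.1 h).2; omega
    have hrv : r ≠ v := by rintro h; rw [h] at hσr; omega
    have hc1 : (U.erase v).card = u := by rw [Finset.card_erase_of_mem hvU, hu]; rfl
    have hupd : ∀ k t, t < n → Function.update σ v k (n + t) = 0 := fun k t ht => by
      rw [Function.update_of_ne (by omega)]; exact hσt t ht
    have e1 : inSet n (Function.update σ v 1) = insert v I := inSet_update_one hvn
    have e2 : undec n (Function.update σ v 1) = U.erase v := undec_update (by norm_num)
    have e3 : inSet n (Function.update σ v 2) = I := inSet_update_two hv0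
    have e4 : undec n (Function.update σ v 2) = U.erase v := undec_update (by norm_num)
    obtain ⟨a, k, hT1, hs1, ha1, ha2, ha3, ha4⟩ := ih u (by omega) (Function.update σ v 1)
      (by rwa [Function.update_of_ne hrv]) (hupd 1) (by rw [e2, hc1])
    obtain ⟨b, l, hT2, hs2, hb1, hb2, hb3, hb4⟩ := ih u (by omega) (Function.update σ v 2)
      (by rwa [Function.update_of_ne hrv]) (hupd 2) (by rw [e4, hc1])
    rw [e1, e2] at hs1 ha3 ha4
    rw [e3, e4] at hs2 hb3 hb4
    refine ⟨a + b, k + l + 3, .node σ a b k l hk hT1 hT2, ?_, ?_, ?_, ?_, ?_⟩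
    · push_cast
      set w1 := weight n g r (insert v I) (U.erase v)
      set w2 := weight n g r I (U.erase v)
      set w := weight n g r I U
      -- The bounds for the two subtrees and the `3` steps of the node add up to at most `5 + 5 * (u
      -- + 1) * w`. As `1 ≤ w`, the `5` is absorbed when `u + 1` becomes `u + 2`.
      have hmul : ((u : ℝ) + 1) * (w1 + w2) ≤ (u + 1) * w :=
        mul_le_mul_of_nonneg_left hadd (by positivity)
      nlinarith
    · exact fun c => add_nonneg (ha1 c) (hb1 c)
    · intro c hc
      have := ha2 c hc
      have := hb2 c hc
      rw [Pi.add_apply, pow_succ]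
      linarith
    · intro c hc
      by_cases hac : a c = 0
      · have hbc : b c ≠ 0 := fun h => hc (by rw [Pi.add_apply, hac, h, add_zero])
        obtain ⟨S, h1, h2, h3⟩ := hb3 c hbc
        exact ⟨S, h1, h2.trans (Finset.union_subset_union_right (Finset.erase_subset _ _)), h3⟩
      · obtain ⟨S, h1, h2, h3⟩ := ha3 c hac
        refine ⟨S, (Finset.subset_insert _ _).trans h1, h2.trans ?_, h3⟩
        refine Finset.union_subset (Finset.insert_subset (Finset.mem_union_right _ hvU)
          Finset.subset_union_left) ?_
        exact (Finset.erase_subset _ _).trans Finset.subset_union_right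
    · intro S h1 h2 hF
      rw [Pi.add_apply]
      by_cases hvS : v ∈ S
      · have := ha4 S (Finset.insert_subset hvS h1) (fun x hx => by
          have := h2 hx
          simp only [Finset.mem_union, Finset.mem_insert, Finset.mem_erase] at this ⊢
          by_cases hxv : x = v <;> tauto) hF
        have := hb1 S.card
        omega
      · have := hb4 S h1 (fun x hx => by
          have := h2 hx
          simp only [Finset.mem_union, Finset.mem_erase] at this ⊢
          by_cases hxv : x = v
          · exact absurd (hxv ▸ hx) hvS
          · tauto) hF
        have := ha1 S.card
        omega

end

end MaxLeaf

/-! ### Reachability in a bounded number of steps -/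

namespace MaxLeaf

/-- Reachability in at most `l` steps. -/
def ReachIn (n : ℕ) (g : ℕ → ℕ → Prop) (I : Finset ℕ) : ℕ → ℕ → ℕ → Prop
  | 0, a, b => a = b
  | l + 1, a, b => ReachIn n g I l a b ∨ ∃ k < n, ReachIn n g I l a k ∧ k ∈ I ∧ g k b

section

variable {n : ℕ} {g : ℕ → ℕ → Prop} {I S : Finset ℕ} {a b r v l m : ℕ}

theorem ReachIn.mono (h : ReachIn n g I l a b) (hl : l ≤ m) : ReachIn n g I m a b := by
  induction hl with
  | refl => exact h
  | step _ ih => exact .inl ih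

theorem ReachIn.reach (l : ℕ) : ∀ b, ReachIn n g I l a b → Reach g I a b := by
  induction l with
  | zero => rintro b rfl; exact .refl
  | succ l ih =>
    rintro b (h | ⟨k, -, h, hk⟩)
    · exact ih b h
    · exact .tail (ih k h) hk

/-- The set of vertices reached within `l` steps gains an element for each `l` until it is stable,
and it never has more than `n` elements. -/
theorem reachIn_iff (hg : ∀ a b, g a b → a < n ∧ b < n) (ha : a < n) :
    ReachIn n g I n a b ↔ Reach g I a b := by
  classical
  refine ⟨fun h => ReachIn.reach n b h, fun h => ?_⟩
  let D : ℕ → Finset ℕ := fun l => (Finset.range n).filter fun x => ReachIn n g I l a x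
  have key : ∀ l, (∀ b, Reach g I a b → ReachIn n g I l a b) ∨ l + 1 ≤ (D l).card := by
    intro l
    induction l with
    | zero => exact .inr (Finset.card_pos.2 ⟨a, by
        simp only [D, Finset.mem_filter, Finset.mem_range]; exact ⟨ha, rfl⟩⟩)
    | succ l ih =>
      rcases ih with h | h
      · exact .inl fun b hb => .inl (h b hb)
      · have hsub : D l ⊆ D (l + 1) := fun x hx => by
          simp only [D, Finset.mem_filter] at hx ⊢
          exact ⟨hx.1, .inl hx.2⟩
        by_cases heq : D l = D (l + 1)
        · refine .inl fun b hb => .inl ?_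
          induction hb with
          | refl => exact ReachIn.mono (l := 0) rfl (Nat.zero_le l)
          | @tail b c _ hbc ih =>
            obtain ⟨h1, h2⟩ := hg _ _ hbc.2
            have : c ∈ D (l + 1) := by
              simp only [D, Finset.mem_filter, Finset.mem_range]
              exact ⟨h2, .inr ⟨b, h1, ih, hbc⟩⟩
            rw [← heq] at this
            exact (Finset.mem_filter.1 this).2
        · have := Finset.card_lt_card (hsub.ssubset_of_ne heq)
          exact .inr (by omega)
  rcases key n with h' | h'
  · exact h' b h
  · have : (D n).card ≤ n := (Finset.card_filter_le _ _).trans_eq (Finset.card_range n)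
    omega

/-- At the first moment at which `v` is reached, some vertex of `S` that was reached one step
earlier has an arc to `v`. Being strictly nearer to the root, such parents cannot form a cycle. -/
theorem exists_parent (hg : ∀ a b, g a b → a < n ∧ b < n) (hF : Feasible n g r S) (hr : r < n)
    (hv : v < n) (hvr : v ≠ r) :
    ∃ u < n, u ∈ S ∧ g u v ∧ ∃ l < n, ReachIn n g S l r u ∧ ¬ ReachIn n g S l r v := by
  have h : ReachIn n g S n r v := (reachIn_iff hg hr).2 (hF.2 v hv)
  have key : ∀ m, m ≤ n → ReachIn n g S m r v →
      ∃ l < n, ¬ ReachIn n g S l r v ∧ ReachIn n g S (l + 1) r v := by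
    intro m
    induction m with
    | zero => exact fun _ h => absurd h.symm hvr
    | succ m ih =>
      intro hm h
      by_cases h' : ReachIn n g S m r v
      · exact ih (by omega) h'
      · exact ⟨m, by omega, h', h⟩
  obtain ⟨l, hl, h1, h2⟩ := key n le_rfl h
  obtain ⟨u, hu, h3, h4, h5⟩ := h2.resolve_left h1
  exact ⟨u, hu, h4, h5, l, hl, h3, h1⟩

end

/-! ### Out-branchings and feasible sets -/

section

variable {n : ℕ}

/-- The adjacency relation of a digraph on `Fin n` as a relation on the natural numbers. -/
def arcs (G : Digraph (Fin n)) (i j : ℕ) : Prop :=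
  ∃ (hi : i < n) (hj : j < n), G.Adj ⟨i, hi⟩ ⟨j, hj⟩

theorem arcs_lt (G : Digraph (Fin n)) (a b : ℕ) (h : arcs G a b) : a < n ∧ b < n :=
  ⟨h.1, h.2.1⟩

theorem arcs_coe {G : Digraph (Fin n)} {u v : Fin n} : arcs G u v ↔ G.Adj u v :=
  ⟨fun ⟨_, _, h⟩ => h, fun h => ⟨u.2, v.2, h⟩⟩

/-- Take the internal vertices and the root. For more than one vertex the root is internal anyway,
so leaves and `S` partition the vertices; for `n = 1` the root is counted on both sides. -/
theorem exists_feasible_of_outBranching {G T : Digraph (Fin n)} {r : Fin n}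
    (h : G.IsOutBranching T r) : ∃ S, S ⊆ Finset.range n ∧ Feasible n (arcs G) r S ∧
      (n = 1 ∨ T.leaves.ncard + S.card ≤ n) := by
  classical
  let A : Finset (Fin n) := Finset.univ.filter fun v => ∃ w, T.Adj v w
  let S : Finset ℕ := insert (r : ℕ) (A.image Fin.val)
  refine ⟨S, ?_, ⟨Finset.mem_insert_self _ _, ?_⟩, ?_⟩
  · intro x hx
    simp only [S, Finset.mem_insert, Finset.mem_image] at hx
    obtain rfl | ⟨y, -, rfl⟩ := hx
    · simp
    · simp
  · intro x hx
    have : ∀ y : Fin n, Relation.ReflTransGen T.Adj r y → Reach (arcs G) S r y := by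
      intro y hy
      induction hy with
      | refl => exact .refl
      | @tail b c _ hbc ih =>
        refine .tail ih ⟨?_, arcs_coe.2 (h.arc_mem _ _ hbc)⟩
        exact Finset.mem_insert_of_mem (Finset.mem_image_of_mem _ (by simp [A]; exact ⟨c, hbc⟩))
    exact this ⟨x, hx⟩ (h.reachable _)
  · by_cases hn : n = 1
    · exact .inl hn
    right
    have hr : r ∈ A := by
      have : ∃ v : Fin n, v ≠ r := by
        by_contra hall
        push Not at hall
        have : Subsingleton (Fin n) := ⟨fun a b => (hall a).trans (hall b).symm⟩
        have := Fin.subsingleton_iff_le_one.1 this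
        have := r.2
        omega
      obtain ⟨v, hv⟩ := this
      obtain ⟨w, hw, -⟩ := Relation.ReflTransGen.cases_head (h.reachable v) |>.resolve_left hv.symm
      simp only [A, Finset.mem_filter, Finset.mem_univ, true_and]
      exact ⟨w, hw⟩
    have hS : S = A.image Fin.val :=
      Finset.insert_eq_of_mem (Finset.mem_image_of_mem _ hr)
    have hl : T.leaves = ((Aᶜ : Finset (Fin n)) : Set (Fin n)) := by
      ext v; simp [Digraph.leaves, A]
    rw [hS, Finset.card_image_of_injective _ Fin.val_injective, hl, Set.ncard_coe_finset,
      Finset.card_compl, Fintype.card_fin]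
    have := Finset.card_le_univ A
    rw [Fintype.card_fin] at this
    omega

/-- Parents are strictly nearer to `r`, so induction on the distance yields reachability. Vertices
outside `S` are nobody's parent, so there are at least `n - S.card` leaves. By minimality of `S` no
other out-branching has more; the case `n = 1` is separate. -/
theorem isMaxLeafOutBranching_of_parents {G T : Digraph (Fin n)} {r : Fin n} {S : Finset ℕ}
    (hS : S ⊆ Finset.range n) (hF : Feasible n (arcs G) r S)
    (hmin : ∀ (r' : Fin n) (S' : Finset ℕ), S' ⊆ Finset.range n → Feasible n (arcs G) r' S' →
      S.card ≤ S'.card)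
    {par : ℕ → ℕ} (hpar : ∀ v < n, v ≠ r → par v ∈ S ∧ arcs G (par v) v ∧
      ∃ l, ReachIn n (arcs G) S l r (par v) ∧ ¬ ReachIn n (arcs G) S l r v)
    (hT : ∀ u v : Fin n, T.Adj u v ↔ v ≠ r ∧ par v = u) : G.IsMaxLeafOutBranching T r := by
  classical
  have hne : ∀ v : Fin n, v ≠ r → (v : ℕ) ≠ r := fun v h h' => h (Fin.ext h')
  refine ⟨⟨?_, ?_, ?_, ?_⟩, ?_⟩
  · intro u v huv
    obtain ⟨h1, h2⟩ := (hT u v).1 huv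
    have := (hpar v v.2 (hne v h1)).2.1
    rw [h2] at this
    exact arcs_coe.1 this
  · exact fun u h => ((hT u r).1 h).1 rfl
  · intro v hv
    have hlt := (arcs_lt G _ _ (hpar v v.2 (hne v hv)).2.1).1
    exact ⟨⟨par v, hlt⟩, (hT _ _).2 ⟨hv, rfl⟩, fun u hu => Fin.ext ((hT u v).1 hu).2.symm⟩
  · have key : ∀ l, ∀ v : Fin n, ReachIn n (arcs G) S l r v → Relation.ReflTransGen T.Adj r v := by
      intro l
      induction l using Nat.strong_induction_on with
      | _ l ih =>
      intro v hv
      by_cases hvr : v = r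
      · exact hvr ▸ .refl
      · obtain ⟨-, h2, m, h3, h4⟩ := hpar v v.2 (hne v hvr)
        have hml : m < l := by
          by_contra hle
          exact h4 (hv.mono (by omega))
        exact .tail (ih m hml ⟨par v, (arcs_lt G _ _ h2).1⟩ h3) ((hT _ _).2 ⟨hvr, rfl⟩)
    intro v
    exact key n v ((reachIn_iff (arcs_lt G) r.2).2 (hF.2 v v.2))
  · intro T' r' h'
    obtain ⟨S', hS', hF', h1⟩ := exists_feasible_of_outBranching h'
    have hle := hmin r' S' hS' hF'
    rcases h1 with h1 | h1
    · subst h1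
      have hall : T.leaves = Set.univ := by
        ext v
        simp only [Digraph.leaves, Set.mem_ofPred_eq, Set.mem_univ, iff_true]
        exact fun w hw => ((hT v w).1 hw).1 (Subsingleton.elim _ _)
      rw [hall]
      exact Set.ncard_le_ncard (Set.subset_univ _) Set.finite_univ
    · have hsub : (((Finset.univ.filter fun v : Fin n => (v : ℕ) ∉ S) : Finset (Fin n)) :
          Set (Fin n)) ⊆ T.leaves := by
        intro v hv w hw
        obtain ⟨h2, h3⟩ := (hT v w).1 hw
        have := (hpar w w.2 (hne w h2)).1
        rw [h3] at this
        simp at hv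
        exact hv this
      have h2 := Set.ncard_le_ncard hsub (Set.toFinite _)
      rw [Set.ncard_coe_finset] at h2
      have h3 := Finset.card_filter_add_card_filter_not (s := (Finset.univ : Finset (Fin n)))
        (fun v : Fin n => (v : ℕ) ∈ S)
      have h4 : (Finset.univ.filter fun v : Fin n => (v : ℕ) ∈ S).card ≤ S.card := by
        refine Finset.card_le_card_of_injOn Fin.val (fun v hv => ?_) Fin.val_injective.injOn
        simpa using hv
      rw [Finset.card_univ, Fintype.card_fin] at h3
      omega

end

/-! ### Telling counts from zero by small moduli -/

/-- A positive number which is not too large is not divisible by all small numbers. -/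
theorem exists_not_dvd {N B : ℕ} (hN : 0 < N) (hB : 0 < B) (h : 2 * B * N < 4 ^ B) :
    ∃ m, 0 < m ∧ m ≤ 2 * B ∧ ¬ m ∣ N := by
  by_contra hall
  push Not at hall
  -- Every prime power occurring in the central binomial coefficient is at most `2 * B`. If all
  -- numbers up to `2 * B` divided `N`, this coefficient, which is at least `4 ^ B / (2 * B)`, would
  -- divide it too.
  have hdvd : B.centralBinom ∣ N := by
    rw [← Nat.factorization_le_iff_dvd B.centralBinom_ne_zero hN.ne']
    intro p
    by_cases hp : p.Prime
    · have h1 : p ^ B.centralBinom.factorization p ≤ 2 * B :=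
        Nat.pow_factorization_choose_le (by omega)
      exact (hp.pow_dvd_iff_le_factorization hN.ne').1
        (hall _ (pow_pos hp.pos _) h1)
    · simp [Nat.factorization_eq_zero_of_not_prime _ hp]
  have h2 := Nat.le_of_dvd hN hdvd
  have h3 := Nat.four_pow_le_two_mul_self_mul_centralBinom B hB
  have h4 : 2 * B * B.centralBinom ≤ 2 * B * N := Nat.mul_le_mul_left _ h2
  omega

/-- This makes `exists_not_dvd` applicable with `B = (n + 2) ^ 2` to the counts, which are at most
`2 ^ n * (n * n) ^ n` by `exists_tree`. -/
theorem mul_lt_four_pow (n : ℕ) :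
    2 * (n + 2) ^ 2 * (2 ^ n * (n * n) ^ n) < 4 ^ ((n + 2) ^ 2) := by
  have h1 : n ≤ 2 ^ n := Nat.lt_two_pow_self.le
  have h2 : n + 2 ≤ 2 ^ (n + 2) := Nat.lt_two_pow_self.le
  calc 2 * (n + 2) ^ 2 * (2 ^ n * (n * n) ^ n)
      ≤ 2 * (2 ^ (n + 2)) ^ 2 * (2 ^ n * (2 ^ n * 2 ^ n) ^ n) := by gcongr
    _ = 2 ^ (1 + (n + 2) * 2 + n + (n + n) * n) := by
        rw [← pow_add, ← pow_mul, ← pow_mul]; ring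
    _ < 2 ^ (2 * (n + 2) ^ 2) := Nat.pow_lt_pow_right (by norm_num) (by nlinarith)
    _ = 4 ^ ((n + 2) ^ 2) := by rw [pow_mul]; norm_num

end MaxLeaf

/-! ### Terms for logical operations -/

namespace RAM

/-- The term, read as a condition, holds in the state. -/
def Tm.Holds (e : Tm) (h : State) : Prop := e.eval h ≠ 0

/-- Conjunction. -/
def Tm.and (a b : Tm) : Tm := .op .mul a b
/-- Disjunction. -/
def Tm.or (a b : Tm) : Tm := .op .add a b
/-- Negation. -/
def Tm.not (a : Tm) : Tm := .op .eq a (.const 0)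
/-- Implication. -/
def Tm.imp (a b : Tm) : Tm := (Tm.not a).or b
/-- Equality. -/
def Tm.eq (a b : Tm) : Tm := .op .eq a b
/-- Comparison. -/
def Tm.lt (a b : Tm) : Tm := .op .lt a b
/-- Sum. -/
def Tm.add (a b : Tm) : Tm := .op .add a b
/-- Product. -/
def Tm.mul (a b : Tm) : Tm := .op .mul a b
/-- Bounded existential quantifier. -/
def Tm.ex (x : ℕ) (b e : Tm) : Tm := .sum x b e
/-- Bounded universal quantifier. -/
def Tm.all (x : ℕ) (b e : Tm) : Tm := .not (.ex x b (.not e))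
/-- The truth value of a condition. -/
def Tm.bool (e : Tm) : Tm := .op .lt (.const 0) e
/-- The number of values below `b` which satisfy the condition. -/
def Tm.cnt (x : ℕ) (b e : Tm) : Tm := .sum x b e.bool
/-- The least value of the register `x` below `b` which satisfies the condition. -/
def Tm.leastT (x y : ℕ) (b e : Tm) : Tm :=
  .cnt y b (.all x (.add (.reg y) (.const 1)) (.not e))
/-- The value of `b` if the register `x` has the value of `e`. -/
def Tm.letT (x : ℕ) (e b : Tm) : Tm :=
  .sum x (.add e (.const 1)) (.mul (.eq (.reg x) e) b)

namespace Tm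

variable {a b e : Tm} {h : State} {x y : ℕ}

theorem holds_and : (Tm.and a b).Holds h ↔ a.Holds h ∧ b.Holds h := by
  simp [Tm.and, Holds, eval, Op.eval]

theorem holds_or : (Tm.or a b).Holds h ↔ a.Holds h ∨ b.Holds h := by
  simp only [Tm.or, Holds, eval, Op.eval]; omega

theorem holds_not : (Tm.not a).Holds h ↔ ¬ a.Holds h := by
  simp only [Tm.not, Holds, eval, Op.eval]
  split_ifs with h <;> simp [h]

theorem holds_imp : (Tm.imp a b).Holds h ↔ (a.Holds h → b.Holds h) := by
  rw [Tm.imp, holds_or, holds_not]; tauto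

theorem holds_eq : (Tm.eq a b).Holds h ↔ a.eval h = b.eval h := by
  simp [Tm.eq, Holds, eval, Op.eval]

theorem holds_lt : (Tm.lt a b).Holds h ↔ a.eval h < b.eval h := by
  simp [Tm.lt, Holds, eval, Op.eval]

theorem holds_ex : (Tm.ex x b e).Holds h ↔ ∃ i < b.eval h, e.Holds (h.set x i) := by
  simp only [Tm.ex, Holds, eval, ne_eq, Finset.sum_eq_zero_iff, Finset.mem_range, not_forall]
  simp

theorem holds_all : (Tm.all x b e).Holds h ↔ ∀ i < b.eval h, e.Holds (h.set x i) := by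
  simp only [Tm.all, holds_not, holds_ex]
  push Not
  rfl

open Classical in
theorem eval_bool : e.bool.eval h = if e.Holds h then 1 else 0 := by
  simp only [Tm.bool, Holds, eval, Op.eval, Nat.pos_iff_ne_zero]
  congr

open Classical in
theorem eval_cnt : (Tm.cnt x b e).eval h =
    ((Finset.range (b.eval h)).filter fun i => e.Holds (h.set x i)).card := by
  rw [Finset.card_filter]
  simp only [Tm.cnt, eval, eval_bool]

theorem eval_add : (Tm.add a b).eval h = a.eval h + b.eval h := rfl
theorem eval_mul : (Tm.mul a b).eval h = a.eval h * b.eval h := rfl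
theorem eval_reg : (Tm.reg x).eval h = h.reg x := rfl
theorem eval_const : (Tm.const x).eval h = x := rfl
theorem eval_load : (Tm.load a).eval h = h.mem (a.eval h) := rfl
theorem eval_sum : (Tm.sum x b e).eval h =
    ∑ i ∈ Finset.range (b.eval h), e.eval (h.set x i) := rfl

/-- The term counts the `z` such that no `i ≤ z` has the property, and these are precisely the
numbers below the least one that has it. -/
theorem eval_leastT {p : ℕ → Prop}
    (hp : ∀ z < b.eval h, ∀ i ≤ z, e.Holds ((h.set y z).set x i) ↔ p i) :
    (Tm.leastT x y b e).eval h = MaxLeaf.least (b.eval h) p := by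
  classical
  rw [Tm.leastT, eval_cnt]
  have : ((Finset.range (b.eval h)).filter fun z =>
      (Tm.all x (.add (.reg y) (.const 1)) (.not e)).Holds (h.set y z)) =
      Finset.range (MaxLeaf.least (b.eval h) p) := by
    ext z
    simp only [Finset.mem_filter, Finset.mem_range, holds_all, eval_add, eval_reg, eval_const,
      State.set_reg_self, holds_not]
    constructor
    · rintro ⟨hz, hall⟩
      by_contra hlt
      have hle := not_lt.1 hlt
      exact hall _ (Nat.lt_succ_of_le hle) ((hp z hz _ hle).2
        (MaxLeaf.least_spec (hle.trans_lt hz)))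
    · intro hz
      have hzb := hz.trans_le (MaxLeaf.least_le _ _)
      exact ⟨hzb, fun i hi => fun hh =>
        MaxLeaf.not_of_lt_least ((Nat.lt_succ_iff.1 hi).trans_lt hz) ((hp z hzb i (by omega)).1 hh)⟩
  rw [this, Finset.card_range]

/-- In the sum over `x` the factor `x = e` keeps a single summand. For this the value of `e` must
not depend on the register `x`. -/
theorem eval_letT (he : ∀ i, e.eval (h.set x i) = e.eval h) :
    (Tm.letT x e b).eval h = b.eval (h.set x (e.eval h)) := by
  simp only [Tm.letT, eval_sum, eval_add, eval_const, eval_mul]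
  rw [Finset.sum_eq_single (e.eval h)]
  · simp [Tm.eq, eval, Op.eval, he]
  · intro i _ hi
    simp [Tm.eq, eval, Op.eval, he, hi]
  · intro hn; simp at hn

end Tm

/-! ### Terms about the state of the search -/

/-- The cell `i` of the table `k`; the register `2` contains the width of the tables. -/
def Tm.tb (k : ℕ) (i : Tm) : Tm := .load (.add (.mul (.reg 2) (.const k)) i)

/-- The cell `i` of the table `k` of width `W`. -/
def State.tbl (h : State) (W k i : ℕ) : ℕ := h.mem (W * k + i)

/-- The number of vertices. -/
def nT : Tm := .reg 0
/-- There is an arc from the vertex in the register `a` to the vertex in the register `b`. -/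
def adjT (a b : ℕ) : Tm := .tb 0 (.add (.mul (.reg a) nT) (.reg b))
/-- Reachability between the vertices in the registers `a` and `b`. -/
def reachT (a b : ℕ) : Tm :=
  .tb 4 (.add (.mul nT (.mul nT nT)) (.add (.mul (.reg a) nT) (.reg b)))
/-- The vertex in the register `a` is internal. -/
def inT (a : ℕ) : Tm := .eq (.tb 2 (.reg a)) (.const 1)
/-- The vertex in the register `a` is undecided. -/
def undT (a : ℕ) : Tm := .and (.lt (.reg a) nT) (.eq (.tb 2 (.reg a)) (.const 0))
/-- The vertex in the register `t` represents a source component. -/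
def repT (t : ℕ) : Tm := .and (.not (reachT 1 t)) <| .all 20 nT <|
  .imp (reachT 20 t) (.and (reachT t 20) (.not (.lt (.reg 20) (.reg t))))
/-- The vertex in the register `v` enters the component of the vertex in the register `t`. -/
def entT (v t : ℕ) : Tm := .and (.not (.eq (.reg v) (.reg t))) <|
  .ex 21 nT <| .and (reachT 21 t) (adjT v 21)
/-- The vertex in the register `v` hits the vertex in the register `t`. -/
def hitsT (v t : ℕ) : Tm := .or (.eq (.reg v) (.reg t)) <|
  .ex 21 nT <| .and (adjT v 21) (reachT 21 t)
/-- The number of vertices which enter a component. -/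
def indT (t : ℕ) : Tm := .cnt 22 nT (.and (undT 22) (entT 22 t))
/-- The number of components entered by a vertex. -/
def outdT (v : ℕ) : Tm := .cnt 23 nT (.and (repT 23) (entT v 23))
/-- Some component cannot be entered. -/
def badT : Tm := .ex 24 nT (.and (repT 24) (.eq (indT 24) (.const 0)))
/-- The vertex in the register `v` enters a component of in-degree `k`. -/
def entDegT (v k : ℕ) : Tm :=
  .ex 24 nT (.and (repT 24) (.and (entT v 24) (.eq (indT 24) (.const k))))
/-- The vertex in the register `v` enters a component of in-degree `3` entered by vertices of high
out-degree only. -/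
def entHighT (v : ℕ) : Tm :=
  .ex 24 nT <| .and (repT 24) <| .and (entT v 24) <| .and (.eq (indT 24) (.const 3)) <|
    .all 25 nT <| .imp (undT 25) <| .imp (entT 25 24) (.not (.lt (outdT 25) (.const 3)))
/-- The item in the register `v` can be selected in the class in the register `p`. -/
def selT (p v : ℕ) : Tm :=
  .or (.and (.eq (.reg p) (.const 0)) (.and (undT v) (entDegT v 1))) <|
  .or (.and (.eq (.reg p) (.const 1))
    (.and (undT v) (.and (.not (.lt (outdT v) (.const 3))) (entDegT v 2)))) <|
  .or (.and (.eq (.reg p) (.const 2)) (.and (undT v) (entDegT v 2))) <|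
  .or (.and (.eq (.reg p) (.const 3)) (.and (undT v) (.not (.lt (outdT v) (.const 4))))) <|
  .or (.and (.eq (.reg p) (.const 4)) (.and (undT v) (entHighT v))) <|
  .and (.eq (.reg p) (.const 5)) (.ex 24 nT <| .and (repT 24) <|
    .and (.eq (.reg v) (.add nT (.reg 24))) (.eq (.tb 2 (.reg v)) (.const 0)))
/-- The number of items. -/
def itemsT : Tm := .mul (.const 2) nT
/-- The selected class and item. -/
def pickT : Tm := .leastT 28 29 (.mul (.const 12) nT) <| .and (.not badT) <|
  .ex 26 (.const 6) <| .ex 27 itemsT <|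
    .and (.eq (.reg 28) (.add (.reg 27) (.mul itemsT (.reg 26)))) (selT 26 27)

end RAM

namespace MaxLeaf

open RAM

/-- The state contains the digraph, the root, the statuses of the items, and the tables of
reachability. -/
structure Env (n : ℕ) (g : ℕ → ℕ → Prop) (r W : ℕ) (σ : ℕ → ℕ) (h : State) : Prop where
  reg_n : h.reg 0 = n
  reg_r : h.reg 1 = r
  reg_W : h.reg 2 = W
  adj : ∀ i < n, ∀ j < n, (h.tbl W 0 (i * n + j) ≠ 0 ↔ g i j)
  st : ∀ i < 2 * n, h.tbl W 2 i = σ i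
  reach : ∀ i < n, ∀ j < n,
    (h.tbl W 4 (n * (n * n) + (i * n + j)) ≠ 0 ↔ Reach g (inSet n σ) i j)

section

variable {n : ℕ} {g : ℕ → ℕ → Prop} {r W : ℕ} {σ : ℕ → ℕ} {h : State} {a b v t p : ℕ}

/-! ### Values of the terms that describe the search -/

theorem Env.set (E : Env n g r W σ h) {x y : ℕ} (hx : 3 ≤ x) : Env n g r W σ (h.set x y) where
  reg_n := by rw [State.set_reg, if_neg (by omega), E.reg_n]
  reg_r := by rw [State.set_reg, if_neg (by omega), E.reg_r]
  reg_W := by rw [State.set_reg, if_neg (by omega), E.reg_W]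
  adj := E.adj
  st := E.st
  reach := E.reach

theorem eval_tb {k : ℕ} {e : Tm} (hW : h.reg 2 = W) :
    (Tm.tb k e).eval h = h.tbl W k (e.eval h) := by
  rw [Tm.tb, Tm.eval_load, Tm.eval_add, Tm.eval_mul, Tm.eval_reg, Tm.eval_const, hW, State.tbl]

theorem Env.eval_nT (E : Env n g r W σ h) : nT.eval h = n := E.reg_n

theorem Env.holds_adjT (E : Env n g r W σ h) (ha : h.reg a < n) (hb : h.reg b < n) :
    (adjT a b).Holds h ↔ g (h.reg a) (h.reg b) := by
  rw [← E.adj _ ha _ hb, Tm.Holds, adjT, eval_tb E.reg_W, Tm.eval_add, Tm.eval_mul, E.eval_nT]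
  rfl

theorem Env.holds_reachT (E : Env n g r W σ h) (ha : h.reg a < n) (hb : h.reg b < n) :
    (reachT a b).Holds h ↔ Reach g (inSet n σ) (h.reg a) (h.reg b) := by
  rw [← E.reach _ ha _ hb, Tm.Holds, reachT, eval_tb E.reg_W]
  simp only [Tm.eval_add, Tm.eval_mul, E.eval_nT, Tm.eval_reg]

theorem Env.holds_inT (E : Env n g r W σ h) (ha : h.reg a < n) :
    (inT a).Holds h ↔ h.reg a ∈ inSet n σ := by
  rw [inT, Tm.holds_eq, eval_tb E.reg_W, Tm.eval_reg, Tm.eval_const, E.st _ (by omega), mem_inSet]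
  simp [ha]

theorem Env.holds_undT (E : Env n g r W σ h) :
    (undT a).Holds h ↔ h.reg a ∈ undec n σ := by
  rw [undT, Tm.holds_and, Tm.holds_eq, Tm.holds_lt, eval_tb E.reg_W, Tm.eval_reg, Tm.eval_const,
    E.eval_nT, mem_undec]
  exact and_congr_right fun ha => by rw [E.st _ (by omega)]

theorem Env.holds_repT (E : Env n g r W σ h) (hr : r < n) (ht : t ≠ 20) (htn : h.reg t < n) :
    (repT t).Holds h ↔ h.reg t ∈ reps n g (inSet n σ) r := by
  have hr' : h.reg 1 < n := E.reg_r.symm ▸ hr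
  rw [repT, Tm.holds_and, Tm.holds_not, Tm.holds_all, E.holds_reachT hr' htn, E.reg_r, E.eval_nT,
    mem_reps, IsRep, and_iff_right htn]
  refine and_congr Iff.rfl (forall₂_congr fun w hw => ?_)
  have E' := E.set (x := 20) (y := w) (by norm_num)
  have h1 : (h.set 20 w).reg t = h.reg t := by rw [State.set_reg, if_neg ht]
  have h2 : (h.set 20 w).reg 20 = w := State.set_reg_self _ _ _
  rw [Tm.holds_imp, Tm.holds_and, Tm.holds_not, Tm.holds_lt, E'.holds_reachT (by rwa [h2])
    (by rwa [h1]), E'.holds_reachT (by rwa [h1]) (by rwa [h2]), Tm.eval_reg, Tm.eval_reg, h1, h2,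
    not_lt]

theorem Env.holds_entT (E : Env n g r W σ h) (hv : v ≠ 21) (ht : t ≠ 21) (hvn : h.reg v < n)
    (htn : h.reg t < n) :
    (entT v t).Holds h ↔ Enters n g (inSet n σ) (h.reg v) (h.reg t) := by
  rw [entT, Tm.holds_and, Tm.holds_not, Tm.holds_eq, Tm.holds_ex, E.eval_nT, Enters]
  refine and_congr Iff.rfl (exists_congr fun w => and_congr_right fun hw => ?_)
  have E' := E.set (x := 21) (y := w) (by norm_num)
  have h1 : (h.set 21 w).reg t = h.reg t := by rw [State.set_reg, if_neg ht]
  have h2 : (h.set 21 w).reg 21 = w := State.set_reg_self _ _ _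
  have h3 : (h.set 21 w).reg v = h.reg v := by rw [State.set_reg, if_neg hv]
  rw [Tm.holds_and, E'.holds_reachT (by rwa [h2]) (by rwa [h1]),
    E'.holds_adjT (by rwa [h3]) (by rwa [h2]), h1, h2, h3]

theorem Env.holds_hitsT (E : Env n g r W σ h) (hg : ∀ a b, g a b → a < n ∧ b < n)
    (hv : v ≠ 21) (ht : t ≠ 21) (hvn : h.reg v < n) (htn : h.reg t < n) :
    (hitsT v t).Holds h ↔ Hits g (inSet n σ) (h.reg v) (h.reg t) := by
  rw [hitsT, Tm.holds_or, Tm.holds_eq, Tm.holds_ex, E.eval_nT, Hits]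
  refine or_congr Iff.rfl (exists_congr fun w => ?_)
  have E' := E.set (x := 21) (y := w) (by norm_num)
  have h1 : (h.set 21 w).reg t = h.reg t := by rw [State.set_reg, if_neg ht]
  have h2 : (h.set 21 w).reg 21 = w := State.set_reg_self _ _ _
  have h3 : (h.set 21 w).reg v = h.reg v := by rw [State.set_reg, if_neg hv]
  -- The term only looks for vertices below `n`, which is no restriction because arcs end below `n`.
  rw [← and_iff_right_of_imp (fun h : g (h.reg v) w ∧ _ => (hg _ _ h.1).2)]
  refine and_congr_right fun hw => ?_
  rw [Tm.holds_and, E'.holds_reachT (by rwa [h2]) (by rwa [h1]),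
    E'.holds_adjT (by rwa [h3]) (by rwa [h2]), h1, h2, h3]

theorem count_eq {s t : Finset ℕ} {p : ℕ → Prop} (h : ∀ i, i ∈ t ↔ i ∈ s ∧ p i) :
    count s p = t.card := by
  classical
  unfold count
  congr 1
  ext i
  rw [Finset.mem_filter, h]

theorem Env.eval_indT (E : Env n g r W σ h) (ht : t ≠ 21) (ht' : t ≠ 22) (htn : h.reg t < n) :
    (indT t).eval h = inDeg n g (inSet n σ) (undec n σ) (h.reg t) := by
  classical
  rw [indT, Tm.eval_cnt, E.eval_nT, inDeg]
  refine (count_eq fun v => ?_).symm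
  have E' := E.set (x := 22) (y := v) (by norm_num)
  have h1 : (h.set 22 v).reg t = h.reg t := by rw [State.set_reg, if_neg ht']
  have h2 : (h.set 22 v).reg 22 = v := State.set_reg_self _ _ _
  rw [Finset.mem_filter, Finset.mem_range, Tm.holds_and, E'.holds_undT, h2]
  rw [← and_assoc, and_iff_right_of_imp (fun h => (mem_undec.1 h).1)]
  refine and_congr_right fun hv => ?_
  have := (mem_undec.1 hv).1
  rw [E'.holds_entT (by norm_num) ht (by rwa [h2]) (by rwa [h1]), h1, h2]

theorem Env.eval_outdT (E : Env n g r W σ h) (hr : r < n) (hv : v ≠ 21) (hv' : v ≠ 23)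
    (hvn : h.reg v < n) : (outdT v).eval h = outDeg n g (inSet n σ) r (h.reg v) := by
  classical
  rw [outdT, Tm.eval_cnt, E.eval_nT, outDeg]
  refine (count_eq fun t => ?_).symm
  have E' := E.set (x := 23) (y := t) (by norm_num)
  have h1 : (h.set 23 t).reg v = h.reg v := by rw [State.set_reg, if_neg hv']
  have h2 : (h.set 23 t).reg 23 = t := State.set_reg_self _ _ _
  rw [Finset.mem_filter, Finset.mem_range, Tm.holds_and]
  rw [← and_iff_right_of_imp (fun h : t ∈ reps n g (inSet n σ) r ∧ _ => (mem_reps.1 h.1).1)]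
  refine and_congr_right fun htn => ?_
  rw [E'.holds_repT hr (by norm_num) (by rwa [h2]),
    E'.holds_entT hv (by norm_num) (by rwa [h1]) (by rwa [h2]), h1, h2]

/-- A condition on a representative in the register `24`. -/
theorem Env.holds_ex_repT (E : Env n g r W σ h) (hr : r < n) {e : Tm} {q : ℕ → Prop}
    (he : ∀ t ∈ reps n g (inSet n σ) r, (e.Holds (h.set 24 t) ↔ q t)) :
    (Tm.ex 24 nT (.and (repT 24) e)).Holds h ↔ ∃ t ∈ reps n g (inSet n σ) r, q t := by
  rw [Tm.holds_ex, E.eval_nT]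
  refine exists_congr fun t => ?_
  have E' := E.set (x := 24) (y := t) (by norm_num)
  have h2 : (h.set 24 t).reg 24 = t := State.set_reg_self _ _ _
  rw [Tm.holds_and]
  constructor
  · rintro ⟨htn, h3, h4⟩
    rw [E'.holds_repT hr (by norm_num) (by rwa [h2]), h2] at h3
    exact ⟨h3, (he t h3).1 h4⟩
  · rintro ⟨h3, h4⟩
    have htn := (mem_reps.1 h3).1
    refine ⟨htn, ?_, (he t h3).2 h4⟩
    rwa [E'.holds_repT hr (by norm_num) (by rwa [h2]), h2]

theorem Env.holds_badT (E : Env n g r W σ h) (hr : r < n) :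
    badT.Holds h ↔ Bad n g (inSet n σ) (undec n σ) r := by
  refine E.holds_ex_repT hr fun t ht => ?_
  have E' := E.set (x := 24) (y := t) (by norm_num)
  have h2 : (h.set 24 t).reg 24 = t := State.set_reg_self _ _ _
  have htn := (mem_reps.1 ht).1
  rw [Tm.holds_eq, E'.eval_indT (by norm_num) (by norm_num) (by rwa [h2]), h2, Tm.eval_const]

theorem Env.holds_entDegT (E : Env n g r W σ h) (hr : r < n) (hv : v ≠ 21) (hv' : v ≠ 24)
    (hvn : h.reg v < n) (k : ℕ) : (entDegT v k).Holds h ↔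
      ∃ t ∈ reps n g (inSet n σ) r, Enters n g (inSet n σ) (h.reg v) t ∧
        inDeg n g (inSet n σ) (undec n σ) t = k := by
  refine E.holds_ex_repT hr fun t ht => ?_
  have E' := E.set (x := 24) (y := t) (by norm_num)
  have h1 : (h.set 24 t).reg v = h.reg v := by rw [State.set_reg, if_neg hv']
  have h2 : (h.set 24 t).reg 24 = t := State.set_reg_self _ _ _
  have htn := (mem_reps.1 ht).1
  rw [Tm.holds_and, Tm.holds_eq, E'.eval_indT (by norm_num) (by norm_num) (by rwa [h2]),
    E'.holds_entT hv (by norm_num) (by rwa [h1]) (by rwa [h2]), h1, h2, Tm.eval_const]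

theorem Env.holds_entHighT (E : Env n g r W σ h) (hr : r < n) (hv : v ≠ 21) (hv' : v ≠ 24)
    (hvn : h.reg v < n) : (entHighT v).Holds h ↔
      ∃ t ∈ reps n g (inSet n σ) r, Enters n g (inSet n σ) (h.reg v) t ∧
        inDeg n g (inSet n σ) (undec n σ) t = 3 ∧ ∀ w ∈ undec n σ,
          Enters n g (inSet n σ) w t → 3 ≤ outDeg n g (inSet n σ) r w := by
  refine E.holds_ex_repT hr fun t ht => ?_
  have E' := E.set (x := 24) (y := t) (by norm_num)
  have h1 : (h.set 24 t).reg v = h.reg v := by rw [State.set_reg, if_neg hv']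
  have h2 : (h.set 24 t).reg 24 = t := State.set_reg_self _ _ _
  have htn := (mem_reps.1 ht).1
  rw [Tm.holds_and, Tm.holds_and, Tm.holds_eq, Tm.holds_all,
    E'.eval_indT (by norm_num) (by norm_num) (by rwa [h2]),
    E'.holds_entT hv (by norm_num) (by rwa [h1]) (by rwa [h2]), h1, h2, Tm.eval_const, E'.eval_nT]
  refine and_congr Iff.rfl (and_congr Iff.rfl ?_)
  have key : ∀ w < n, (Tm.imp (undT 25) (.imp (entT 25 24)
      (.not (.lt (outdT 25) (.const 3))))).Holds ((h.set 24 t).set 25 w) ↔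
      (w ∈ undec n σ → Enters n g (inSet n σ) w t → 3 ≤ outDeg n g (inSet n σ) r w) := by
    intro w hw
    have E2 := E'.set (x := 25) (y := w) (by norm_num)
    have h3 : ((h.set 24 t).set 25 w).reg 24 = t := by
      rw [State.set_reg, if_neg (by norm_num), h2]
    have h4 : ((h.set 24 t).set 25 w).reg 25 = w := State.set_reg_self _ _ _
    rw [Tm.holds_imp, Tm.holds_imp, E2.holds_undT, Tm.holds_not, Tm.holds_lt,
      E2.holds_entT (by norm_num) (by norm_num) (by rwa [h4]) (by rwa [h3]),
      E2.eval_outdT hr (by norm_num) (by norm_num) (by rwa [h4]), h3, h4, Tm.eval_const, not_lt]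
  constructor
  · exact fun H w hw => (key w (mem_undec.1 hw).1).1 (H w (mem_undec.1 hw).1) hw
  · exact fun H w hw => (key w hw).2 (H w)

theorem branch_iff {I U : Finset ℕ} {p v : ℕ} : Branch n g r I U p v ↔
    (p = 0 ∧ v ∈ U ∧ ∃ t ∈ reps n g I r, Enters n g I v t ∧ inDeg n g I U t = 1) ∨
    (p = 1 ∧ v ∈ U ∧ 3 ≤ outDeg n g I r v ∧
      ∃ t ∈ reps n g I r, Enters n g I v t ∧ inDeg n g I U t = 2) ∨
    (p = 2 ∧ v ∈ U ∧ ∃ t ∈ reps n g I r, Enters n g I v t ∧ inDeg n g I U t = 2) ∨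
    (p = 3 ∧ v ∈ U ∧ 4 ≤ outDeg n g I r v) ∨
    (p = 4 ∧ v ∈ U ∧ ∃ t ∈ reps n g I r, Enters n g I v t ∧ inDeg n g I U t = 3 ∧
      ∀ w ∈ U, Enters n g I w t → 3 ≤ outDeg n g I r w) := by
  match p with
  | 0 => simp [Branch]
  | 1 => simp [Branch]
  | 2 => simp [Branch]
  | 3 => simp [Branch]
  | 4 => simp [Branch]
  | p + 5 => simp [Branch]

theorem Env.holds_selT (E : Env n g r W σ h) (hr : r < n) (hv : v ≠ 21) (hv' : v ≠ 24)
    (hv'' : v ≠ 23) (hvn : h.reg v < 2 * n) :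
    (selT p v).Holds h ↔ Sel n g r σ (h.reg p) (h.reg v) := by
  -- The item may be a tag, with a number from `n` on. The lemmas about vertices apply only after it
  -- is known to be undecided.
  have hlt : h.reg v ∈ undec n σ → h.reg v < n := fun H => (mem_undec.1 H).1
  have hlast : (Tm.ex 24 nT <| .and (repT 24) <| .and (.eq (.reg v) (.add nT (.reg 24)))
      (.eq (.tb 2 (.reg v)) (.const 0))).Holds h ↔
      ∃ t ∈ reps n g (inSet n σ) r, h.reg v = n + t ∧ σ (h.reg v) = 0 := by
    refine E.holds_ex_repT hr fun t ht => ?_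
    have E' := E.set (x := 24) (y := t) (by norm_num)
    have h1 : (h.set 24 t).reg v = h.reg v := by rw [State.set_reg, if_neg hv']
    have h2 : (h.set 24 t).reg 24 = t := State.set_reg_self _ _ _
    rw [Tm.holds_and, Tm.holds_eq, Tm.holds_eq, Tm.eval_add, E'.eval_nT, eval_tb E'.reg_W,
      Tm.eval_reg, Tm.eval_reg, Tm.eval_const, h1, h2, E'.st _ hvn]
  rw [selT, Sel, branch_iff]
  simp only [Tm.holds_or, Tm.holds_and, E.holds_undT, Tm.holds_eq, Tm.eval_reg, Tm.eval_const,
    hlast, or_assoc]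
  refine or_congr (and_congr_right fun _ => and_congr_right fun hU => ?_) <|
    or_congr (and_congr_right fun _ => and_congr_right fun hU => ?_) <|
    or_congr (and_congr_right fun _ => and_congr_right fun hU => ?_) <|
    or_congr (and_congr_right fun _ => and_congr_right fun hU => ?_) <|
    or_congr (and_congr_right fun _ => and_congr_right fun hU => ?_) Iff.rfl
  · exact E.holds_entDegT hr hv hv' (hlt hU) 1
  · rw [Tm.holds_not, Tm.holds_lt, E.eval_outdT hr hv hv'' (hlt hU), Tm.eval_const, not_lt,
      E.holds_entDegT hr hv hv' (hlt hU) 2]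
  · exact E.holds_entDegT hr hv hv' (hlt hU) 2
  · rw [Tm.holds_not, Tm.holds_lt, E.eval_outdT hr hv hv'' (hlt hU), Tm.eval_const, not_lt]
  · exact E.holds_entHighT hr hv hv' (hlt hU)

theorem Env.eval_pickT (E : Env n g r W σ h) (hr : r < n) :
    pickT.eval h = pickKey n g r σ := by
  have e1 : ∀ {h : State}, Env n g r W σ h → itemsT.eval h = 2 * n := fun E => by
    rw [itemsT, Tm.eval_mul, E.eval_nT, Tm.eval_const]
  rw [pickT, Tm.eval_leastT (p := fun z => ¬ Bad n g (inSet n σ) (undec n σ) r ∧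
    ∃ p < 6, ∃ i < 2 * n, z = i + 2 * n * p ∧ Sel n g r σ p i)]
  · rw [Tm.eval_mul, E.eval_nT, Tm.eval_const, pickKey]
    refine least_congr fun z hz => and_congr_right fun _ => ?_
    constructor
    · rintro ⟨p, hp, i, hi, rfl, hs⟩
      rwa [Nat.add_mul_div_left _ _ (by omega), Nat.div_eq_of_lt hi, zero_add,
        Nat.add_mul_mod_self_left, Nat.mod_eq_of_lt hi]
    · intro hs
      refine ⟨z / (2 * n), ?_, z % (2 * n), Nat.mod_lt _ (by omega), ?_, hs⟩
      · rw [Nat.div_lt_iff_lt_mul (by omega)]; omega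
      · rw [Nat.mod_add_div]
  · intro z _ i _
    have E2 : Env n g r W σ ((h.set 29 z).set 28 i) :=
      (E.set (x := 29) (y := z) (by norm_num)).set (x := 28) (y := i) (by norm_num)
    generalize hh2 : (h.set 29 z).set 28 i = h2 at E2
    have hi : h2.reg 28 = i := by rw [← hh2]; exact State.set_reg_self _ _ _
    rw [Tm.holds_and, Tm.holds_not, E2.holds_badT hr, Tm.holds_ex, Tm.eval_const]
    refine and_congr Iff.rfl (exists_congr fun p => and_congr_right fun hp => ?_)
    have E3 := E2.set (x := 26) (y := p) (by norm_num)
    rw [Tm.holds_ex, e1 E3]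
    refine exists_congr fun j => and_congr_right fun hj => ?_
    have E4 := E3.set (x := 27) (y := j) (by norm_num)
    have h27 : ((h2.set 26 p).set 27 j).reg 27 = j := State.set_reg_self _ _ _
    have h26 : ((h2.set 26 p).set 27 j).reg 26 = p := by
      rw [State.set_reg, if_neg (by norm_num), State.set_reg_self]
    have h28 : ((h2.set 26 p).set 27 j).reg 28 = i := by
      rw [State.set_reg, if_neg (by norm_num), State.set_reg, if_neg (by norm_num), hi]
    rw [Tm.holds_and, Tm.holds_eq, Tm.eval_reg, Tm.eval_add, Tm.eval_mul, e1 E4, Tm.eval_reg,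
      Tm.eval_reg, E4.holds_selT hr (by norm_num) (by norm_num) (by norm_num) (by rwa [h27]),
      h27, h26, h28]

end

end MaxLeaf

/-! ### Running commands -/

namespace RAM

/-- The command turns one state into the other one in at most `T` steps. -/
def HRun (N : ℕ) (c : Cmd) (h h' : State) (T : ℕ) : Prop := ∃ k ≤ T, HExec N c h h' k

/-- The address of the cell `i` of the table `k`. -/
def Tm.addr (k : ℕ) (i : Tm) : Tm := .add (.mul (.reg 2) (.const k)) i

/-- Tabulation: fill the table `k` with the values of `e`, with the index in the register `13`. -/
def tabC (k : ℕ) (len e : Tm) : Cmd := .seq (.assign 13 (.const 0)) <|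
  .while (.lt (.reg 13) len) <|
    .seq (.store (.addr k (.reg 13)) e) (.assign 13 (.add (.reg 13) (.const 1)))

/-- The state `h'` arises from `h` by writing the first `z` values of `f` into the table `k`. -/
structure Fill (W k : ℕ) (f : ℕ → ℕ) (z : ℕ) (h h' : State) : Prop where
  reg : ∀ x, x ≠ 13 → h'.reg x = h.reg x
  out : ∀ a, (∀ i < z, a ≠ W * k + i) → h'.mem a = h.mem a
  inn : ∀ i < z, h'.mem (W * k + i) = f i

section

variable {N W k k' z Z T T' i j x v : ℕ} {f : ℕ → ℕ} {h h' h'' : State} {c c' : Cmd} {a e : Tm}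

theorem HRun.mono (H : HRun N c h h' T) (hT : T ≤ T') : HRun N c h h' T' :=
  let ⟨k, hk, h⟩ := H
  ⟨k, hk.trans hT, h⟩

theorem HRun.seq (H : HRun N c h h' T) (H' : HRun N c' h' h'' T') :
    HRun N (.seq c c') h h'' (T + T') :=
  let ⟨k, hk, h⟩ := H
  let ⟨k', hk', h'⟩ := H'
  ⟨k + k', Nat.add_le_add hk hk', .seq h h'⟩

theorem HRun.assign (he : e.eval h = v) (hv : v ≤ N) : HRun N (.assign x e) h (h.set x v) 1 := by
  subst he; exact ⟨1, le_rfl, .assign h x e hv⟩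

theorem HRun.store (ha : a.eval h = i) (he : e.eval h = v) (hv : v ≤ N) :
    HRun N (.store a e) h (h.put i v) 1 := by
  subst he ha; exact ⟨1, le_rfl, .store h a e hv⟩

theorem HRun.ite_true (he : e.Holds h) (H : HRun N c h h' T) :
    HRun N (.ite e c c') h h' (T + 1) :=
  let ⟨k, hk, h⟩ := H
  ⟨k + 1, by omega, .ite_true he h⟩

theorem HRun.ite_false (he : ¬ e.Holds h) (H : HRun N c' h h' T) :
    HRun N (.ite e c c') h h' (T + 1) :=
  let ⟨k, hk, h⟩ := H
  ⟨k + 1, by omega, .ite_false (by simpa [Tm.Holds] using he) h⟩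

theorem HRun.while_true (he : e.Holds h) (H : HRun N c h h' T)
    (H' : HRun N (.while e c) h' h'' T') : HRun N (.while e c) h h'' (T + T' + 1) :=
  let ⟨k, hk, h⟩ := H
  let ⟨k', hk', h'⟩ := H'
  ⟨k + k' + 1, by omega, .while_true he h h'⟩

theorem HRun.while_false (he : ¬ e.Holds h) : HRun N (.while e c) h h 1 :=
  ⟨1, le_rfl, .while_false (by simpa [Tm.Holds] using he)⟩

theorem HRun.skip : HRun N .skip h h 1 := ⟨1, le_rfl, .skip h⟩

theorem Tm.eval_op (o : Op) (a b : Tm) (h : State) :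
    (Tm.op o a b).eval h = o.eval (a.eval h) (b.eval h) := rfl

theorem eval_addr (hW : h.reg 2 = W) : (Tm.addr k a).eval h = W * k + a.eval h := by
  rw [Tm.addr, Tm.eval_add, Tm.eval_mul, Tm.eval_reg, Tm.eval_const, hW]

theorem cell_eq_iff (hi : i < W) (hj : j < W) : W * k + i = W * k' + j ↔ k = k' ∧ i = j := by
  constructor
  · intro h
    have h1 : (W * k + i) / W = (W * k' + j) / W := by rw [h]
    rw [Nat.mul_add_div (by omega), Nat.mul_add_div (by omega), Nat.div_eq_of_lt hi,
      Nat.div_eq_of_lt hj] at h1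
    have h2 : k = k' := by simpa using h1
    subst h2
    exact ⟨rfl, by omega⟩
  · rintro ⟨rfl, rfl⟩; rfl

theorem Fill.tbl_ne (F : Fill W k f z h h') (hz : z ≤ W) (hk : k' ≠ k) (hi : i < W) :
    h'.tbl W k' i = h.tbl W k' i :=
  F.out _ fun _ hj he => hk ((cell_eq_iff hi (hj.trans_le hz)).1 he).1

theorem Fill.tbl_eq (F : Fill W k f z h h') (hi : i < z) : h'.tbl W k i = f i := F.inn i hi

theorem Fill.tbl_ge (F : Fill W k f z h h') (hi : z ≤ i) : h'.tbl W k i = h.tbl W k i :=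
  F.out _ fun _ hj he => by omega

theorem tbl_put (hi : i < W) (hj : j < W) :
    (h.put (W * k + i) v).tbl W k' j = if k' = k ∧ j = i then v else h.tbl W k' j := by
  simp only [State.tbl, State.put_mem, cell_eq_iff hj hi]

/-- While entry `z` is computed the earlier entries of the same table are already in place, so that
tabulation covers dynamic programming. Each entry takes a test, a store and an increment. -/
theorem run_tab {len : Tm} (hW : h.reg 2 = W) (hZ : Z ≤ N)
    (hlen : ∀ h' : State, (∀ x, x ≠ 13 → h'.reg x = h.reg x) → len.eval h' = Z)
    (he : ∀ z < Z, ∀ h', Fill W k f z h h' → h'.reg 13 = z → e.eval h' = f z)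
    (hf : ∀ z < Z, f z ≤ N) :
    ∃ h', HRun N (tabC k len e) h h' (3 * Z + 2) ∧ Fill W k f Z h h' := by
  have loop : ∀ m z, z + m = Z → ∀ h₁, Fill W k f z h h₁ → h₁.reg 13 = z →
      ∃ h', HRun N (.while (.lt (.reg 13) len) <|
        .seq (.store (.addr k (.reg 13)) e) (.assign 13 (.add (.reg 13) (.const 1)))) h₁ h'
        (3 * m + 1) ∧ Fill W k f Z h h' := by
    intro m
    induction m with
    | zero =>
      intro z hz h₁ F h13
      obtain rfl : z = Z := by simpa using hz
      refine ⟨h₁, .while_false ?_, F⟩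
      rw [Tm.holds_lt, hlen h₁ F.reg, Tm.eval_reg, h13]
      exact lt_irrefl _
    | succ m ih =>
      intro z hz h₁ F h13
      set h₂ := h₁.put (W * k + z) (f z) with hh₂
      set h₃ := h₂.set 13 (z + 1) with hh₃
      have r1 : HRun N (.store (.addr k (.reg 13)) e) h₁ h₂ 1 := by
        refine HRun.store ?_ (he z (by omega) h₁ F h13) (hf z (by omega))
        rw [eval_addr (by rw [F.reg 2 (by norm_num), hW]), Tm.eval_reg, h13]
      have r2 : HRun N (.assign 13 (.add (.reg 13) (.const 1))) h₂ h₃ 1 := by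
        refine HRun.assign ?_ (by omega)
        rw [Tm.eval_add, Tm.eval_reg, Tm.eval_const, hh₂, State.put_reg, h13]
      have F3 : Fill W k f (z + 1) h h₃ := by
        refine ⟨fun x hx => ?_, fun a ha => ?_, fun i hi => ?_⟩
        · rw [hh₃, State.set_reg, if_neg hx]; exact F.reg x hx
        · rw [hh₃, State.set_mem, hh₂, State.put_mem, if_neg (ha z (by omega))]
          exact F.out a fun i hi => ha i (by omega)
        · rw [hh₃, State.set_mem, hh₂, State.put_mem]
          split_ifs with h
          · congr 1; omega
          · exact F.inn i (by omega)
      obtain ⟨h', r3, F'⟩ := ih (z + 1) (by omega) h₃ F3 (State.set_reg_self _ _ _)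
      refine ⟨h', (HRun.while_true ?_ (r1.seq r2) r3).mono (by omega), F'⟩
      rw [Tm.holds_lt, hlen h₁ F.reg, Tm.eval_reg, h13]
      omega
  obtain ⟨h', r, F⟩ := loop Z 0 (by simp) (h.set 13 0)
    ⟨fun x hx => by rw [State.set_reg, if_neg hx], fun _ _ => rfl, by simp⟩
    (State.set_reg_self _ _ _)
  exact ⟨h', (HRun.seq (HRun.assign rfl (Nat.zero_le _)) r).mono (by omega), F⟩

end

/-- The index in a tabulation. -/
def zT : Tm := .reg 13
/-- The square of the number of vertices. -/
def nnT : Tm := .mul nT nT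

/-- Tabulate reachability in a bounded number of steps. -/
def reachC : Cmd := tabC 4 (.mul (.add nT (.const 1)) nnT) <|
  .letT 32 (.op .mod zT nT) <| .bool <|
    .or (.and (.lt zT nnT) (.eq (.op .div zT nT) (.reg 32))) <|
    .and (.not (.lt zT nnT)) <| .or (.tb 4 (.op .sub zT nnT)) <|
      .ex 33 nT <| .and (.tb 4 (.add (.op .sub (.op .sub zT nnT) (.reg 32)) (.reg 33))) <|
        .and (inT 33) (adjT 33 32)

/-- The representative in the register `t` has tag `2`. -/
def tagT (t : ℕ) : Tm := .eq (.tb 2 (.add nT (.reg t))) (.const 2)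

/-- Tabulate the numbers of branching walks modulo the register `7`. -/
def walksC : Cmd := tabC 5 (.mul (.add nT (.const 1)) nT) <|
  .letT 30 (.op .div zT nT) <| .letT 31 (.op .mod zT nT) <|
    .op .mod (.add (.mul (.eq (.reg 30) (.const 0))
      (.bool (.not (.ex 24 nT (.and (repT 24) (.and (tagT 24) (hitsT 31 24)))))))
      (.sum 32 nT <| .mul (.bool (.and (undT 32) (hitsT 31 32))) <|
        .sum 33 (.reg 30) <| .mul (.tb 5 (.add (.mul (.reg 33) nT) (.reg 32)))
          (.tb 5 (.add (.mul (.op .sub (.op .sub (.reg 30) (.const 1)) (.reg 33)) nT)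
            (.reg 31))))) (.reg 7)

/-- The number of internal vertices. -/
def cardT : Tm := .cnt 20 nT (inT 20)
/-- The number of representatives with tag `2`, modulo `2`. -/
def parityT : Tm := .op .mod (.cnt 24 nT (.and (repT 24) (tagT 24))) (.const 2)

/-- Add the contribution of a leaf of the search tree to the table `6`. -/
def accC : Cmd := tabC 6 (.add nT (.const 1)) <|
  .op .mod (.add (.tb 6 zT) <|
    .mul (.bool (.and (.not badT) (.not (.lt zT cardT)))) <|
    .letT 30 (.tb 5 (.add (.mul (.op .sub zT cardT) nT) (.reg 1))) <|
      .add (.mul (.eq parityT (.const 0)) (.reg 30))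
        (.mul (.eq parityT (.const 1)) (.op .sub (.reg 7) (.reg 30)))) (.reg 7)

end RAM

namespace MaxLeaf

open RAM

/-- The width of the tables. -/
def width (n : ℕ) : ℕ := (n + 1) ^ 3

/-- The widest table is that of reachability, with `n + 1` layers of `n * n` entries. All tables
share the width, and table `0` starts at address `0`, so the input matrix is in place from the
outset. -/
theorem width_bounds (n : ℕ) : (n + 1) * (n * n) ≤ width n ∧ (n + 1) * n ≤ width n ∧
    2 * n < width n ∧ n * n < width n := by
  unfold width
  refine ⟨?_, ?_, ?_, ?_⟩ <;> ring_nf <;> nlinarith [Nat.zero_le (n ^ 2), Nat.zero_le (n ^ 3)]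

theorem idx_lt {n i j : ℕ} (hi : i < n) (hj : j < n) : i * n + j < n * n := by nlinarith

/-- The state contains the digraph, the root and the statuses of the items. -/
structure Base (n : ℕ) (g : ℕ → ℕ → Prop) (r : ℕ) (σ : ℕ → ℕ) (h : State) : Prop where
  reg_n : h.reg 0 = n
  reg_r : h.reg 1 = r
  reg_W : h.reg 2 = width n
  adj : ∀ i < n, ∀ j < n, (h.tbl (width n) 0 (i * n + j) ≠ 0 ↔ g i j)
  st : ∀ i < 2 * n, h.tbl (width n) 2 i = σ i

section

variable {n N m : ℕ} {g : ℕ → ℕ → Prop} {r : ℕ} {σ : ℕ → ℕ} {h h' : State}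

theorem Base.set (E : Base n g r σ h) {x y : ℕ} (hx : 3 ≤ x) : Base n g r σ (h.set x y) where
  reg_n := by rw [State.set_reg, if_neg (by omega), E.reg_n]
  reg_r := by rw [State.set_reg, if_neg (by omega), E.reg_r]
  reg_W := by rw [State.set_reg, if_neg (by omega), E.reg_W]
  adj := E.adj
  st := E.st

theorem Base.fill (E : Base n g r σ h) {k z : ℕ} {f : ℕ → ℕ} (F : Fill (width n) k f z h h')
    (hk : k ≠ 0) (hk' : k ≠ 2) (hz : z ≤ width n) : Base n g r σ h' where
  reg_n := by rw [F.reg _ (by norm_num), E.reg_n]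
  reg_r := by rw [F.reg _ (by norm_num), E.reg_r]
  reg_W := by rw [F.reg _ (by norm_num), E.reg_W]
  adj := fun i hi j hj => by
    rw [F.tbl_ne hz hk.symm ((idx_lt hi hj).trans (width_bounds n).2.2.2)]
    exact E.adj i hi j hj
  st := fun i hi => by
    rw [F.tbl_ne hz hk'.symm (hi.trans (width_bounds n).2.2.1)]
    exact E.st i hi

theorem Env.base (E : Env n g r (width n) σ h) : Base n g r σ h :=
  ⟨E.reg_n, E.reg_r, E.reg_W, E.adj, E.st⟩

theorem Env.fill (E : Env n g r (width n) σ h) {k z : ℕ} {f : ℕ → ℕ}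
    (F : Fill (width n) k f z h h') (hk : k ≠ 0) (hk' : k ≠ 2) (hk4 : k ≠ 4) (hz : z ≤ width n) :
    Env n g r (width n) σ h' :=
  let B := E.base.fill F hk hk' hz
  { reg_n := B.reg_n, reg_r := B.reg_r, reg_W := B.reg_W, adj := B.adj, st := B.st
    reach := fun i hi j hj => by
      rw [F.tbl_ne hz hk4.symm]
      · exact E.reach i hi j hj
      · have := idx_lt hi hj
        have := (width_bounds n).1
        rw [add_mul, one_mul] at this
        omega }

theorem Base.eval_nT (E : Base n g r σ h) : nT.eval h = n := E.reg_n

theorem Base.eval_nnT (E : Base n g r σ h) : nnT.eval h = n * n := by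
  rw [nnT, Tm.eval_mul, E.eval_nT]

theorem Base.holds_adjT (E : Base n g r σ h) {a b : ℕ} (ha : h.reg a < n) (hb : h.reg b < n) :
    (adjT a b).Holds h ↔ g (h.reg a) (h.reg b) := by
  rw [← E.adj _ ha _ hb, Tm.Holds, adjT, eval_tb E.reg_W, Tm.eval_add, Tm.eval_mul, E.eval_nT]
  rfl

theorem Base.holds_inT (E : Base n g r σ h) {a : ℕ} (ha : h.reg a < n) :
    (inT a).Holds h ↔ h.reg a ∈ inSet n σ := by
  rw [inT, Tm.holds_eq, eval_tb E.reg_W, Tm.eval_reg, Tm.eval_const, E.st _ (by omega), mem_inSet]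
  simp [ha]

/-! ### Tabulating reachability, walks and counts -/

theorem idx3_div {l i j : ℕ} (hi : i < n) (hj : j < n) :
    (l * (n * n) + (i * n + j)) / (n * n) = l ∧
    (l * (n * n) + (i * n + j)) / n % n = i ∧ (l * (n * n) + (i * n + j)) % n = j := by
  have hn : 0 < n := by omega
  refine ⟨?_, ?_, ?_⟩
  · rw [mul_comm l, Nat.mul_add_div (Nat.mul_pos hn hn), Nat.div_eq_of_lt (idx_lt hi hj), add_zero]
  · rw [show l * (n * n) + (i * n + j) = n * (i + n * l) + j by ring, Nat.mul_add_div hn,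
      Nat.div_eq_of_lt hj, add_zero, Nat.add_mul_mod_self_left, Nat.mod_eq_of_lt hi]
  · rw [show l * (n * n) + (i * n + j) = j + n * (i + n * l) by ring, Nat.add_mul_mod_self_left,
      Nat.mod_eq_of_lt hj]

theorem exists_idx3 {z : ℕ} (hz : z < (n + 1) * (n * n)) :
    ∃ l i j, l ≤ n ∧ i < n ∧ j < n ∧ z = l * (n * n) + (i * n + j) := by
  have hn : 0 < n := Nat.pos_of_ne_zero fun h => by simp [h] at hz
  refine ⟨z / n / n, z / n % n, z % n, ?_, Nat.mod_lt _ hn, Nat.mod_lt _ hn, ?_⟩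
  · rw [Nat.div_div_eq_div_mul, ← Nat.lt_succ_iff, Nat.div_lt_iff_lt_mul (Nat.mul_pos hn hn)]
    exact hz
  · have h1 := Nat.div_add_mod z n
    have h2 := Nat.div_add_mod (z / n) n
    calc z = n * (z / n) + z % n := h1.symm
      _ = n * (n * (z / n / n) + z / n % n) + z % n := by rw [h2]
      _ = _ := by ring

open Classical in
/-- The tabulation of reachability. -/
theorem Base.run_reachC (E : Base n g r σ h) (hg : ∀ a b, g a b → a < n ∧ b < n)
    (hN : width n ≤ N) :
    ∃ h', HRun N reachC h h' (3 * width n + 2) ∧ Env n g r (width n) σ h' ∧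
      (∃ f, Fill (width n) 4 f ((n + 1) * (n * n)) h h') ∧
      ∀ l ≤ n, ∀ i < n, ∀ j < n, (h'.tbl (width n) 4 (l * (n * n) + (i * n + j)) ≠ 0 ↔
        ReachIn n g (inSet n σ) l i j) := by
  have hW := (width_bounds n).1
  let f : ℕ → ℕ := fun z =>
    if ReachIn n g (inSet n σ) (z / (n * n)) (z / n % n) (z % n) then 1 else 0
  have hfidx : ∀ l i j, i < n → j < n → f (l * (n * n) + (i * n + j)) =
      if ReachIn n g (inSet n σ) l i j then 1 else 0 := by
    intro l i j hi hj
    obtain ⟨h1, h2, h3⟩ := idx3_div (l := l) hi hj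
    simp only [f, h1, h2, h3]
  have key := run_tab (N := N) (k := 4) (f := f) (Z := (n + 1) * (n * n)) (h := h)
    (len := .mul (.add nT (.const 1)) nnT)
    (e := .letT 32 (.op .mod zT nT) <| .bool <|
    .or (.and (.lt zT nnT) (.eq (.op .div zT nT) (.reg 32))) <|
    .and (.not (.lt zT nnT)) <| .or (.tb 4 (.op .sub zT nnT)) <|
      .ex 33 nT <| .and (.tb 4 (.add (.op .sub (.op .sub zT nnT) (.reg 32)) (.reg 33))) <|
        .and (inT 33) (adjT 33 32)) E.reg_W (hW.trans hN)
  refine Exists.elim (key ?_ ?_ ?_) fun h' hh => ?_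
  · intro h₁ hr
    rw [Tm.eval_mul, Tm.eval_add, nnT, Tm.eval_mul, nT, Tm.eval_reg, Tm.eval_const,
      hr 0 (by norm_num), E.reg_n]
  · intro z hz h₁ F h13
    have B := E.fill F (by norm_num) (by norm_num) (hz.le.trans hW)
    obtain ⟨l, i, j, hl, hi, hj, hzz⟩ := exists_idx3 hz
    obtain ⟨d1, d2, d3⟩ := idx3_div (l := l) hi hj
    rw [← hzz] at d1 d2 d3
    have hmod : ∀ h₂ : State, h₂.reg 0 = n → h₂.reg 13 = z →
        (Tm.op .mod zT nT).eval h₂ = j := fun h₂ e1 e2 => by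
      rw [← d3, ← e1, ← e2]; rfl
    rw [Tm.eval_letT (fun y => by
      rw [hmod _ (B.set (by norm_num)).reg_n, hmod h₁ B.reg_n h13]
      rw [State.set_reg, if_neg (by norm_num), h13]), hmod h₁ B.reg_n h13, Tm.eval_bool]
    have B2 := B.set (x := 32) (y := j) (by norm_num)
    have hz2 : zT.eval (h₁.set 32 j) = z := by
      rw [zT, Tm.eval_reg, State.set_reg, if_neg (by norm_num), h13]
    have h32 : (h₁.set 32 j).reg 32 = j := State.set_reg_self _ _ _
    have hsub : (Tm.op .sub zT nnT).eval (h₁.set 32 j) = z - n * n := by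
      rw [Tm.eval, hz2, B2.eval_nnT, Op.eval]
    have htb : ∀ i', i' < z → (h₁.tbl (width n) 4 i' ≠ 0 ↔
        ReachIn n g (inSet n σ) (i' / (n * n)) (i' / n % n) (i' % n)) := fun i' hi' => by
      rw [F.tbl_eq hi']; simp only [f]; split_ifs with hR <;> simp [hR]
    -- If `z` is the entry `(i, j)` of a layer other than the first, the cell `z - n * n - j + k` is
    -- the entry `(i, k)` of the layer before it.
    have hex : (Tm.ex 33 nT <| .and (.tb 4 (.add (.op .sub (.op .sub zT nnT) (.reg 32)) (.reg 33)))
        (.and (inT 33) (adjT 33 32))).Holds (h₁.set 32 j) ↔ ∃ k < n,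
          h₁.tbl (width n) 4 (z - n * n - j + k) ≠ 0 ∧ k ∈ inSet n σ ∧ g k j := by
      rw [Tm.holds_ex, B2.eval_nT]
      refine exists_congr fun k => and_congr_right fun hk => ?_
      have B3 := B2.set (x := 33) (y := k) (by norm_num)
      have e33 : ((h₁.set 32 j).set 33 k).reg 33 = k := State.set_reg_self _ _ _
      have e32 : ((h₁.set 32 j).set 33 k).reg 32 = j := by
        rw [State.set_reg, if_neg (by norm_num), h32]
      have e13 : ((h₁.set 32 j).set 33 k).reg 13 = z := by
        rw [State.set_reg, if_neg (by norm_num), State.set_reg, if_neg (by norm_num), h13]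
      rw [Tm.holds_and, Tm.holds_and, B3.holds_inT (by rwa [e33]),
        B3.holds_adjT (by rwa [e33]) (by rwa [e32]), e33, e32, Tm.Holds, eval_tb B3.reg_W,
        Tm.eval_add, Tm.eval_op, Tm.eval_op, Tm.eval_reg, Tm.eval_reg, B3.eval_nnT, zT,
        Tm.eval_reg, e13, e33, e32]
      rfl
    have hval : (Tm.or (.and (.lt zT nnT) (.eq (.op .div zT nT) (.reg 32))) <|
        .and (.not (.lt zT nnT)) <| .or (.tb 4 (.op .sub zT nnT)) <|
        .ex 33 nT <| .and (.tb 4 (.add (.op .sub (.op .sub zT nnT) (.reg 32)) (.reg 33))) <|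
        .and (inT 33) (adjT 33 32)).Holds (h₁.set 32 j) ↔ ReachIn n g (inSet n σ) l i j := by
      rw [Tm.holds_or, Tm.holds_and, Tm.holds_and, Tm.holds_or, Tm.holds_not, Tm.holds_lt,
        Tm.holds_eq, hex, hz2, B2.eval_nnT, Tm.eval_reg, h32, Tm.eval, hz2, B2.eval_nT]
      have hT : (Tm.tb 4 (.op .sub zT nnT)).Holds (h₁.set 32 j) ↔
          h₁.tbl (width n) 4 (z - n * n) ≠ 0 := by
        rw [Tm.Holds, eval_tb B2.reg_W, hsub]; rfl
      rw [hT]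
      have hij := idx_lt hi hj
      cases l with
      | zero =>
        have hlt : z < n * n := by omega
        have hdiv : z / n = i := by
          rw [← d2, Nat.mod_eq_of_lt]
          rw [Nat.div_lt_iff_lt_mul (by omega)]; exact hlt
        simp [hlt, Op.eval, hdiv, ReachIn]
      | succ l =>
        rw [add_mul, one_mul] at hzz
        have hge : ¬ z < n * n := by omega
        have hz1 : z - n * n = l * (n * n) + (i * n + j) := by clear hex; omega
        rw [ReachIn]
        simp only [hge, false_and, not_false_eq_true, true_and, false_or]
        rw [htb _ (by omega), hz1, (idx3_div hi hj).1, (idx3_div hi hj).2.1, (idx3_div hi hj).2.2]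
        refine or_congr Iff.rfl (exists_congr fun k => and_congr_right fun hk => ?_)
        have hik := idx_lt hi hk
        rw [show l * (n * n) + (i * n + j) - j + k = l * (n * n) + (i * n + k) by
          clear hex; omega,
          htb _ (by omega), (idx3_div hi hk).1, (idx3_div hi hk).2.1, (idx3_div hi hk).2.2]
    rw [hzz, hfidx l i j hi hj]
    simp only [hval]
  · intro z _
    have : 0 < width n := by unfold width; positivity
    simp only [f]; split_ifs <;> omega
  · obtain ⟨r1, F⟩ := hh
    have hl : ∀ l ≤ n, ∀ i < n, ∀ j < n, (h'.tbl (width n) 4 (l * (n * n) + (i * n + j)) ≠ 0 ↔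
        ReachIn n g (inSet n σ) l i j) := by
      intro l hl i hi j hj
      rw [F.tbl_eq, hfidx l i j hi hj]
      · split_ifs with hR <;> simp [hR]
      · have := idx_lt hi hj
        have : l * (n * n) ≤ n * (n * n) := Nat.mul_le_mul_right _ hl
        rw [add_mul, one_mul]; omega
    have B := E.fill F (by norm_num) (by norm_num) hW
    refine ⟨h', r1.mono (by omega), ⟨B.reg_n, B.reg_r, B.reg_W, B.adj, B.st, ?_⟩, ⟨f, F⟩, hl⟩
    intro i hi j hj
    rw [hl n le_rfl i hi j hj, reachIn_iff hg hi]

theorem Env.holds_tagT (E : Env n g r (width n) σ h) {t : ℕ} (ht : h.reg t < n) :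
    (tagT t).Holds h ↔ σ (n + h.reg t) = 2 := by
  rw [tagT, Tm.holds_eq, eval_tb E.reg_W, Tm.eval_add, E.eval_nT, Tm.eval_reg, Tm.eval_const,
    E.st _ (by omega)]

theorem idx2_div {k v : ℕ} (hv : v < n) : (k * n + v) / n = k ∧ (k * n + v) % n = v := by
  have hn : 0 < n := by omega
  rw [mul_comm, Nat.mul_add_div hn, Nat.div_eq_of_lt hv, add_zero, Nat.mul_add_mod,
    Nat.mod_eq_of_lt hv]
  exact ⟨rfl, rfl⟩

theorem idx2_lt {i k w v : ℕ} (hw : w < n) (hi : i < k) : i * n + w < k * n + v := by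
  have : (i + 1) * n ≤ k * n := Nat.mul_le_mul_right _ hi
  rw [add_mul, one_mul] at this
  omega

open Classical in
/-- The tabulation of the numbers of branching walks. -/
theorem Env.run_walksC (E : Env n g r (width n) σ h) (hg : ∀ a b, g a b → a < n ∧ b < n)
    (hr : r < n) (h7 : h.reg 7 = m) (hm : 0 < m) (hmN : m ≤ N) (hN : width n ≤ N) :
    ∃ h', HRun N walksC h h' (3 * width n + 2) ∧ ∃ f, Fill (width n) 5 f ((n + 1) * n) h h' ∧
      ∀ k ≤ n, ∀ v < n, h'.tbl (width n) 5 (k * n + v) =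
        numWalks g (inSet n σ) (undec n σ) (tagged n g r 2 σ) k v % m := by
  have hW := (width_bounds n).2.1
  set nw := numWalks g (inSet n σ) (undec n σ) (tagged n g r 2 σ) with hnw
  let f : ℕ → ℕ := fun z => nw (z / n) (z % n) % m
  have hf : ∀ k v, v < n → f (k * n + v) = nw k v % m := fun k v hv => by
    simp only [f, (idx2_div (k := k) hv).1, (idx2_div (k := k) hv).2]
  have key := run_tab (N := N) (k := 5) (f := f) (Z := (n + 1) * n) (h := h)
    (len := .mul (.add nT (.const 1)) nT)
    (e := .letT 30 (.op .div zT nT) <| .letT 31 (.op .mod zT nT) <|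
    .op .mod (.add (.mul (.eq (.reg 30) (.const 0))
      (.bool (.not (.ex 24 nT (.and (repT 24) (.and (tagT 24) (hitsT 31 24)))))))
      (.sum 32 nT <| .mul (.bool (.and (undT 32) (hitsT 31 32))) <|
        .sum 33 (.reg 30) <| .mul (.tb 5 (.add (.mul (.reg 33) nT) (.reg 32)))
          (.tb 5 (.add (.mul (.op .sub (.op .sub (.reg 30) (.const 1)) (.reg 33)) nT)
            (.reg 31))))) (.reg 7)) E.reg_W (hW.trans hN)
  refine Exists.elim (key ?_ ?_ ?_) fun h' hh => ?_
  · intro h₁ hr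
    rw [Tm.eval_mul, Tm.eval_add, nT, Tm.eval_reg, Tm.eval_const, hr 0 (by norm_num), E.reg_n]
  · intro z hz h₁ F h13
    have B := E.fill F (by norm_num) (by norm_num) (by norm_num) (hz.le.trans hW)
    have hn : 0 < n := by omega
    obtain ⟨k, v, hv, hzz⟩ : ∃ k v, v < n ∧ z = k * n + v :=
      ⟨z / n, z % n, Nat.mod_lt _ hn, (Nat.div_add_mod' z n).symm⟩
    have hd := (idx2_div (k := k) hv).1
    have hd' := (idx2_div (k := k) hv).2
    rw [← hzz] at hd hd'
    have hkn : k ≤ n := by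
      rw [← hd, ← Nat.lt_succ_iff, Nat.div_lt_iff_lt_mul hn]; exact hz
    have ediv : ∀ h₂ : State, h₂.reg 0 = n → h₂.reg 13 = z → (Tm.op .div zT nT).eval h₂ = k :=
      fun h₂ e1 e2 => by rw [← hd, ← e1, ← e2]; rfl
    have emod : ∀ h₂ : State, h₂.reg 0 = n → h₂.reg 13 = z → (Tm.op .mod zT nT).eval h₂ = v :=
      fun h₂ e1 e2 => by rw [← hd', ← e1, ← e2]; rfl
    have B1 := B.set (x := 30) (y := k) (by norm_num)
    have B2 := B1.set (x := 31) (y := v) (by norm_num)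
    have s13 : (h₁.set 30 k).reg 13 = z := by rw [State.set_reg, if_neg (by norm_num), h13]
    rw [Tm.eval_letT (fun y => by
        rw [ediv _ (B.set (by norm_num)).reg_n, ediv h₁ B.reg_n h13]
        rw [State.set_reg, if_neg (by norm_num), h13]), ediv h₁ B.reg_n h13,
      Tm.eval_letT (fun y => by
        rw [emod _ (B1.set (by norm_num)).reg_n, emod _ B1.reg_n s13]
        rw [State.set_reg, if_neg (by norm_num), s13]), emod _ B1.reg_n s13]
    have e7 : ((h₁.set 30 k).set 31 v).reg 7 = m := by
      rw [State.set_reg, if_neg (by norm_num), State.set_reg, if_neg (by norm_num),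
        F.reg _ (by norm_num), h7]
    have e30 : ((h₁.set 30 k).set 31 v).reg 30 = k := by
      rw [State.set_reg, if_neg (by norm_num), State.set_reg_self]
    have e31 : ((h₁.set 30 k).set 31 v).reg 31 = v := State.set_reg_self _ _ _
    have etbl : ∀ i, ((h₁.set 30 k).set 31 v).tbl (width n) 5 i = h₁.tbl (width n) 5 i :=
      fun _ => rfl
    generalize (h₁.set 30 k).set 31 v = h₂ at B2 e7 e30 e31 etbl
    have hX : (Tm.ex 24 nT (.and (repT 24) (.and (tagT 24) (hitsT 31 24)))).Holds h₂ ↔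
        ∃ t ∈ tagged n g r 2 σ, Hits g (inSet n σ) v t := by
      refine (B2.holds_ex_repT hr (q := fun t => σ (n + t) = 2 ∧ Hits g (inSet n σ) v t)
        fun t ht => ?_).trans ?_
      · have B3 := B2.set (x := 24) (y := t) (by norm_num)
        have htn := (mem_reps.1 ht).1
        have e24 : (h₂.set 24 t).reg 24 = t := State.set_reg_self _ _ _
        have e31' : (h₂.set 24 t).reg 31 = v := by rw [State.set_reg, if_neg (by norm_num), e31]
        rw [Tm.holds_and, B3.holds_tagT (by rwa [e24]), B3.holds_hitsT hg (by norm_num)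
          (by norm_num) (by rwa [e31']) (by rwa [e24]), e24, e31']
      · simp only [mem_tagged, and_assoc]
    have hS : (Tm.sum 32 nT <| .mul (.bool (.and (undT 32) (hitsT 31 32))) <|
        .sum 33 (.reg 30) <| .mul (.tb 5 (.add (.mul (.reg 33) nT) (.reg 32)))
          (.tb 5 (.add (.mul (.op .sub (.op .sub (.reg 30) (.const 1)) (.reg 33)) nT)
            (.reg 31)))).eval h₂ = ∑ w ∈ (undec n σ).filter (Hits g (inSet n σ) v),
          ∑ i ∈ Finset.range k, (nw i w % m) * (nw (k - 1 - i) v % m) := by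
      have hfil : (undec n σ).filter (Hits g (inSet n σ) v) =
          (Finset.range n).filter fun w => w ∈ undec n σ ∧ Hits g (inSet n σ) v w := by
        ext w
        rw [Finset.mem_filter, Finset.mem_filter, Finset.mem_range]
        exact (and_iff_right_of_imp fun h => (mem_undec.1 h.1).1).symm
      rw [Tm.eval_sum, B2.eval_nT, hfil, Finset.sum_filter]
      refine Finset.sum_congr rfl fun w hw => ?_
      have hwn := Finset.mem_range.1 hw
      have B3 := B2.set (x := 32) (y := w) (by norm_num)
      have e32 : (h₂.set 32 w).reg 32 = w := State.set_reg_self _ _ _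
      have e31' : (h₂.set 32 w).reg 31 = v := by rw [State.set_reg, if_neg (by norm_num), e31]
      have e30' : (h₂.set 32 w).reg 30 = k := by rw [State.set_reg, if_neg (by norm_num), e30]
      have hiff : (Tm.and (undT 32) (hitsT 31 32)).Holds (h₂.set 32 w) ↔
          w ∈ undec n σ ∧ Hits g (inSet n σ) v w := by
        rw [Tm.holds_and, B3.holds_undT, B3.holds_hitsT hg (by norm_num) (by norm_num)
          (by rwa [e31']) (by rwa [e32]), e31', e32]
      rw [Tm.eval_mul, Tm.eval_bool, Tm.eval_sum, Tm.eval_reg, e30']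
      simp only [hiff, ite_mul, one_mul, zero_mul]
      refine if_congr Iff.rfl (Finset.sum_congr rfl fun i hi => ?_) rfl
      have hik := Finset.mem_range.1 hi
      have B4 := B3.set (x := 33) (y := i) (by norm_num)
      have t5 : ∀ j, ((h₂.set 32 w).set 33 i).tbl (width n) 5 j = h₁.tbl (width n) 5 j := etbl
      have e33 : ((h₂.set 32 w).set 33 i).reg 33 = i := State.set_reg_self _ _ _
      have q30 : ((h₂.set 32 w).set 33 i).reg 30 = k := by
        rw [State.set_reg, if_neg (by norm_num), e30']
      have q31 : ((h₂.set 32 w).set 33 i).reg 31 = v := by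
        rw [State.set_reg, if_neg (by norm_num), e31']
      have q32 : ((h₂.set 32 w).set 33 i).reg 32 = w := by
        rw [State.set_reg, if_neg (by norm_num), e32]
      rw [Tm.eval_mul, eval_tb B4.reg_W, eval_tb B4.reg_W, Tm.eval_add, Tm.eval_add, Tm.eval_mul,
        Tm.eval_mul, Tm.eval_op, Tm.eval_op, B4.eval_nT]
      simp only [Tm.eval_reg, Tm.eval_const, Op.eval, e33, q30, q31, q32, t5]
      rw [F.tbl_eq (by rw [hzz]; exact idx2_lt hwn hik), hf _ _ hwn,
        F.tbl_eq (by rw [hzz]; exact idx2_lt hv (by omega)), hf _ _ hv]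
    rw [Tm.eval_op, Tm.eval_add, Tm.eval_mul, Tm.eval_bool, hS, Tm.eval_reg, e7, Op.eval, hzz,
      hf _ _ hv]
    simp only [Tm.holds_not, hX, Tm.eq, Tm.eval_op, Op.eval, Tm.eval_reg, Tm.eval_const, e30]
    -- Without steps the double sum is empty and only the avoidance indicator remains; for a
    -- positive number of steps the first summand is zero.
    cases k with
    | zero =>
      rw [hnw, numWalks]
      by_cases hx : ∃ t ∈ tagged n g r 2 σ, Hits g (inSet n σ) v t <;> simp [hx]
    | succ k =>
      rw [hnw, numWalks, ← hnw]
      simp only [Nat.add_eq_zero_iff, one_ne_zero, and_false, if_false, zero_mul, zero_add,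
        Nat.add_sub_cancel]
      -- The table holds residues; as the recursion uses only sums and products, it may be checked
      -- in `ZMod m`.
      refine (ZMod.natCast_eq_natCast_iff' _ _ m).1 ?_
      push_cast
      refine Finset.sum_congr rfl fun w _ => ?_
      rw [← Fin.sum_univ_eq_sum_range (fun i => ((nw i w % m : ℕ) : ZMod m) *
        ((nw (k - i) v % m : ℕ) : ZMod m))]
      simp only [ZMod.natCast_mod]
  · intro z _
    exact (Nat.mod_lt _ hm).le.trans hmN
  · obtain ⟨r1, F⟩ := hh
    refine ⟨h', r1.mono (by omega), f, F, fun k hk v hv => ?_⟩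
    rw [F.tbl_eq, hf k v hv]
    have : k * n ≤ n * n := Nat.mul_le_mul_right _ hk
    rw [add_mul, one_mul]; omega

theorem Env.eval_cardT (E : Env n g r (width n) σ h) : cardT.eval h = (inSet n σ).card := by
  classical
  rw [cardT, Tm.eval_cnt, E.eval_nT]
  congr 1
  ext v
  have E' := E.set (x := 20) (y := v) (by norm_num)
  have e20 : (h.set 20 v).reg 20 = v := State.set_reg_self _ _ _
  rw [Finset.mem_filter, Finset.mem_range,
    ← and_iff_right_of_imp (fun h : v ∈ inSet n σ => (mem_inSet.1 h).1)]
  refine and_congr_right fun hv => ?_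
  rw [E'.holds_inT (by rwa [e20]), e20]

theorem Env.eval_parityT (E : Env n g r (width n) σ h) (hr : r < n) :
    parityT.eval h = (tagged n g r 2 σ).card % 2 := by
  classical
  rw [parityT, Tm.eval_op, Tm.eval_cnt, E.eval_nT, Tm.eval_const, Op.eval]
  congr 2
  ext t
  have E' := E.set (x := 24) (y := t) (by norm_num)
  have e24 : (h.set 24 t).reg 24 = t := State.set_reg_self _ _ _
  rw [Finset.mem_filter, Finset.mem_range, mem_tagged, ← and_iff_right_of_imp
    (fun h : t ∈ reps n g (inSet n σ) r ∧ σ (n + t) = 2 => (mem_reps.1 h.1).1)]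
  refine and_congr_right fun ht => ?_
  rw [Tm.holds_and, E'.holds_repT hr (by norm_num) (by rwa [e24]), E'.holds_tagT (by rwa [e24]),
    e24]

open Classical in
/-- The contribution of a leaf of the search tree is added modulo `m`. -/
theorem Env.run_accC (E : Env n g r (width n) σ h) (hr : r < n) (h7 : h.reg 7 = m) (hm : 0 < m)
    (hmN : m ≤ N) (hN : width n ≤ N)
    (ht : ∀ k ≤ n, ∀ v < n, h.tbl (width n) 5 (k * n + v) =
        numWalks g (inSet n σ) (undec n σ) (tagged n g r 2 σ) k v % m) :
    ∃ h', HRun N accC h h' (3 * width n + 2) ∧ ∃ f, Fill (width n) 6 f (n + 1) h h' ∧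
      ∀ c ≤ n, ((h'.tbl (width n) 6 c : ℕ) : ZMod m) =
        (h.tbl (width n) 6 c : ZMod m) + (leafVal n g r σ c : ZMod m) := by
  have hW : n + 1 ≤ width n := by have := (width_bounds n).2.2.1; omega
  set b : ℕ → ℕ := fun c => numWalks g (inSet n σ) (undec n σ) (tagged n g r 2 σ)
    (c - (inSet n σ).card) r % m with hb
  -- The sign is implemented by replacing the residue `b c` by `m - b c`, as the machine only has
  -- natural numbers.
  set x : ℕ → ℕ := fun c => if ¬ Bad n g (inSet n σ) (undec n σ) r ∧ ¬ c < (inSet n σ).card then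
    (if (tagged n g r 2 σ).card % 2 = 0 then b c else m - b c) else 0 with hx
  have key := run_tab (N := N) (k := 6) (f := fun c => (h.tbl (width n) 6 c + x c) % m)
    (Z := n + 1) (h := h) (len := .add nT (.const 1)) (e := .op .mod (.add (.tb 6 zT) <|
    .mul (.bool (.and (.not badT) (.not (.lt zT cardT)))) <|
    .letT 30 (.tb 5 (.add (.mul (.op .sub zT cardT) nT) (.reg 1))) <|
      .add (.mul (.eq parityT (.const 0)) (.reg 30))
        (.mul (.eq parityT (.const 1)) (.op .sub (.reg 7) (.reg 30)))) (.reg 7))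
    E.reg_W (hW.trans hN)
  refine Exists.elim (key ?_ ?_ ?_) fun h' hh => ?_
  · intro h₁ hr
    rw [Tm.eval_add, nT, Tm.eval_reg, Tm.eval_const, hr 0 (by norm_num), E.reg_n]
  · intro z hz h₁ F h13
    have B := E.fill F (by norm_num) (by norm_num) (by norm_num) (hz.le.trans hW)
    have e7 : h₁.reg 7 = m := by rw [F.reg _ (by norm_num), h7]
    have htb : ∀ h₂ : State, Env n g r (width n) σ h₂ → h₂.reg 13 = z → h₂.mem = h₁.mem →
        (Tm.tb 5 (.add (.mul (.op .sub zT cardT) nT) (.reg 1))).eval h₂ = b z := by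
      intro h₂ E2 e13 hmem
      rw [eval_tb E2.reg_W, Tm.eval_add, Tm.eval_mul, Tm.eval_op, E2.eval_cardT, E2.eval_nT,
        Tm.eval_reg, E2.reg_r, zT, Tm.eval_reg, e13, Op.eval, State.tbl, hmem, ← State.tbl]
      have h1 := idx2_lt (n := n) (i := z - (inSet n σ).card) (k := n + 1) (v := 0) hr (by omega)
      rw [F.tbl_ne (hz.le.trans hW) (by norm_num)
        (h1.trans_le (by have := (width_bounds n).2.1; omega)), ht _ (by omega) _ hr]
    have B2 := B.set (x := 30) (y := b z) (by norm_num)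
    rw [Tm.eval_op, Tm.eval_add, eval_tb B.reg_W, Tm.eval_mul, Tm.eval_bool,
      Tm.eval_letT (fun y => by
        rw [htb _ (B.set (by norm_num)) (by rw [State.set_reg, if_neg (by norm_num), h13]) rfl,
          htb _ B h13 rfl]), htb _ B h13 rfl, Tm.eval_add, Tm.eval_mul, Tm.eval_mul, Tm.eval_op,
      Tm.eval_reg, Tm.eval_reg, Tm.eval_reg, e7, zT, Tm.eval_reg, h13, F.tbl_ge le_rfl,
      State.set_reg_self, State.set_reg _ 30 _ 7, if_neg (by norm_num : ¬ 7 = 30), e7]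
    simp only [Tm.holds_and, Tm.holds_not, B.holds_badT hr, Tm.holds_lt, B.eval_cardT, Tm.eval_reg,
      h13, Tm.eq, Tm.eval_op, B2.eval_parityT hr, Op.eval, Tm.eval_const, hx]
    rcases Nat.mod_two_eq_zero_or_one (tagged n g r 2 σ).card with hp | hp <;> simp [hp]
  · intro z _
    exact (Nat.mod_lt _ hm).le.trans hmN
  · obtain ⟨r1, F⟩ := hh
    refine ⟨h', r1.mono (by omega), _, F, fun c hc => ?_⟩
    rw [F.tbl_eq (by omega), ZMod.natCast_mod, Nat.cast_add]
    congr 1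
    simp only [hx, leafVal]
    by_cases hbad : Bad n g (inSet n σ) (undec n σ) r
    · simp [hbad]
    by_cases hcard : (inSet n σ).card ≤ c
    · have hbm : b c ≤ m := (Nat.mod_lt _ hm).le
      simp only [hbad, hcard, not_lt.2 hcard, not_false_eq_true, and_self, if_true, if_false]
      rcases Nat.even_or_odd (tagged n g r 2 σ).card with hp | hp
      · rw [if_pos (Nat.even_iff.1 hp), hp.neg_one_pow]
        simp [hb, ZMod.natCast_mod]
      · rw [if_neg (by have := Nat.odd_iff.1 hp; omega), hp.neg_one_pow, Nat.cast_sub hbm]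
        simp [hb, ZMod.natCast_mod]
    · simp [hbad, hcard, not_le.1 hcard]

end

end MaxLeaf

/-! ### The traversal of the search tree -/

namespace RAM

/-- The selected item. -/
def itemT : Tm := .op .mod (.reg 6) itemsT

/-- Treat a leaf of the search tree. -/
def leafC : Cmd := .seq walksC <| .seq accC <| .assign 4 (.const 1)

/-- Descend into the first subtree. -/
def pushC : Cmd := .seq (.store (.addr 3 (.reg 3)) itemT) <|
  .seq (.store (.addr 2 itemT) (.const 1)) <| .assign 3 (.add (.reg 3) (.const 1))

/-- Treat a node of the search tree at its first visit. -/
def visitC : Cmd := .seq reachC <| .seq (.assign 6 pickT) <|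
  .ite (.lt (.reg 6) (.mul (.const 12) nT)) pushC leafC

/-- Go on after the traversal of a subtree. -/
def backC : Cmd := .ite (.eq (.reg 3) (.const 0)) (.assign 5 (.const 0)) <|
  .seq (.assign 6 (.tb 3 (.op .sub (.reg 3) (.const 1)))) <|
  .ite (.eq (.tb 2 (.reg 6)) (.const 1))
    (.seq (.store (.addr 2 (.reg 6)) (.const 2)) (.assign 4 (.const 0)))
    (.seq (.store (.addr 2 (.reg 6)) (.const 0)) (.assign 3 (.op .sub (.reg 3) (.const 1))))

/-- A step of the traversal. -/
def stepC : Cmd := .ite (.eq (.reg 4) (.const 0)) visitC backC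

/-- The traversal of the search tree. -/
def searchC : Cmd := .while (.reg 5) stepC

end RAM

namespace MaxLeaf

open RAM

section

variable {n N m : ℕ} {g : ℕ → ℕ → Prop} {r : ℕ} {σ stk : ℕ → ℕ} {A : ℕ → ℤ} {h₀ h h' : State}
  {mode d : ℕ}

theorem Sel.lt_and_eq_zero {p i : ℕ} (H : Sel n g r σ p i) : i < 2 * n ∧ σ i = 0 := by
  rcases H with H | ⟨-, t, ht, rfl, h⟩
  · have : i ∈ undec n σ := by
      rcases branch_iff.1 H with h | h | h | h | h <;> exact h.2.1
    have := mem_undec.1 this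
    exact ⟨by omega, this.2⟩
  · have := (mem_reps.1 ht).1
    exact ⟨by omega, h⟩

/-- The number of undecided items. -/
def zeros (n : ℕ) (σ : ℕ → ℕ) : ℕ := ((Finset.range (2 * n)).filter fun i => σ i = 0).card

/-- Every level of the stack uses up an undecided item, so depth plus undecided items stays at most
`2 * n`. This keeps the stack inside its table. -/
theorem zeros_update {i k : ℕ} (hi : i < 2 * n) (h0 : σ i = 0) (hk : k ≠ 0) :
    zeros n (Function.update σ i k) + 1 = zeros n σ := by
  have : ((Finset.range (2 * n)).filter fun j => Function.update σ i k j = 0) =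
      ((Finset.range (2 * n)).filter fun j => σ j = 0).erase i := by
    ext j
    simp only [Finset.mem_filter, Finset.mem_erase, Function.update_apply]
    split_ifs with hj <;> simp [hj, hk]
  unfold zeros
  rw [this, Finset.card_erase_add_one]
  simp [hi, h0]

/-- What is left unchanged by the search. -/
structure Frame (n : ℕ) (h₀ h : State) : Prop where
  reg : ∀ x, x ∉ [3, 4, 5, 6, 13] → h.reg x = h₀.reg x
  tbl : ∀ k < 2, ∀ i < width n, h.tbl (width n) k i = h₀.tbl (width n) k i

theorem Frame.set (F : Frame n h₀ h) {x v : ℕ} (hx : x ∈ [3, 4, 5, 6, 13]) :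
    Frame n h₀ (h.set x v) where
  reg y hy := by rw [State.set_reg, if_neg (by rintro rfl; exact hy hx), F.reg y hy]
  tbl := F.tbl

theorem Frame.put (F : Frame n h₀ h) {k i v : ℕ} (hk : 2 ≤ k) (hi : i < width n) :
    Frame n h₀ (h.put (width n * k + i) v) where
  reg := F.reg
  tbl k' hk' j hj := by rw [tbl_put hi hj, if_neg (by omega), F.tbl k' hk' j hj]

theorem Frame.fill (F : Frame n h₀ h) {k z : ℕ} {f : ℕ → ℕ} (G : Fill (width n) k f z h h')
    (hk : 2 ≤ k) (hz : z ≤ width n) : Frame n h₀ h' where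
  reg y hy := by rw [G.reg y (by rintro rfl; simp at hy), F.reg y hy]
  tbl k' hk' j hj := by rw [G.tbl_ne hz (by omega) hj, F.tbl k' hk' j hj]

/-- The state of the traversal, with a stack of depth `d`. -/
structure DState (n : ℕ) (g : ℕ → ℕ → Prop) (r m : ℕ) (h₀ : State) (mode d : ℕ)
    (σ stk : ℕ → ℕ) (A : ℕ → ℤ) (h : State) : Prop where
  base : Base n g r σ h
  frame : Frame n h₀ h
  reg_d : h.reg 3 = d
  reg_mode : h.reg 4 = mode
  reg_run : h.reg 5 = 1
  stk : ∀ i < d, h.tbl (width n) 3 i = stk i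
  acc : ∀ c ≤ n, ((h.tbl (width n) 6 c : ℕ) : ZMod m) = A c

theorem Base.put (E : Base n g r σ h) {k i v : ℕ} (hk : k ≠ 0) (hk' : k ≠ 2) (hi : i < width n) :
    Base n g r σ (h.put (width n * k + i) v) where
  reg_n := E.reg_n
  reg_r := E.reg_r
  reg_W := E.reg_W
  adj := fun a ha b hb => by
    rw [tbl_put hi ((idx_lt ha hb).trans (width_bounds n).2.2.2), if_neg fun h => hk h.1.symm]
    exact E.adj a ha b hb
  st := fun a ha => by
    rw [tbl_put hi (ha.trans (width_bounds n).2.2.1), if_neg fun h => hk' h.1.symm]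
    exact E.st a ha

theorem Base.put_st (E : Base n g r σ h) {i v : ℕ} (hi : i < 2 * n) :
    Base n g r (Function.update σ i v) (h.put (width n * 2 + i) v) where
  reg_n := E.reg_n
  reg_r := E.reg_r
  reg_W := E.reg_W
  adj := fun a ha b hb => by
    rw [tbl_put (hi.trans (width_bounds n).2.2.1) ((idx_lt ha hb).trans (width_bounds n).2.2.2),
      if_neg (by norm_num)]
    exact E.adj a ha b hb
  st := fun a ha => by
    rw [tbl_put (hi.trans (width_bounds n).2.2.1) (ha.trans (width_bounds n).2.2.1),
      Function.update_apply, E.st a ha]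
    simp

theorem DState.set (D : DState n g r m h₀ mode d σ stk A h) {x v : ℕ} (hx : x ∈ [6, 13]) :
    DState n g r m h₀ mode d σ stk A (h.set x v) := by
  have hx' : x = 6 ∨ x = 13 := by simpa using hx
  have h3 : ∀ y ∈ [3, 4, 5], (h.set x v).reg y = h.reg y := fun y hy => by
    rw [State.set_reg, if_neg]; rintro rfl; rcases hx' with rfl | rfl <;> simp at hy
  exact ⟨D.base.set (by omega), D.frame.set (by simp at hx ⊢; tauto),
    (h3 _ (by simp)).trans D.reg_d, (h3 _ (by simp)).trans D.reg_mode,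
    (h3 _ (by simp)).trans D.reg_run, D.stk, D.acc⟩

theorem DState.set_mode (D : DState n g r m h₀ mode d σ stk A h) {v : ℕ} :
    DState n g r m h₀ v d σ stk A (h.set 4 v) :=
  ⟨D.base.set (by norm_num), D.frame.set (by simp), D.reg_d, State.set_reg_self _ _ _, D.reg_run,
    D.stk, D.acc⟩

theorem DState.set_depth (D : DState n g r m h₀ mode d σ stk A h) {v : ℕ} (hv : v ≤ d) :
    DState n g r m h₀ mode v σ stk A (h.set 3 v) :=
  ⟨D.base.set (by norm_num), D.frame.set (by simp), State.set_reg_self _ _ _, D.reg_mode,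
    D.reg_run, fun i hi => D.stk i (hi.trans_le hv), D.acc⟩

theorem DState.put_st (D : DState n g r m h₀ mode d σ stk A h) (hd : d ≤ 2 * n) {i v : ℕ}
    (hi : i < 2 * n) :
    DState n g r m h₀ mode d (Function.update σ i v) stk A (h.put (width n * 2 + i) v) := by
  have h1 := (width_bounds n).2.2.1
  refine ⟨D.base.put_st hi, D.frame.put le_rfl (hi.trans h1), D.reg_d, D.reg_mode, D.reg_run, ?_,
    ?_⟩
  · intro j hj
    rw [tbl_put (hi.trans h1) (by omega), if_neg (by norm_num), D.stk j hj]
  · intro c hc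
    rw [tbl_put (hi.trans h1) (by omega), if_neg (by norm_num), D.acc c hc]

theorem DState.push (D : DState n g r m h₀ mode d σ stk A h) (hd : d < 2 * n) {i : ℕ} :
    DState n g r m h₀ mode (d + 1) σ (Function.update stk d i) A
      ((h.put (width n * 3 + d) i).set 3 (d + 1)) := by
  have h1 := (width_bounds n).2.2.1
  refine ⟨(D.base.put (by norm_num) (by norm_num) (by omega)).set (by norm_num),
    (D.frame.put (by norm_num) (by omega)).set (by simp), State.set_reg_self _ _ _, D.reg_mode,
    D.reg_run, ?_, ?_⟩
  · intro j hj
    change (h.put (width n * 3 + d) i).tbl (width n) 3 j = _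
    rw [tbl_put (by omega) (by omega), Function.update_apply]
    by_cases hjd : j = d
    · simp [hjd]
    · rw [if_neg (fun h => hjd h.2), if_neg hjd, D.stk j (by omega)]
  · intro c hc
    change ((((h.put (width n * 3 + d) i).tbl (width n) 6 c : ℕ)) : ZMod m) = _
    rw [tbl_put (by omega) (by omega), if_neg (by norm_num), D.acc c hc]

theorem DState.fill (D : DState n g r m h₀ mode d σ stk A h) (hd : d ≤ 2 * n) {k z : ℕ}
    {f : ℕ → ℕ} (G : Fill (width n) k f z h h') (hk : k = 4 ∨ k = 5) (hz : z ≤ width n) :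
    DState n g r m h₀ mode d σ stk A h' := by
  have h1 := (width_bounds n).2.2.1
  refine ⟨D.base.fill G (by omega) (by omega) hz, D.frame.fill G (by omega) hz,
    (G.reg _ (by norm_num)).trans D.reg_d, (G.reg _ (by norm_num)).trans D.reg_mode,
    (G.reg _ (by norm_num)).trans D.reg_run, ?_, ?_⟩
  · intro j hj
    rw [G.tbl_ne hz (by omega) (by omega), D.stk j hj]
  · intro c hc
    rw [G.tbl_ne hz (by omega) (by omega), D.acc c hc]

/-- `s` steps of the traversal lead from `h` to `h'`. -/
def Steps (n N s : ℕ) (h h' : State) : Prop :=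
  ∀ h'' T, HRun N searchC h' h'' T → HRun N searchC h h'' (T + s * (30 * width n))

/-- Executions are only defined when they halt, so a part of the loop is described by what may
follow it, and composition is substitution of continuations. -/
theorem Steps.trans {h'' : State} {s s' : ℕ} (H : Steps n N s h h') (H' : Steps n N s' h' h'') :
    Steps n N (s + s') h h'' := fun h₃ T R => by
  have := H _ _ (H' _ _ R)
  rwa [add_assoc, ← add_mul, add_comm s'] at this

theorem Steps.of_run (h5 : h.reg 5 = 1) (H : HRun N stepC h h' (30 * width n - 1)) :
    Steps n N 1 h h' := fun h₃ T R => by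
  have hw : 0 < width n := by unfold width; positivity
  refine (HRun.while_true (by simp [Tm.Holds, Tm.eval, h5]) H R).mono (by omega)

theorem width_pos (n : ℕ) : 0 < width n := by unfold width; positivity

theorem eval_itemsT (B : Base n g r σ h) : itemsT.eval h = 2 * n := by
  rw [itemsT, Tm.eval_mul, B.eval_nT, Tm.eval_const]

theorem eval_itemT (B : Base n g r σ h) : itemT.eval h = h.reg 6 % (2 * n) := by
  rw [itemT, Tm.eval_op, eval_itemsT B, Tm.eval_reg, Op.eval]

/-- The first visit of a node. -/
theorem DState.visit (D : DState n g r m h₀ 0 d σ stk A h) (hg : ∀ a b, g a b → a < n ∧ b < n)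
    (hr : r < n) (hd : d ≤ 2 * n) (hN : 30 * width n ≤ N) :
    ∃ h₁, DState n g r m h₀ 0 d σ stk A h₁ ∧ Env n g r (width n) σ h₁ ∧
      h₁.reg 6 = pickKey n g r σ ∧ ∀ h' T,
      HRun N (.ite (.lt (.reg 6) (.mul (.const 12) nT)) pushC leafC) h₁ h' T →
      HRun N stepC h h' (3 * width n + 4 + T) := by
  obtain ⟨h₁, R, E, ⟨f, F⟩, -⟩ := D.base.run_reachC hg (by omega : width n ≤ N)
  have D₁ := D.fill hd F (.inl rfl) (width_bounds n).1
  have hk : pickKey n g r σ ≤ N := (least_le _ _).trans (by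
    have := (width_bounds n).2.2.1; omega)
  refine ⟨_, D₁.set (x := 6) (v := pickKey n g r σ) (by simp), E.set (by norm_num),
    State.set_reg_self _ _ _, fun h' T H => ?_⟩
  refine (HRun.ite_true ?_ (R.seq ((HRun.assign (E.eval_pickT hr) hk).seq H))).mono (by omega)
  rw [Tm.holds_eq, Tm.eval_reg, D.reg_mode, Tm.eval_const]

theorem DState.steps_push (D : DState n g r m h₀ 0 d σ stk A h)
    (hg : ∀ a b, g a b → a < n ∧ b < n) (hr : r < n) (hd : d < 2 * n) (hN : 30 * width n ≤ N)
    (hk : pickKey n g r σ < 12 * n) : ∃ h', Steps n N 1 h h' ∧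
      DState n g r m h₀ 0 (d + 1) (Function.update σ (pickKey n g r σ % (2 * n)) 1)
        (Function.update stk d (pickKey n g r σ % (2 * n))) A h' := by
  have hw := (width_bounds n).2.2.1
  obtain ⟨h₁, D₁, E, h6, H⟩ := D.visit hg hr hd.le hN
  set i := pickKey n g r σ % (2 * n) with hi
  have hin : i < 2 * n := Nat.mod_lt _ (by omega)
  have D₂ : DState n g r m h₀ 0 (d + 1) σ (Function.update stk d i) A _ := D₁.push hd (i := i)
  have D₃ := D₂.put_st (v := 1) (by omega) hin
  refine ⟨_, .of_run D.reg_run ((H _ 5 ?_).mono (by omega)), D₃⟩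
  refine (HRun.ite_true (by
    rw [Tm.holds_lt, Tm.eval_reg, h6, Tm.eval_mul, E.eval_nT, Tm.eval_const]; exact hk)
    (HRun.seq (T := 1) (T' := 2) (h' := h₁.put (width n * 3 + d) i) ?_
      (HRun.seq (T := 1) (T' := 1)
        (h' := (h₁.put (width n * 3 + d) i).put (width n * 2 + i) 1) ?_ ?_))).mono (by omega)
  · refine HRun.store ?_ ?_ (by omega)
    · rw [eval_addr D₁.base.reg_W, Tm.eval_reg, D₁.reg_d]
    · rw [eval_itemT D₁.base, h6]
  · have B := D₁.base.put (k := 3) (i := d) (v := i) (by norm_num) (by norm_num) (by omega)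
    refine HRun.store ?_ rfl (by omega)
    rw [eval_addr B.reg_W, eval_itemT B, State.put_reg, h6]
  · refine HRun.assign ?_ (by omega)
    rw [Tm.eval_add, Tm.eval_reg, State.put_reg, State.put_reg, D₁.reg_d, Tm.eval_const]

theorem DState.steps_leaf (D : DState n g r m h₀ 0 d σ stk A h)
    (hg : ∀ a b, g a b → a < n ∧ b < n) (hr : r < n) (hd : d ≤ 2 * n) (hN : 30 * width n ≤ N)
    (h7 : h₀.reg 7 = m) (hm : 0 < m) (hmN : m ≤ N) (hk : pickKey n g r σ = 12 * n) :
    ∃ h', Steps n N 1 h h' ∧ DState n g r m h₀ 1 d σ stk (A + leafVal n g r σ) h' := by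
  have hw := (width_bounds n).2.2.1
  have hw0 := width_pos n
  obtain ⟨h₁, D₁, E, h6, H⟩ := D.visit hg hr hd hN
  have h7₁ : h₁.reg 7 = m := (D₁.frame.reg _ (by simp)).trans h7
  obtain ⟨h₂, R₂, f, F, ht⟩ := E.run_walksC hg hr h7₁ hm hmN (by omega)
  have hz := (width_bounds n).2.1
  have D₂ := D₁.fill hd F (.inr rfl) hz
  have E₂ := E.fill F (by norm_num) (by norm_num) (by norm_num) hz
  obtain ⟨h₃, R₃, f', F', hacc⟩ := E₂.run_accC hr ((F.reg _ (by norm_num)).trans h7₁) hm hmN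
    (by omega) ht
  have hz' : n + 1 ≤ width n := by omega
  have D₃ : DState n g r m h₀ 0 d σ stk (A + leafVal n g r σ) h₃ := by
    refine ⟨D₂.base.fill F' (by norm_num) (by norm_num) hz', D₂.frame.fill F' (by norm_num) hz',
      (F'.reg _ (by norm_num)).trans D₂.reg_d, (F'.reg _ (by norm_num)).trans D₂.reg_mode,
      (F'.reg _ (by norm_num)).trans D₂.reg_run, ?_, ?_⟩
    · intro j hj
      rw [F'.tbl_ne hz' (by norm_num) (by omega), D₂.stk j hj]
    · intro c hc
      rw [hacc c hc, D₂.acc c hc, Pi.add_apply, Int.cast_add]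
  refine ⟨_, .of_run D.reg_run ((H _ (6 * width n + 6) ?_).mono (by omega)), D₃.set_mode⟩
  refine (HRun.ite_false (by
    rw [Tm.holds_lt, Tm.eval_reg, h6, Tm.eval_mul, E.eval_nT, Tm.eval_const, hk]
    exact lt_irrefl _) (R₂.seq (R₃.seq (HRun.assign rfl ?_)))).mono (by omega)
  rw [Tm.eval_const]; omega

/-- The second visit of a node. -/
theorem DState.steps_next (D : DState n g r m h₀ 1 (d + 1) σ stk A h) (hd : d < 2 * n)
    (hN : 30 * width n ≤ N) {i : ℕ} (hi : i < 2 * n) (hs : stk d = i) (h1 : σ i = 1) :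
    ∃ h', Steps n N 1 h h' ∧ DState n g r m h₀ 0 (d + 1) (Function.update σ i 2) stk A h' := by
  have hw := (width_bounds n).2.2.1
  have D₁ := D.set (x := 6) (v := i) (by simp)
  have D₂ := (D₁.put_st (by omega) (v := 2) hi).set_mode (v := 0)
  have e6 : (h.set 6 i).reg 6 = i := State.set_reg_self _ _ _
  refine ⟨_, .of_run D.reg_run (HRun.mono (T := 6) ?_ (by omega)), D₂⟩
  refine (HRun.ite_false (by
    rw [Tm.holds_eq, Tm.eval_reg, D.reg_mode, Tm.eval_const]; norm_num)
    (HRun.ite_false (by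
      rw [Tm.holds_eq, Tm.eval_reg, D.reg_d, Tm.eval_const]; omega)
    (HRun.seq (T := 1) (T' := 3) (h' := h.set 6 i) ?_
      (HRun.ite_true (T := 2) ?_
        (HRun.seq (T := 1) (T' := 1) (h' := (h.set 6 i).put (width n * 2 + i) 2) ?_ ?_))))).mono
          (by omega)
  · refine HRun.assign ?_ (by omega)
    rw [eval_tb D.base.reg_W, Tm.eval_op, Tm.eval_reg, D.reg_d, Tm.eval_const, Op.eval,
      Nat.add_sub_cancel, D.stk d (by omega), hs]
  · rw [Tm.holds_eq, eval_tb D₁.base.reg_W, Tm.eval_reg, e6, D₁.base.st i hi, h1, Tm.eval_const]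
  · refine HRun.store ?_ rfl (by omega)
    rw [eval_addr D₁.base.reg_W, Tm.eval_reg, e6]
  · exact HRun.assign rfl (Nat.zero_le _)

/-- The last visit of a node. -/
theorem DState.steps_pop (D : DState n g r m h₀ 1 (d + 1) σ stk A h) (hd : d < 2 * n)
    (hN : 30 * width n ≤ N) {i : ℕ} (hi : i < 2 * n) (hs : stk d = i) (h1 : σ i ≠ 1) :
    ∃ h', Steps n N 1 h h' ∧ DState n g r m h₀ 1 d (Function.update σ i 0) stk A h' := by
  have hw := (width_bounds n).2.2.1
  have D₁ := D.set (x := 6) (v := i) (by simp)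
  have D₂ := (D₁.put_st (by omega) (v := 0) hi).set_depth (v := d) (by omega)
  have e6 : (h.set 6 i).reg 6 = i := State.set_reg_self _ _ _
  refine ⟨_, .of_run D.reg_run (HRun.mono (T := 6) ?_ (by omega)), D₂⟩
  refine (HRun.ite_false (by
    rw [Tm.holds_eq, Tm.eval_reg, D.reg_mode, Tm.eval_const]; norm_num)
    (HRun.ite_false (by
      rw [Tm.holds_eq, Tm.eval_reg, D.reg_d, Tm.eval_const]; omega)
    (HRun.seq (T := 1) (T' := 3) (h' := h.set 6 i) ?_
      (HRun.ite_false (T := 2) ?_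
        (HRun.seq (T := 1) (T' := 1) (h' := (h.set 6 i).put (width n * 2 + i) 0) ?_ ?_))))).mono
          (by omega)
  · refine HRun.assign ?_ (by omega)
    rw [eval_tb D.base.reg_W, Tm.eval_op, Tm.eval_reg, D.reg_d, Tm.eval_const, Op.eval,
      Nat.add_sub_cancel, D.stk d (by omega), hs]
  · rw [Tm.holds_eq, eval_tb D₁.base.reg_W, Tm.eval_reg, e6, D₁.base.st i hi, Tm.eval_const]
    exact h1
  · refine HRun.store ?_ rfl (by omega)
    rw [eval_addr D₁.base.reg_W, Tm.eval_reg, e6]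
  · refine HRun.assign ?_ (by omega)
    rw [Tm.eval_op, Tm.eval_reg, State.put_reg, D₁.reg_d, Tm.eval_const, Op.eval,
      Nat.add_sub_cancel]

theorem DState.congr {stk' : ℕ → ℕ} (D : DState n g r m h₀ mode d σ stk A h)
    (hs : ∀ i < d, stk i = stk' i) : DState n g r m h₀ mode d σ stk' A h :=
  { D with stk := fun i hi => (D.stk i hi).trans (hs i hi) }

/-- The traversal of a subtree. -/
theorem Tree.steps {a : ℕ → ℤ} {s : ℕ} (T : Tree n g r σ a s)
    (hg : ∀ a b, g a b → a < n ∧ b < n) (hr : r < n) (hN : 30 * width n ≤ N)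
    (h7 : h₀.reg 7 = m) (hm : 0 < m) (hmN : m ≤ N) : ∀ {d stk A h},
    DState n g r m h₀ 0 d σ stk A h → d + zeros n σ ≤ 2 * n →
    ∃ h', Steps n N s h h' ∧ DState n g r m h₀ 1 d σ stk (A + a) h' := by
  induction T with
  | leaf σ h =>
    intro d stk A h₁ D hd
    exact D.steps_leaf hg hr (by omega) hN h7 hm hmN h
  | node σ a b k l h _ _ ih₁ ih₂ =>
    intro d stk A h₁ D hd
    obtain ⟨hi, h0⟩ := (pickKey_spec h).2.lt_and_eq_zero
    have z1 := zeros_update hi h0 (k := 1) (by norm_num)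
    have z2 := zeros_update hi h0 (k := 2) (by norm_num)
    obtain ⟨h₂, S₂, D₂⟩ := D.steps_push hg hr (by omega) hN h
    set i := pickKey n g r σ % (2 * n) with hi'
    obtain ⟨h₃, S₃, D₃⟩ := ih₁ D₂ (by omega)
    obtain ⟨h₄, S₄, D₄⟩ := D₃.steps_next (by omega) hN hi (Function.update_self _ _ _)
      (Function.update_self _ _ _)
    rw [Function.update_idem] at D₄
    obtain ⟨h₅, S₅, D₅⟩ := ih₂ D₄ (by omega)
    obtain ⟨h₆, S₆, D₆⟩ := D₅.steps_pop (by omega) hN hi (Function.update_self _ _ _)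
      (by rw [Function.update_self]; norm_num)
    -- The selected item was undecided before the descent, so resetting its status to `0` restores
    -- the original state.
    rw [Function.update_idem, ← h0, Function.update_eq_self, add_assoc] at D₆
    refine ⟨h₆, ?_, D₆.congr fun j hj => Function.update_of_ne hj.ne _ _⟩
    have := S₂.trans (S₃.trans (S₄.trans (S₅.trans S₆)))
    rwa [show 1 + (k + (1 + (l + 1))) = k + l + 3 by ring] at this

/-- The traversal of the search tree. -/
theorem Tree.run_searchC {a : ℕ → ℤ} {s : ℕ} (T : Tree n g r σ a s)
    (hg : ∀ a b, g a b → a < n ∧ b < n) (hr : r < n) (hN : 30 * width n ≤ N)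
    (h7 : h₀.reg 7 = m) (hm : 0 < m) (hmN : m ≤ N) (D : DState n g r m h₀ 0 0 σ stk 0 h) :
    ∃ h', HRun N searchC h h' ((s + 1) * (30 * width n)) ∧ Frame n h₀ h' ∧
      ∀ c ≤ n, ((h'.tbl (width n) 6 c : ℕ) : ZMod m) = a c := by
  have hw := width_pos n
  have hz : zeros n σ ≤ 2 * n := (Finset.card_filter_le _ _).trans_eq (Finset.card_range _)
  obtain ⟨h', S, D'⟩ := T.steps hg hr hN h7 hm hmN D (by omega)
  rw [zero_add] at D'
  refine ⟨h'.set 5 0, (S _ 5 ?_).mono ?_, D'.frame.set (by simp), D'.acc⟩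
  · refine (HRun.while_true (T := 3) (T' := 1) ?_ ?_ (HRun.while_false ?_)).mono (by omega)
    · simp [Tm.Holds, Tm.eval, D'.reg_run]
    · refine (HRun.ite_false ?_ (HRun.ite_true ?_ (HRun.assign rfl ?_))).mono le_rfl
      · rw [Tm.holds_eq, Tm.eval_reg, D'.reg_mode, Tm.eval_const]; norm_num
      · rw [Tm.holds_eq, Tm.eval_reg, D'.reg_d, Tm.eval_const]
      · exact Nat.zero_le _
    · simp [Tm.Holds, Tm.eval]
  · rw [add_mul]; omega

end

end MaxLeaf

/-! ### The minimum size of a feasible set -/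

namespace RAM

/-- The initial status of the item in the register `13`. -/
def initT : Tm := .add (.eq zT (.reg 1)) <|
  .mul (.const 2) (.bool (.and (.not (.eq zT (.reg 1))) (.and (.lt zT nT) (.tb 1 zT))))

/-- Initialize the traversal. -/
def initC : Cmd := .seq (tabC 6 (.add nT (.const 1)) (.const 0)) <|
  .seq (tabC 2 itemsT initT) <| .seq (.assign 3 (.const 0)) <| .seq (.assign 4 (.const 0)) <|
    .assign 5 (.const 1)

/-- Traverse the search tree with the modulus in the register `7`, and lower the register `8` to
the least size with a nonzero count. -/
def roundC : Cmd := .seq initC <| .seq searchC <|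
  .assign 8 (.leastT 28 29 (.reg 8) (.op .mod (.tb 6 (.reg 28)) (.reg 7)))

/-- The number of moduli. -/
def moduliT : Tm := .mul (.const 2) (.mul (.add nT (.const 2)) (.add nT (.const 2)))

/-- Compute the minimum size of a feasible set into the register `8`. -/
def solveC : Cmd := .seq (.assign 8 (.add nT (.const 1))) <| .seq (.assign 7 (.const 1)) <|
  .while (.not (.lt moduliT (.reg 7))) (.seq roundC (.assign 7 (.add (.reg 7) (.const 1))))

end RAM

namespace MaxLeaf

open RAM

/-- The minimum size of a feasible set which avoids the vertices in `X`, except possibly for the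
root, or `n + 1` if there is none. -/
noncomputable def opt (n : ℕ) (g : ℕ → ℕ → Prop) (r : ℕ) (X : ℕ → Prop) : ℕ :=
  least (n + 1) fun c => ∃ S, S ⊆ Finset.range n ∧ Feasible n g r S ∧ (∀ x ∈ S, X x → x = r) ∧
    S.card ≤ c

open Classical in
/-- The initial statuses of the items. -/
noncomputable def start (n r : ℕ) (X : ℕ → Prop) (i : ℕ) : ℕ :=
  if i = r then 1 else if i < n ∧ X i then 2 else 0

/-- A bound for the number of steps in a traversal. -/
noncomputable def stepBound (n : ℕ) : ℕ := ⌊1 + 5 * ((n : ℝ) + 1) * 1.9043 ^ n⌋₊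

section

variable {n N m : ℕ} {g : ℕ → ℕ → Prop} {r : ℕ} {σ stk : ℕ → ℕ} {X : ℕ → Prop} {h₀ h h' : State}

/-- Lowering a minimum round by round gives the minimum for the disjunction; this is how the moduli
are combined. -/
theorem least_least (b : ℕ) (p q : ℕ → Prop) :
    least (least b p) q = least b fun c => p c ∨ q c := by
  refine le_antisymm ?_ ?_
  · rcases (least_le b fun c => p c ∨ q c).lt_or_eq with h | h
    · rcases least_spec h with h1 | h1
      · exact (least_le _ _).trans (least_le_of h1)
      · exact least_le_of h1
    · exact ((least_le _ _).trans (least_le _ _)).trans h.ge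
  · rcases (least_le (least b p) q).lt_or_eq with h | h
    · exact least_le_of (.inr (least_spec h))
    · rw [h]
      rcases (least_le b p).lt_or_eq with h1 | h1
      · exact least_le_of (.inl (least_spec h1))
      · rw [h1]; exact least_le _ _

/-! ### The initial state and the optimum -/

theorem inSet_start (hr : r < n) : inSet n (start n r X) = {r} := by
  ext x
  rw [mem_inSet, start, Finset.mem_singleton]
  split_ifs with h1 h2
  · simp [h1, hr]
  · simp [h1]
  · simp [h1]

theorem mem_undec_start {x : ℕ} : x ∈ undec n (start n r X) ↔ x < n ∧ x ≠ r ∧ ¬ X x := by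
  rw [mem_undec, start]
  refine and_congr_right fun hx => ?_
  split_ifs with h1 h2
  · simp [h1]
  · simp [h2.2]
  · simp only [true_iff]; exact ⟨h1, fun h => h2 ⟨hx, h⟩⟩

/-- The search tree for the minimum size of a feasible set. -/
theorem exists_tree_start (hg : ∀ a b, g a b → a < n ∧ b < n) (hr : r < n) (X : ℕ → Prop) :
    ∃ a s, Tree n g r (start n r X) a s ∧ s ≤ stepBound n ∧
      (least (n + 1) fun c => ∃ m, 0 < m ∧ m ≤ 2 * ((n + 2) * (n + 2)) ∧ (a c : ZMod m) ≠ 0) =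
        opt n g r X := by
  obtain ⟨a, s, T, hs, h0, ha, h1, h2⟩ := exists_tree hg hr _ (start n r X) (by simp [start])
    (fun t ht => by rw [start, if_neg (by omega), if_neg (by omega)]) rfl
  have hu : (undec n (start n r X)).card ≤ n :=
    (Finset.card_filter_le _ _).trans_eq (Finset.card_range n)
  refine ⟨a, s, T, Nat.le_floor (hs.trans ?_), ?_⟩
  · have hq : (reps n g (inSet n (start n r X)) r).card ≤ n := by
      classical
      exact (Finset.card_filter_le _ _).trans_eq (Finset.card_range n)
    have hw : weight n g r (inSet n (start n r X)) (undec n (start n r X)) ≤ 1.9043 ^ n := by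
      refine weight_le.trans ?_
      -- There are at most `n` undecided vertices, each contributing `3`, and at most `n`
      -- components; the basis `1.9043` is a bound for `1.1747 ^ 4`.
      calc _ ≤ (1.1747 : ℝ) ^ (4 * n) := pow_le_pow_right₀ (by norm_num) (by omega)
        _ = (1.1747 ^ 4) ^ n := pow_mul _ _ _
        _ ≤ _ := pow_le_pow_left₀ (by norm_num) (by norm_num) _
    have hu' : ((undec n (start n r X)).card : ℝ) ≤ n := by exact_mod_cast hu
    have := weight_nonneg (n := n) (g := g) (r := r) (I := inSet n (start n r X))
      (U := undec n (start n r X))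
    gcongr
  · have hdvd : ∀ c < n + 1,
        ((∃ m, 0 < m ∧ m ≤ 2 * ((n + 2) * (n + 2)) ∧ (a c : ZMod m) ≠ 0) ↔ a c ≠ 0) := by
      intro c hc
      constructor
      · rintro ⟨m, -, -, h⟩ h'
        simp [h'] at h
      · intro hne
        obtain ⟨x, hx⟩ := Int.eq_ofNat_of_zero_le (h0 c)
        have hxle : x ≤ 2 ^ n * (n * n) ^ n := by
          have := ha c (by omega)
          rw [hx] at this
          calc x ≤ 2 ^ (undec n (start n r X)).card * (n * n) ^ n := by exact_mod_cast this
            _ ≤ _ := Nat.mul_le_mul_right _ (Nat.pow_le_pow_right (by norm_num) hu)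
        have hx0 : 0 < x := by
          refine Nat.pos_of_ne_zero fun h => hne (by rw [hx, h]; rfl)
        -- The modulus depends on `c`, so the algorithm has to try all of them.
        obtain ⟨m, hm, hm2, hmx⟩ := exists_not_dvd hx0 (B := (n + 2) ^ 2) (by positivity)
          ((Nat.mul_le_mul_left _ hxle).trans_lt (mul_lt_four_pow n))
        refine ⟨m, hm, by rwa [← sq], fun h => hmx ?_⟩
        rw [hx] at h
        exact (ZMod.natCast_eq_zero_iff x m).1 (by exact_mod_cast h)
    have hsub : ∀ S, (inSet n (start n r X) ⊆ S ∧
        S ⊆ inSet n (start n r X) ∪ undec n (start n r X)) ∧ Feasible n g r S ↔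
        S ⊆ Finset.range n ∧ Feasible n g r S ∧ ∀ x ∈ S, X x → x = r := by
      intro S
      rw [inSet_start hr]
      constructor
      · rintro ⟨⟨-, h2⟩, h3⟩
        refine ⟨fun x hx => ?_, h3, fun x hx hX => ?_⟩
        · have := h2 hx
          rw [Finset.mem_union, Finset.mem_singleton, mem_undec_start] at this
          rw [Finset.mem_range]; rcases this with rfl | h <;> [exact hr; exact h.1]
        · have := h2 hx
          rw [Finset.mem_union, Finset.mem_singleton, mem_undec_start] at this
          rcases this with rfl | h <;> [rfl; exact absurd hX h.2.2]
      · rintro ⟨h1, h2, h3⟩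
        refine ⟨⟨Finset.singleton_subset_iff.2 h2.1, fun x hx => ?_⟩, h2⟩
        rw [Finset.mem_union, Finset.mem_singleton, mem_undec_start]
        by_cases hxr : x = r
        · exact .inl hxr
        · exact .inr ⟨Finset.mem_range.1 (h1 hx), hxr, fun h => hxr (h3 x hx h)⟩
    rw [least_congr hdvd]
    -- A nonzero count for `c` only gives a feasible set with at most `c` elements, since walks may
    -- repeat vertices. The least such `c` is nevertheless the optimum, as every feasible set has a
    -- nonzero count for its exact size.
    refine le_antisymm ?_ ?_
    · rcases (show opt n g r X ≤ n + 1 from least_le _ _).lt_or_eq with h | h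
      · obtain ⟨S, hS, hF, hX, hc⟩ := least_spec h
        obtain ⟨⟨h3, h4⟩, h5⟩ := (hsub S).2 ⟨hS, hF, hX⟩
        exact (least_le_of (h2 S h3 h4 h5).ne').trans hc
      · exact (least_le _ _).trans h.ge
    · rcases (least_le (n + 1) fun c => a c ≠ 0).lt_or_eq with h | h
      · obtain ⟨S, h3, h4, h5, hc⟩ := h1 _ (least_spec h)
        obtain ⟨h6, h7, h8⟩ := (hsub S).1 ⟨⟨h3, h4⟩, h5⟩
        exact least_le_of ⟨S, h6, h7, h8, hc⟩
      · exact (least_le _ _).trans h.ge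

/-- What is left unchanged by the computation of the minimum size. -/
structure SolveFrame (n : ℕ) (h₀ h : State) : Prop where
  reg : ∀ x, x ∉ [3, 4, 5, 6, 7, 8, 13] → h.reg x = h₀.reg x
  tbl : ∀ k < 2, ∀ i < width n, h.tbl (width n) k i = h₀.tbl (width n) k i

theorem SolveFrame.trans {h'' : State} (F : SolveFrame n h h') (F' : SolveFrame n h' h'') :
    SolveFrame n h h'' :=
  ⟨fun x hx => (F'.reg x hx).trans (F.reg x hx),
    fun k hk i hi => (F'.tbl k hk i hi).trans (F.tbl k hk i hi)⟩

theorem Frame.solveFrame (F : Frame n h h') : SolveFrame n h h' :=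
  ⟨fun x hx => F.reg x (by simp at hx ⊢; tauto), F.tbl⟩

theorem SolveFrame.set {x v : ℕ} (hx : x ∈ [3, 4, 5, 6, 7, 8, 13]) :
    SolveFrame n h (h.set x v) :=
  ⟨fun y hy => by rw [State.set_reg, if_neg (by rintro rfl; exact hy hx)], fun _ _ _ _ => rfl⟩

/-- The state contains the digraph and the root. -/
structure Pre (n : ℕ) (g : ℕ → ℕ → Prop) (r : ℕ) (X : ℕ → Prop) (h : State) : Prop where
  reg_n : h.reg 0 = n
  reg_r : h.reg 1 = r
  reg_W : h.reg 2 = width n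
  adj : ∀ i < n, ∀ j < n, (h.tbl (width n) 0 (i * n + j) ≠ 0 ↔ g i j)
  excl : ∀ i < n, (h.tbl (width n) 1 i ≠ 0 ↔ X i)

theorem Pre.frame (P : Pre n g r X h) (F : SolveFrame n h h') : Pre n g r X h' where
  reg_n := (F.reg _ (by simp)).trans P.reg_n
  reg_r := (F.reg _ (by simp)).trans P.reg_r
  reg_W := (F.reg _ (by simp)).trans P.reg_W
  adj i hi j hj := by
    rw [F.tbl 0 (by norm_num) _ ((idx_lt hi hj).trans (width_bounds n).2.2.2), P.adj i hi j hj]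
  excl i hi := by
    rw [F.tbl 1 (by norm_num) _ (by have := (width_bounds n).2.2.1; omega), P.excl i hi]

theorem Pre.eval_nT (P : Pre n g r X h) : nT.eval h = n := P.reg_n

theorem Pre.run_initC (P : Pre n g r X h) (hN : 30 * width n ≤ N) :
    ∃ h', HRun N initC h h' (9 * n + 10) ∧ DState n g r m h 0 0 (start n r X) stk 0 h' := by
  classical
  have hw := (width_bounds n).2.2.1
  have hw0 := width_pos n
  obtain ⟨h₁, R₁, F₁⟩ := run_tab (N := N) (k := 6) (f := fun _ => 0) (Z := n + 1) (h := h)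
    (len := .add nT (.const 1)) (e := .const 0) P.reg_W (by omega)
    (fun h' hr => by
      rw [Tm.eval_add, nT, Tm.eval_reg, Tm.eval_const, hr 0 (by norm_num), P.reg_n])
    (fun _ _ _ _ _ => rfl) (fun _ _ => Nat.zero_le _)
  have hz₁ : n + 1 ≤ width n := by omega
  have G₁ : Frame n h h₁ := Frame.fill ⟨fun _ _ => rfl, fun _ _ _ _ => rfl⟩ F₁ (by norm_num) hz₁
  have P₁ := P.frame G₁.solveFrame
  obtain ⟨h₂, R₂, F₂⟩ := run_tab (N := N) (k := 2) (f := start n r X) (Z := 2 * n) (h := h₁)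
    (len := itemsT) (e := initT) P₁.reg_W (by omega)
    (fun h' hr => by
      rw [itemsT, Tm.eval_mul, nT, Tm.eval_reg, Tm.eval_const, hr 0 (by norm_num), P₁.reg_n])
    (fun z hz h' F h13 => by
      have P' := P₁.frame (Frame.solveFrame (Frame.fill ⟨fun _ _ => rfl, fun _ _ _ _ => rfl⟩ F
        le_rfl (by omega)))
      have h0 : (Tm.and (.not (.eq zT (.reg 1))) (.and (.lt zT nT) (.tb 1 zT))).Holds h' ↔
          z ≠ r ∧ z < n ∧ X z := by
        rw [Tm.holds_and, Tm.holds_not, Tm.holds_eq, Tm.holds_and, Tm.holds_lt, P'.eval_nT, zT,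
          Tm.eval_reg, Tm.eval_reg, P'.reg_r, h13]
        refine and_congr_right fun _ => and_congr_right fun hzn => ?_
        rw [Tm.Holds, eval_tb P'.reg_W, Tm.eval_reg, h13, P'.excl z hzn]
      rw [initT, Tm.eval_add, Tm.eval_mul, Tm.eval_bool, Tm.eq, Tm.eval_op, zT, Tm.eval_reg,
        Tm.eval_reg, h13, P'.reg_r, Tm.eval_const, Op.eval, start]
      rw [zT, Tm.eq] at h0
      simp only [h0]
      by_cases hzr : z = r
      · simp [hzr]
      · by_cases h' : z < n ∧ X z <;> simp [hzr, h'])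
    (fun z _ => by unfold start; split_ifs <;> omega)
  have hz₂ : 2 * n ≤ width n := by omega
  have G₂ := G₁.fill F₂ le_rfl hz₂
  have P₂ := P.frame G₂.solveFrame
  refine ⟨((h₂.set 3 0).set 4 0).set 5 1, (R₁.seq (R₂.seq ((HRun.assign rfl (Nat.zero_le _)).seq
    ((HRun.assign rfl (Nat.zero_le _)).seq (HRun.assign rfl ?_))))).mono (by omega), ?_⟩
  · rw [Tm.eval_const]; omega
  · refine ⟨Base.set (Base.set (Base.set ⟨P₂.reg_n, P₂.reg_r, P₂.reg_W, P₂.adj, ?_⟩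
      (by norm_num)) (by norm_num)) (by norm_num),
      ((G₂.set (by simp)).set (by simp)).set (by simp), rfl, rfl, rfl, by simp, ?_⟩
    · intro i hi
      rw [F₂.tbl_eq hi]
    · intro c hc
      change ((h₂.tbl (width n) 6 c : ℕ) : ZMod m) = _
      rw [F₂.tbl_ne hz₂ (by norm_num) (by omega), F₁.tbl_eq (by omega)]
      simp

theorem Pre.run_roundC (P : Pre n g r X h) (hg : ∀ a b, g a b → a < n ∧ b < n) (hr : r < n)
    (hN : 30 * width n ≤ N) (h7 : h.reg 7 = m) (hm : 0 < m) (hmN : m ≤ N) {a : ℕ → ℤ} {s v : ℕ}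
    (T : Tree n g r (start n r X) a s) (h8 : h.reg 8 = v) (hv : v ≤ n + 1) :
    ∃ h', HRun N roundC h h' (9 * n + 11 + (s + 1) * (30 * width n)) ∧ SolveFrame n h h' ∧
      h'.reg 7 = m ∧ h'.reg 8 = least v fun c => (a c : ZMod m) ≠ 0 := by
  have hw := (width_bounds n).2.2.1
  obtain ⟨h₁, R₁, D⟩ := P.run_initC (m := m) (stk := 0) hN
  obtain ⟨h₂, R₂, F, hacc⟩ := T.run_searchC hg hr hN h7 hm hmN D
  have P₂ := P.frame F.solveFrame
  have e8 : h₂.reg 8 = v := (F.reg _ (by simp)).trans h8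
  have e7 : h₂.reg 7 = m := (F.reg _ (by simp)).trans h7
  refine ⟨h₂.set 8 (least v fun c => (a c : ZMod m) ≠ 0), (R₁.seq (R₂.seq (HRun.assign ?_
    ((least_le _ _).trans (by omega))))).mono (by omega),
    F.solveFrame.trans (SolveFrame.set (by simp)), ?_, State.set_reg_self _ _ _⟩
  -- The table of counts is only meaningful up to `n`; the guard is harmless because the search
  -- stops below `v ≤ n + 1`.
  · rw [Tm.eval_leastT (p := fun c => c ≤ n → (a c : ZMod m) ≠ 0), Tm.eval_reg, e8]
    · refine least_congr fun c hc => ?_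
      simp [show c ≤ n by omega]
    · intro z hz i hi
      rw [Tm.eval_reg, e8] at hz
      have e28 : ((h₂.set 29 z).set 28 i).reg 28 = i := State.set_reg_self _ _ _
      have e2 : ((h₂.set 29 z).set 28 i).reg 2 = width n := P₂.reg_W
      have e7' : ((h₂.set 29 z).set 28 i).reg 7 = m := e7
      rw [Tm.Holds, Tm.eval_op, eval_tb e2, Tm.eval_reg, Tm.eval_reg, e28, e7', Op.eval,
        ← hacc i (by omega)]
      simp only [show i ≤ n by omega, true_implies]
      refine not_iff_not.2 ?_
      rw [ZMod.natCast_eq_zero_iff, Nat.dvd_iff_mod_eq_zero]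
      rfl
  · rw [State.set_reg, if_neg (by norm_num), e7]

/-- The computation of the minimum size of a feasible set. -/
theorem Pre.run_solveC (P : Pre n g r X h) (hg : ∀ a b, g a b → a < n ∧ b < n) (hr : r < n)
    (hN : 30 * width n ≤ N) (hmN : 2 * ((n + 2) * (n + 2)) + 1 ≤ N) :
    ∃ h', HRun N solveC h h' (2 * ((n + 2) * (n + 2)) * ((stepBound n + 2) * (40 * width n)) + 3) ∧
      SolveFrame n h h' ∧ h'.reg 8 = opt n g r X := by
  have hw := (width_bounds n).2.2.1
  obtain ⟨a, s, T, hs, ha⟩ := exists_tree_start hg hr X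
  set M := 2 * ((n + 2) * (n + 2)) with hM
  set C := (stepBound n + 2) * (40 * width n) with hC
  have hcost : 9 * n + 11 + (s + 1) * (30 * width n) + 1 + 1 ≤ C := by
    have : (s + 1) * (30 * width n) ≤ (stepBound n + 1) * (30 * width n) :=
      Nat.mul_le_mul_right _ (by omega)
    have h2 := Nat.zero_le (stepBound n * width n)
    nlinarith
  -- Invariant: register `8` holds the least size whose count is nonzero for a modulus below `m`,
  -- and `k` moduli are left.
  have loop : ∀ k m, m + k = M + 1 → 0 < m → ∀ h₁, SolveFrame n h h₁ → h₁.reg 7 = m →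
      (h₁.reg 8 = least (n + 1) fun c => ∃ m', 0 < m' ∧ m' < m ∧ (a c : ZMod m') ≠ 0) →
      ∃ h', HRun N (.while (.not (.lt moduliT (.reg 7)))
        (.seq roundC (.assign 7 (.add (.reg 7) (.const 1))))) h₁ h' (k * C + 1) ∧
        SolveFrame n h h' ∧
        h'.reg 8 = least (n + 1) fun c => ∃ m', 0 < m' ∧ m' ≤ M ∧ (a c : ZMod m') ≠ 0 := by
    intro k
    induction k with
    | zero =>
      intro m hm _ h₁ F e7 e8
      have P₁ := P.frame F
      refine ⟨h₁, (HRun.while_false ?_).mono (by omega), F, ?_⟩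
      · rw [Tm.holds_not, Tm.holds_lt, moduliT, Tm.eval_mul, Tm.eval_mul, Tm.eval_add, P₁.eval_nT,
          Tm.eval_const, Tm.eval_reg, e7, not_not]
        omega
      · rw [e8]
        simp only [show ∀ m', m' < m ↔ m' ≤ M by omega]
    | succ k ih =>
      intro m hm hm0 h₁ F e7 e8
      have P₁ := P.frame F
      obtain ⟨h₂, R, F₂, e7', e8'⟩ := P₁.run_roundC hg hr hN e7 hm0 (by omega) T e8
        (least_le _ _)
      obtain ⟨h₃, R₃, F₃, e8₃⟩ := ih (m + 1) (by omega) (by omega) (h₂.set 7 (m + 1))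
        ((F.trans F₂).trans (SolveFrame.set (by simp))) (State.set_reg_self _ _ _) (by
          rw [State.set_reg, if_neg (by norm_num), e8', least_least]
          refine least_congr fun c _ => ?_
          constructor
          · rintro (⟨m', h1, h2, h3⟩ | h)
            · exact ⟨m', h1, by omega, h3⟩
            · exact ⟨m, hm0, by omega, h⟩
          · rintro ⟨m', h1, h2, h3⟩
            rcases Nat.lt_succ_iff_lt_or_eq.1 h2 with h | rfl
            · exact .inl ⟨m', h1, h, h3⟩
            · exact .inr h3)
      refine ⟨h₃, (HRun.while_true ?_ (R.seq (HRun.assign ?_ (by omega))) R₃).mono ?_, F₃, e8₃⟩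
      · rw [Tm.holds_not, Tm.holds_lt, moduliT, Tm.eval_mul, Tm.eval_mul, Tm.eval_add, P₁.eval_nT,
          Tm.eval_const, Tm.eval_reg, e7]
        omega
      · rw [Tm.eval_add, Tm.eval_reg, e7', Tm.eval_const]
      · rw [add_mul k 1 C]; omega
  obtain ⟨h', R, F, e8⟩ := loop M 1 (by omega) one_pos ((h.set 8 (n + 1)).set 7 1)
    ((SolveFrame.set (by simp)).trans (SolveFrame.set (by simp))) (State.set_reg_self _ _ _) (by
      rw [State.set_reg, if_neg (by norm_num), State.set_reg_self]
      refine (least_eq_of_forall fun c _ => ?_).symm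
      rintro ⟨m', h1, h2, -⟩
      omega)
  refine ⟨h', (HRun.seq (HRun.assign ?_ (by omega)) (HRun.seq (HRun.assign rfl ?_) R)).mono
    (by omega), F, e8.trans ha⟩
  · rw [Tm.eval_add, P.eval_nT, Tm.eval_const]
  · rw [Tm.eval_const]; omega

end

end MaxLeaf

/-! ### The algorithm -/

namespace RAM

/-- Find the best root. -/
def rootsC : Cmd := .while (.lt (.reg 1) nT) <| .seq solveC <|
  .seq (.ite (.lt (.reg 8) (.reg 9)) (.seq (.assign 9 (.reg 8)) (.assign 10 (.reg 1))) .skip) <|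
    .assign 1 (.add (.reg 1) (.const 1))

/-- Exclude as many vertices as possible. -/
def excludeC : Cmd := .while (.lt (.reg 11) nT) <| .seq (.store (.addr 1 (.reg 11)) (.const 1)) <|
  .seq solveC <|
  .seq (.ite (.eq (.reg 8) (.reg 9)) .skip (.store (.addr 1 (.reg 11)) (.const 0))) <|
    .assign 11 (.add (.reg 11) (.const 1))

/-- The final statuses. -/
def finalT : Tm := .bool (.or (.eq zT (.reg 1)) (.and (.lt zT nT) (.not (.tb 1 zT))))

/-- The parent of the vertex in the register `13`. -/
def parentT : Tm := .leastT 34 35 nT <| .and (inT 34) <| .and (adjT 34 13) <|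
  .ex 33 nT <| .and (.tb 4 (.add (.mul (.reg 33) nnT) (.add (.mul (.reg 1) nT) (.reg 34))))
    (.not (.tb 4 (.add (.mul (.reg 33) nnT) (.add (.mul (.reg 1) nT) (.reg 13)))))

/-- Write the output. -/
def outputC : Cmd := .seq (tabC 2 itemsT finalT) <| .seq reachC <| .seq (tabC 7 nT parentT) <|
  .seq (tabC 0 nT (.tb 7 zT)) <| .assign 0 (.const 1)

/-- The algorithm. -/
def mainC : Cmd :=
  .seq (.assign 2 (.mul (.add nT (.const 1)) (.mul (.add nT (.const 1)) (.add nT (.const 1))))) <|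
  .seq (.assign 9 (.add nT (.const 1))) <| .seq rootsC <|
  .ite (.lt (.reg 9) (.add nT (.const 1)))
    (.seq (.assign 1 (.reg 10)) <| .seq (.assign 11 (.const 0)) <| .seq excludeC outputC)
    (.assign 0 (.const 0))

end RAM

namespace MaxLeaf

open RAM

section

variable {n N : ℕ} {g : ℕ → ℕ → Prop} {r k best : ℕ} {X Y : ℕ → Prop} {h h' : State}

/-- A bound for the number of steps of `solveC`. -/
noncomputable def solveTime (n : ℕ) : ℕ :=
  2 * ((n + 2) * (n + 2)) * ((stepBound n + 2) * (40 * width n)) + 3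

theorem opt_le : opt n g r X ≤ n + 1 := least_le _ _

theorem opt_le_of {S : Finset ℕ} (hS : S ⊆ Finset.range n) (hF : Feasible n g r S)
    (hX : ∀ x ∈ S, X x → x = r) : opt n g r X ≤ S.card :=
  least_le_of ⟨S, hS, hF, hX, le_rfl⟩

theorem exists_of_opt_lt (h : opt n g r X < n + 1) : ∃ S, S ⊆ Finset.range n ∧
    Feasible n g r S ∧ (∀ x ∈ S, X x → x = r) ∧ S.card = opt n g r X := by
  obtain ⟨S, hS, hF, hX, hc⟩ := least_spec h
  exact ⟨S, hS, hF, hX, hc.antisymm (opt_le_of hS hF hX)⟩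

theorem opt_mono (hXY : ∀ x, X x → Y x) : opt n g r X ≤ opt n g r Y := by
  rcases (opt_le : opt n g r Y ≤ n + 1).lt_or_eq with h | h
  · obtain ⟨S, hS, hF, hY, hc⟩ := exists_of_opt_lt h
    exact hc ▸ opt_le_of hS hF fun x hx hX => hY x hx (hXY x hX)
  · exact h ▸ opt_le

theorem Pre.set (P : Pre n g r X h) {x v : ℕ} (hx : 3 ≤ x) : Pre n g r X (h.set x v) where
  reg_n := by rw [State.set_reg, if_neg (by omega), P.reg_n]
  reg_r := by rw [State.set_reg, if_neg (by omega), P.reg_r]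
  reg_W := by rw [State.set_reg, if_neg (by omega), P.reg_W]
  adj := P.adj
  excl := P.excl

theorem Pre.set_root (P : Pre n g r X h) (v : ℕ) : Pre n g v X (h.set 1 v) where
  reg_n := P.reg_n
  reg_r := State.set_reg_self _ _ _
  reg_W := P.reg_W
  adj := P.adj
  excl := P.excl

theorem Pre.put (P : Pre n g r X h) {v c : ℕ} (hv : v < n)
    (hY : ∀ x < n, Y x ↔ if x = v then c ≠ 0 else X x) :
    Pre n g r Y (h.put (width n * 1 + v) c) where
  reg_n := P.reg_n
  reg_r := P.reg_r
  reg_W := P.reg_W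
  adj i hi j hj := by
    have := (width_bounds n).2.2.1
    rw [tbl_put (by omega) ((idx_lt hi hj).trans (width_bounds n).2.2.2), if_neg (by norm_num),
      P.adj i hi j hj]
  excl i hi := by
    have := (width_bounds n).2.2.1
    rw [tbl_put (by omega) (by omega), hY i hi, ← P.excl i hi]
    split_ifs with h1 h2 h2 <;> simp_all

/-- The search for the best root. -/
theorem Pre.run_rootsC (hg : ∀ a b, g a b → a < n ∧ b < n) (hN : 30 * width n ≤ N)
    (hmN : 2 * ((n + 2) * (n + 2)) + 1 ≤ N) : ∀ j k h, j + k = n → Pre n g k X h →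
    h.reg 9 ≤ n + 1 → (∀ r < k, h.reg 9 ≤ opt n g r X) →
    (h.reg 9 < n + 1 → h.reg 10 < k ∧ opt n g (h.reg 10) X = h.reg 9) →
    ∃ h', HRun N rootsC h h' (j * (solveTime n + 7) + 1) ∧ Pre n g n X h' ∧
      h'.reg 9 ≤ n + 1 ∧ (∀ r < n, h'.reg 9 ≤ opt n g r X) ∧
      (h'.reg 9 < n + 1 → h'.reg 10 < n ∧ opt n g (h'.reg 10) X = h'.reg 9) := by
  have hw := (width_bounds n).2.2.1
  intro j
  induction j with
  | zero =>
    intro k h hk P h1 h2 h3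
    obtain rfl : k = n := by omega
    refine ⟨h, (HRun.while_false ?_).mono (by omega), P, h1, h2, h3⟩
    rw [Tm.holds_lt, P.eval_nT, Tm.eval_reg, P.reg_r]
    exact lt_irrefl _
  | succ j ih =>
    intro k h hk P h1 h2 h3
    obtain ⟨h₁, R₁, F, e8⟩ := P.run_solveC hg (by omega) hN hmN
    have P₁ := P.frame F
    have e9 : h₁.reg 9 = h.reg 9 := F.reg _ (by simp)
    have e10 : h₁.reg 10 = h.reg 10 := F.reg _ (by simp)
    have hif : ∃ h₂, HRun N (.ite (.lt (.reg 8) (.reg 9))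
        (.seq (.assign 9 (.reg 8)) (.assign 10 (.reg 1))) .skip) h₁ h₂ 3 ∧ Pre n g k X h₂ ∧
        h₂.reg 9 ≤ n + 1 ∧ (∀ r < k + 1, h₂.reg 9 ≤ opt n g r X) ∧
        (h₂.reg 9 < n + 1 → h₂.reg 10 < k + 1 ∧ opt n g (h₂.reg 10) X = h₂.reg 9) := by
      by_cases hlt : opt n g k X < h.reg 9
      · refine ⟨(h₁.set 9 (opt n g k X)).set 10 k, HRun.ite_true ?_ ((HRun.assign (e := .reg 8) e8 ?_).seq
          (HRun.assign ?_ ?_)), (P₁.set (by norm_num)).set (by norm_num), ?_⟩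
        · rwa [Tm.holds_lt, Tm.eval_reg, Tm.eval_reg, e8, e9]
        · omega
        · rw [Tm.eval_reg, State.set_reg, if_neg (by norm_num), P₁.reg_r]
        · omega
        · have q9 : ((h₁.set 9 (opt n g k X)).set 10 k).reg 9 = opt n g k X := by
            rw [State.set_reg, if_neg (by norm_num), State.set_reg_self]
          rw [q9, State.set_reg_self]
          refine ⟨opt_le, fun r hr => ?_, fun _ => ⟨by omega, rfl⟩⟩
          rcases Nat.lt_succ_iff_lt_or_eq.1 hr with h | rfl
          · exact hlt.le.trans (h2 r h)
          · exact le_rfl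
      · refine ⟨h₁, (HRun.ite_false ?_ HRun.skip).mono (by norm_num), P₁, by omega, ?_, ?_⟩
        · rwa [Tm.holds_lt, Tm.eval_reg, Tm.eval_reg, e8, e9]
        · intro r hr
          rcases Nat.lt_succ_iff_lt_or_eq.1 hr with h | rfl
          · exact e9 ▸ h2 r h
          · exact e9 ▸ not_lt.1 hlt
        · rw [e9, e10]
          exact fun h => ⟨(h3 h).1.trans (Nat.lt_succ_self _), (h3 h).2⟩
    obtain ⟨h₂, R₂, P₂, p1, p2, p3⟩ := hif
    obtain ⟨h₃, R₃, q⟩ := ih (k + 1) (h₂.set 1 (k + 1)) (by omega) (P₂.set_root _) p1 p2 p3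
    refine ⟨h₃, (HRun.while_true ?_ (R₁.seq (R₂.seq (HRun.assign ?_ (by omega)))) R₃).mono ?_, q⟩
    · rw [Tm.holds_lt, P.eval_nT, Tm.eval_reg, P.reg_r]; omega
    · rw [Tm.eval_add, Tm.eval_reg, P₂.reg_r, Tm.eval_const]
    · rw [← solveTime, add_mul j 1]; omega

/-- The exclusion of vertices. -/
theorem Pre.run_excludeC (hg : ∀ a b, g a b → a < n ∧ b < n) (hr : r < n)
    (hN : 30 * width n ≤ N) (hmN : 2 * ((n + 2) * (n + 2)) + 1 ≤ N) : ∀ j k X h, j + k = n →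
    Pre n g r X h → h.reg 11 = k → h.reg 9 = best → opt n g r X = best → (∀ v, X v → v < k) →
    (∀ v < k, v ≠ r → ¬ X v → opt n g r (fun x => x = v ∨ X x) ≠ best) →
    ∃ h' X, HRun N excludeC h h' (j * (solveTime n + 7) + 1) ∧ Pre n g r X h' ∧
      opt n g r X = best ∧
      (∀ v < n, v ≠ r → ¬ X v → opt n g r (fun x => x = v ∨ X x) ≠ best) := by
  have hw := (width_bounds n).2.2.1
  intro j
  induction j with
  | zero =>
    intro k X h hk P e11 e9 ho hX hv
    obtain rfl : k = n := by omega
    refine ⟨h, X, (HRun.while_false ?_).mono (by omega), P, ho, hv⟩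
    rw [Tm.holds_lt, P.eval_nT, Tm.eval_reg, e11]
    exact lt_irrefl _
  | succ j ih =>
    intro k X h hk P e11 e9 ho hX hv
    have hkn : k < n := by omega
    have P₁ : Pre n g r (fun x => x = k ∨ X x) (h.put (width n * 1 + k) 1) :=
      P.put hkn fun x _ => by split_ifs with hx <;> simp [hx]
    obtain ⟨h₁, R₁, F, e8⟩ := P₁.run_solveC hg hr hN hmN
    have P₂ := P₁.frame F
    have e9' : h₁.reg 9 = best := (F.reg _ (by simp)).trans e9
    have e11' : h₁.reg 11 = k := (F.reg _ (by simp)).trans e11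
    have hmono : best ≤ opt n g r (fun x => x = k ∨ X x) := ho ▸ opt_mono fun x hx => .inr hx
    have hif : ∃ h₂ Y, HRun N (.ite (.eq (.reg 8) (.reg 9)) .skip
        (.store (.addr 1 (.reg 11)) (.const 0))) h₁ h₂ 2 ∧ Pre n g r Y h₂ ∧ h₂.reg 11 = k ∧
        h₂.reg 9 = best ∧ opt n g r Y = best ∧ (∀ v, Y v → v < k + 1) ∧
        (∀ v < k + 1, v ≠ r → ¬ Y v → opt n g r (fun x => x = v ∨ Y x) ≠ best) := by
      by_cases heq : opt n g r (fun x => x = k ∨ X x) = best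
      · refine ⟨h₁, _, HRun.ite_true ?_ HRun.skip, P₂, e11', e9', heq, ?_, ?_⟩
        · rw [Tm.holds_eq, Tm.eval_reg, Tm.eval_reg, e8, e9', heq]
        · rintro v (rfl | h)
          · exact Nat.lt_succ_self _
          · exact (hX v h).trans (Nat.lt_succ_self _)
        · intro v hvk hvr hvY hopt
          push Not at hvY
          -- Excluding more vertices can only raise the optimum, so a vertex that could not be
          -- spared earlier cannot be spared now.
          have h1 : opt n g r (fun x => x = v ∨ X x) ≤ best :=
            hopt ▸ opt_mono fun x hx => hx.imp_right .inr
          have h2 : best ≤ opt n g r (fun x => x = v ∨ X x) := ho ▸ opt_mono fun x hx => .inr hx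
          exact hv v (by omega) hvr hvY.2 (h1.antisymm h2)
      · refine ⟨h₁.put (width n * 1 + k) 0, X, HRun.ite_false ?_ (HRun.store ?_ rfl ?_),
          P₂.put hkn ?_, e11', e9', ho, fun v h => (hX v h).trans (Nat.lt_succ_self _), ?_⟩
        · rwa [Tm.holds_eq, Tm.eval_reg, Tm.eval_reg, e8, e9']
        · rw [eval_addr P₂.reg_W, Tm.eval_reg, e11']
        · exact Nat.zero_le _
        · intro x _
          split_ifs with hx
          · subst hx; simpa using fun h => lt_irrefl _ (hX x h)
          · simp [hx]
        · intro v hvk hvr hvX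
          rcases Nat.lt_succ_iff_lt_or_eq.1 hvk with h | rfl
          · exact hv v h hvr hvX
          · exact heq
    obtain ⟨h₂, Y, R₂, P₃, p11, p9, p1, p2, p3⟩ := hif
    obtain ⟨h₃, Z, R₃, q⟩ := ih (k + 1) Y (h₂.set 11 (k + 1)) (by omega) (P₃.set (by norm_num))
      (State.set_reg_self _ _ _) p9 p1 p2 p3
    refine ⟨h₃, Z, (HRun.while_true ?_ ((HRun.store ?_ rfl (by rw [Tm.eval_const]; omega)).seq
      (R₁.seq (R₂.seq (HRun.assign ?_ (by omega))))) R₃).mono ?_, q⟩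
    · rw [Tm.holds_lt, P.eval_nT, Tm.eval_reg, e11]; omega
    · rw [eval_addr P.reg_W, Tm.eval_reg, e11]
    · rw [Tm.eval_add, Tm.eval_reg, p11, Tm.eval_const]
    · rw [← solveTime, add_mul j 1]; omega

open Classical in
/-- The final set of internal vertices. -/
noncomputable def kept (n r : ℕ) (X : ℕ → Prop) : Finset ℕ :=
  (Finset.range n).filter fun v => v = r ∨ ¬ X v

theorem mem_kept {v : ℕ} : v ∈ kept n r X ↔ v < n ∧ (v = r ∨ ¬ X v) := by simp [kept]

/-- Any optimal set avoiding `X` is all of the kept set: a kept vertex other than `r` missing from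
it could have been excluded as well without changing the optimum. -/
theorem feasible_kept (hr : r < n) (ho : opt n g r X < n + 1)
    (hv : ∀ v < n, v ≠ r → ¬ X v → opt n g r (fun x => x = v ∨ X x) ≠ opt n g r X) :
    Feasible n g r (kept n r X) ∧ (kept n r X).card = opt n g r X := by
  obtain ⟨S, hS, hF, hX, hc⟩ := exists_of_opt_lt ho
  suffices kept n r X = S by rw [this]; exact ⟨hF, hc⟩
  ext v
  rw [mem_kept]
  constructor
  · rintro ⟨hvn, h⟩
    by_contra hvS
    have hvr : v ≠ r := by rintro rfl; exact hvS hF.1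
    have hXv := h.resolve_left hvr
    refine hv v hvn hvr hXv (le_antisymm ?_ (opt_mono fun x hx => .inr hx))
    rw [← hc]
    refine opt_le_of hS hF fun x hx hxX => ?_
    rcases hxX with rfl | h
    · exact absurd hx hvS
    · exact hX x hx h
  · intro hvS
    refine ⟨Finset.mem_range.1 (hS hvS), ?_⟩
    by_cases h : X v
    · exact .inl (hX v hvS h)
    · exact .inr h

/-- The output. -/
theorem Pre.run_outputC (P : Pre n g r X h) (hg : ∀ a b, g a b → a < n ∧ b < n) (hr : r < n)
    (hN : 30 * width n ≤ N) (hF : Feasible n g r (kept n r X)) :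
    ∃ h', HRun N outputC h h' (12 * n + 3 * width n + 9) ∧ h'.reg 0 = 1 ∧ h'.reg 1 = r ∧
      ∀ v < n, v ≠ r → h'.mem v ∈ kept n r X ∧ g (h'.mem v) v ∧
        ∃ l, ReachIn n g (kept n r X) l r (h'.mem v) ∧ ¬ ReachIn n g (kept n r X) l r v := by
  classical
  have hw := (width_bounds n).2.2.1
  set S := kept n r X with hS
  set σ : ℕ → ℕ := fun i => if i = r ∨ i < n ∧ ¬ X i then 1 else 0 with hσ
  have hin : inSet n σ = S := by
    ext v
    rw [mem_inSet, hS, mem_kept]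
    refine and_congr_right fun hv => ?_
    simp only [hσ]
    split_ifs with h <;> simp_all
  obtain ⟨h₁, R₁, F₁⟩ := run_tab (N := N) (k := 2) (f := σ) (Z := 2 * n) (h := h)
    (len := itemsT) (e := finalT) P.reg_W (by omega)
    (fun h' hr => by
      rw [itemsT, Tm.eval_mul, nT, Tm.eval_reg, Tm.eval_const, hr 0 (by norm_num), P.reg_n])
    (fun z hz h' F h13 => by
      have P' := P.frame (Frame.solveFrame (Frame.fill ⟨fun _ _ => rfl, fun _ _ _ _ => rfl⟩ F
        le_rfl (by omega)))
      have h0 : (Tm.or (.eq zT (.reg 1)) (.and (.lt zT nT) (.not (.tb 1 zT)))).Holds h' ↔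
          z = r ∨ z < n ∧ ¬ X z := by
        rw [Tm.holds_or, Tm.holds_eq, Tm.holds_and, Tm.holds_not, Tm.holds_lt, P'.eval_nT, zT,
          Tm.eval_reg, Tm.eval_reg, P'.reg_r, h13]
        refine or_congr_right (and_congr_right fun hzn => not_congr ?_)
        rw [Tm.Holds, eval_tb P'.reg_W, Tm.eval_reg, h13, P'.excl z hzn]
      rw [finalT, Tm.eval_bool]
      simp only [h0, hσ])
    (fun z _ => by simp only [hσ]; split_ifs <;> omega)
  have P₁ := P.frame (Frame.solveFrame (Frame.fill ⟨fun _ _ => rfl, fun _ _ _ _ => rfl⟩ F₁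
    le_rfl hw.le))
  have B₁ : Base n g r σ h₁ :=
    ⟨P₁.reg_n, P₁.reg_r, P₁.reg_W, P₁.adj, fun i hi => F₁.tbl_eq hi⟩
  obtain ⟨h₂, R₂, E₂, -, hreach⟩ := B₁.run_reachC hg (by omega : width n ≤ N)
  rw [hin] at hreach
  set q : ℕ → ℕ → Prop := fun v u => u ∈ S ∧ g u v ∧ ∃ l < n,
    ReachIn n g S l r u ∧ ¬ ReachIn n g S l r v with hq
  have hidx : ∀ l ≤ n, ∀ u < n, l * (n * n) + (r * n + u) < (n + 1) * (n * n) := by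
    intro l hl u hu
    have := idx_lt hr hu
    have : l * (n * n) ≤ n * (n * n) := Nat.mul_le_mul_right _ hl
    rw [add_mul, one_mul]; omega
  have hz : n ≤ width n := by omega
  have hWn := (width_bounds n).1
  obtain ⟨h₃, R₃, F₃⟩ := run_tab (N := N) (k := 7) (f := fun v => least n (q v)) (Z := n)
    (h := h₂) (len := nT) (e := parentT) E₂.reg_W (by omega)
    (fun h' hr => by rw [nT, Tm.eval_reg, hr 0 (by norm_num), E₂.reg_n])
    (fun v hv h' F h13 => by
      have B' := E₂.base.fill F (by norm_num) (by norm_num) (hv.le.trans hz)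
      rw [parentT, Tm.eval_leastT (p := fun u => u < n → q v u), B'.eval_nT]
      · exact least_congr fun u hu => by simp [hu]
      · intro z hzn u hu
        rw [B'.eval_nT] at hzn
        have hun : u < n := by omega
        have B3 := (B'.set (x := 35) (y := z) (by norm_num)).set (x := 34) (y := u) (by norm_num)
        have e34 : ((h'.set 35 z).set 34 u).reg 34 = u := State.set_reg_self _ _ _
        have e13 : ((h'.set 35 z).set 34 u).reg 13 = v := by
          rw [State.set_reg, if_neg (by norm_num), State.set_reg, if_neg (by norm_num), h13]
        have etbl : ∀ i < width n, ((h'.set 35 z).set 34 u).tbl (width n) 4 i =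
            h₂.tbl (width n) 4 i :=
          fun i hi => F.tbl_ne (hv.le.trans hz) (by norm_num) hi
        generalize (h'.set 35 z).set 34 u = h₄ at B3 e34 e13 etbl
        simp only [hun, true_implies]
        rw [Tm.holds_and, Tm.holds_and, B3.holds_inT (by rwa [e34]),
          B3.holds_adjT (by rwa [e34]) (by rwa [e13]), e34, e13, hin, Tm.holds_ex, B3.eval_nT]
        refine and_congr_right fun _ => and_congr_right fun _ => exists_congr fun l =>
          and_congr_right fun hl => ?_
        have B4 := B3.set (x := 33) (y := l) (by norm_num)
        have f34 : (h₄.set 33 l).reg 34 = u := by rw [State.set_reg, if_neg (by norm_num), e34]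
        have f13 : (h₄.set 33 l).reg 13 = v := by rw [State.set_reg, if_neg (by norm_num), e13]
        have f33 : (h₄.set 33 l).reg 33 = l := State.set_reg_self _ _ _
        have ftbl : ∀ i, (h₄.set 33 l).tbl (width n) 4 i = h₄.tbl (width n) 4 i := fun _ => rfl
        rw [Tm.holds_and, Tm.holds_not, Tm.Holds, Tm.Holds, eval_tb B4.reg_W, eval_tb B4.reg_W]
        simp only [Tm.eval_add, Tm.eval_mul, B4.eval_nnT, B4.eval_nT, Tm.eval_reg, f33, f34, f13,
          B4.reg_r, ftbl]
        rw [etbl _ ((hidx l hl.le u hun).trans_le hWn), etbl _ ((hidx l hl.le v hv).trans_le hWn),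
          hreach l hl.le r hr u hun, hreach l hl.le r hr v hv])
    (fun v _ => (least_le _ _).trans (by omega))
  have e2 : h₃.reg 2 = width n := (F₃.reg _ (by norm_num)).trans E₂.reg_W
  -- The parents are collected in table `7` and copied to address `0` only now, since their
  -- computation still reads the adjacency matrix stored there.
  obtain ⟨h₄, R₄, F₄⟩ := run_tab (N := N) (k := 0) (f := fun v => least n (q v)) (Z := n)
    (h := h₃) (len := nT) (e := .tb 7 zT) e2 (by omega)
    (fun h' hr => by
      rw [nT, Tm.eval_reg, hr 0 (by norm_num), F₃.reg 0 (by norm_num), E₂.reg_n])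
    (fun v hv h' F h13 => by
      rw [eval_tb ((F.reg 2 (by norm_num)).trans e2), zT, Tm.eval_reg, h13,
        F.tbl_ne (hv.le.trans hz) (by norm_num) (by omega), F₃.tbl_eq hv])
    (fun v _ => (least_le _ _).trans (by omega))
  refine ⟨h₄.set 0 1, (R₁.seq (R₂.seq (R₃.seq (R₄.seq (HRun.assign rfl ?_))))).mono (by omega),
    State.set_reg_self _ _ _, ?_, ?_⟩
  · rw [Tm.eval_const]; omega
  · rw [State.set_reg, if_neg (by norm_num), F₄.reg 1 (by norm_num), F₃.reg 1 (by norm_num),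
      E₂.reg_r]
  · intro v hv hvr
    have hmem : (h₄.set 0 1).mem v = least n (q v) := by
      rw [State.set_mem, ← F₄.tbl_eq hv, State.tbl, mul_zero, zero_add]
    obtain ⟨u, hu, huq⟩ := exists_parent hg hF hr hv hvr
    have hq' := least_spec (b := n) (p := q v) ((least_le_of huq).trans_lt hu)
    rw [hmem]
    exact ⟨hq'.1, hq'.2.1, hq'.2.2.choose, hq'.2.2.choose_spec.2⟩

/-- The algorithm. -/
theorem run_mainC (hg : ∀ a b, g a b → a < n ∧ b < n)
    (hN : 30 * width n ≤ N) (hmN : 2 * ((n + 2) * (n + 2)) + 1 ≤ N)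
    (h0 : h.reg 0 = n) (h1 : h.reg 1 = 0)
    (hadj : ∀ i < n, ∀ j < n, (h.mem (i * n + j) ≠ 0 ↔ g i j))
    (hzero : ∀ a, n * n ≤ a → h.mem a = 0) :
    ∃ h', HRun N mainC h h' ((2 * n + 2) * (solveTime n + 20 * width n)) ∧
      ((h'.reg 0 = 1 ∧ ∃ r S, r < n ∧ S ⊆ Finset.range n ∧ Feasible n g r S ∧
        (∀ r' S', S' ⊆ Finset.range n → Feasible n g r' S' → S.card ≤ S'.card) ∧
        h'.reg 1 = r ∧ ∀ v < n, v ≠ r → h'.mem v ∈ S ∧ g (h'.mem v) v ∧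
          ∃ l, ReachIn n g S l r (h'.mem v) ∧ ¬ ReachIn n g S l r v) ∨
      (h'.reg 0 = 0 ∧ ∀ r S, S ⊆ Finset.range n → ¬ Feasible n g r S)) := by
  have hw := (width_bounds n).2.2.1
  have hnn := (width_bounds n).2.2.2
  have hw0 := width_pos n
  have P : Pre n g 0 (fun _ => False) ((h.set 2 (width n)).set 9 (n + 1)) := by
    refine Pre.set (h := h.set 2 (width n)) ⟨h0, h1, State.set_reg_self _ _ _, ?_, ?_⟩ (by norm_num)
    · intro i hi j hj
      rw [State.tbl, mul_zero, zero_add, State.set_mem, hadj i hi j hj]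
    · intro i hi
      rw [State.tbl, mul_one, State.set_mem, hzero _ (by omega)]
      simp
  have e9 : ((h.set 2 (width n)).set 9 (n + 1)).reg 9 = n + 1 := State.set_reg_self _ _ _
  obtain ⟨h₁, R₁, P₁, p1, p2, p3⟩ := Pre.run_rootsC hg hN hmN n 0 _ rfl P e9.le
    (by simp) (by rw [e9]; simp)
  have hstart : ∀ {c h' T}, HRun N c h₁ h' T → HRun N (.seq
      (.assign 2 (.mul (.add nT (.const 1)) (.mul (.add nT (.const 1)) (.add nT (.const 1))))) <|
      .seq (.assign 9 (.add nT (.const 1))) <| .seq rootsC c) h h'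
      (n * (solveTime n + 7) + 3 + T) := by
    intro c h' T R
    refine ((HRun.assign ?_ (by omega)).seq ((HRun.assign ?_ (by omega)).seq (R₁.seq R))).mono
      (by omega)
    · simp only [Tm.eval_mul, Tm.eval_add, nT, Tm.eval_reg, Tm.eval_const, h0, width]; ring
    · rw [Tm.eval_add, nT, Tm.eval_reg, Tm.eval_const, State.set_reg, if_neg (by norm_num), h0]
  by_cases hlt : h₁.reg 9 < n + 1
  · obtain ⟨hr, ho⟩ := p3 hlt
    set r := h₁.reg 10 with hr'
    obtain ⟨h₂, X, R₂, P₂, ho₂, hv⟩ := Pre.run_excludeC (best := h₁.reg 9) hg hr hN hmN n 0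
      (fun _ => False) ((h₁.set 1 r).set 11 0) rfl ((P₁.set_root r).set (by norm_num))
      (State.set_reg_self _ _ _) rfl ho (by simp) (by simp)
    obtain ⟨hF, hc⟩ := feasible_kept hr (ho₂.trans_lt hlt) (by rwa [ho₂])
    obtain ⟨h₃, R₃, q0, q1, q2⟩ := P₂.run_outputC hg hr hN hF
    refine ⟨h₃, (hstart (HRun.ite_true ?_ ((HRun.assign rfl ?_).seq ((HRun.assign rfl ?_).seq
      (R₂.seq R₃))))).mono ?_, .inl ⟨q0, r, kept n r X, hr,
      fun x hx => Finset.mem_range.2 (mem_kept.1 hx).1, hF, ?_, q1, q2⟩⟩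
    · rwa [Tm.holds_lt, Tm.eval_add, P₁.eval_nT, Tm.eval_reg, Tm.eval_const]
    · rw [Tm.eval_reg]; omega
    · exact Nat.zero_le _
    · have := Nat.zero_le (n * width n)
      nlinarith
    · intro r' S' hS' hF'
      rw [hc, ho₂]
      exact (p2 r' (Finset.mem_range.1 (hS' hF'.1))).trans (opt_le_of hS' hF' (by simp))
  · refine ⟨h₁.set 0 0, (hstart (HRun.ite_false ?_ (HRun.assign rfl (Nat.zero_le _)))).mono ?_,
      .inr ⟨State.set_reg_self _ _ _, fun r S hS hF => ?_⟩⟩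
    · rwa [Tm.holds_lt, Tm.eval_add, P₁.eval_nT, Tm.eval_reg, Tm.eval_const]
    · have := Nat.zero_le (n * width n)
      nlinarith
    -- The value `n + 1` in register `9` means that no root has a feasible set, as such a set would
    -- have at most `n` elements.
    · have h2 := (p2 r (Finset.mem_range.1 (hS hF.1))).trans (opt_le_of hS hF (by simp))
      have h3 := Finset.card_le_card hS
      rw [Finset.card_range] at h3
      omega

end

end MaxLeaf

/-! ### The main theorem -/

namespace MaxLeaf

open RAM

section

variable {n : ℕ} {G : Digraph (Fin n)}

/-! ### Input, output and resources -/

theorem input_mem (i : ℕ) (_ : i < n) (j : ℕ) (hj : j < n) :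
    (input G).mem (i * n + j) ≠ 0 ↔ arcs G i j := by
  classical
  have h : (∃ i' j' : Fin n, i * n + j = i' * n + j' ∧ G.Adj i' j') ↔ arcs G i j := by
    constructor
    · rintro ⟨i', j', he, ha⟩
      have h1 := idx2_div (k := i) hj
      rw [he, (idx2_div j'.2).1, (idx2_div j'.2).2] at h1
      rw [← h1.1, ← h1.2]
      exact arcs_coe.2 ha
    · rintro ⟨hi, hj, ha⟩
      exact ⟨⟨i, hi⟩, ⟨j, hj⟩, rfl, ha⟩
  rw [← h]
  simp [input]

theorem input_mem_le (a : ℕ) : (input G).mem a ≤ 1 := by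
  simp only [input]; split_ifs <;> simp

theorem input_mem_eq_zero (a : ℕ) (ha : n * n ≤ a) : (input G).mem a = 0 := by
  simp only [input]
  rw [if_neg]
  rintro ⟨i, j, rfl, -⟩
  have := idx_lt i.2 j.2
  omega

theorem input_reg_le (x : ℕ) : (input G).reg x ≤ n := by
  simp only [input]; split_ifs <;> simp

theorem wf_mainC : mainC.wf := by decide

theorem exp_mainC_pos : mainC.exp ≠ 0 := by
  simp only [mainC, Cmd.exp]; omega

/-- The output of the algorithm is correct. -/
theorem isMaxLeafOutput {s h : State} (hs : s.Agree h)
    (H : (h.reg 0 = 1 ∧ ∃ r S, r < n ∧ S ⊆ Finset.range n ∧ Feasible n (arcs G) r S ∧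
        (∀ r' S', S' ⊆ Finset.range n → Feasible n (arcs G) r' S' → S.card ≤ S'.card) ∧
        h.reg 1 = r ∧ ∀ v < n, v ≠ r → h.mem v ∈ S ∧ arcs G (h.mem v) v ∧
          ∃ l, ReachIn n (arcs G) S l r (h.mem v) ∧ ¬ ReachIn n (arcs G) S l r v) ∨
      (h.reg 0 = 0 ∧ ∀ r S, S ⊆ Finset.range n → ¬ Feasible n (arcs G) r S)) :
    IsMaxLeafOutput G s := by
  have h0 := hs.1 0 (by norm_num [numVars])
  have h1 := hs.1 1 (by norm_num [numVars])
  rcases H with ⟨e0, r, S, hr, hS, hF, hmin, e1, hpar⟩ | ⟨e0, hno⟩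
  · refine .inl ⟨h0.trans e0, ⟨fun u v => v ≠ ⟨r, hr⟩ ∧ s.mem v = u⟩, ⟨r, hr⟩, ?_, h1.trans e1,
      fun u v => Iff.rfl⟩
    refine isMaxLeafOutBranching_of_parents (S := S) (par := h.mem) hS hF
      (fun r' S' => hmin r' S') hpar fun u v => ?_
    rw [hs.2]
  · refine .inr ⟨h0.trans e0, fun T r hT => ?_⟩
    obtain ⟨S, hS, hF, -⟩ := exists_feasible_of_outBranching hT
    exact hno r S hS hF

/-- The size of the search tree is the only exponential quantity in the running time; the remaining
summands are multiplied by `1.9043 ^ n ≥ 1` to obtain a single polynomial factor. -/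
theorem time_le (n : ℕ) : (((2 * n + 2) * (solveTime n + 20 * width n) : ℕ) : ℝ) ≤
    (((2 * n + 2) * (2 * ((n + 2) * (n + 2)) * ((5 * n + 8) * (40 * width n)) + 3 +
      20 * width n) : ℕ) : ℝ) * 1.9043 ^ n := by
  have hy : (1 : ℝ) ≤ 1.9043 ^ n := one_le_pow₀ (by norm_num)
  have hs : (stepBound n : ℝ) ≤ 1 + 5 * ((n : ℝ) + 1) * 1.9043 ^ n :=
    Nat.floor_le (by positivity)
  generalize (1.9043 : ℝ) ^ n = y at *
  have hs2 : (stepBound n : ℝ) + 2 ≤ (5 * n + 8) * y := by nlinarith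
  unfold solveTime
  push_cast
  have hw : (0 : ℝ) ≤ width n := Nat.cast_nonneg _
  have h1 : ((stepBound n : ℝ) + 2) * (40 * width n) ≤ (5 * n + 8) * y * (40 * width n) :=
    mul_le_mul_of_nonneg_right hs2 (by positivity)
  have h2 := mul_le_mul_of_nonneg_left h1
    (by positivity : (0 : ℝ) ≤ 2 * (((n : ℝ) + 2) * (n + 2)))
  have h3 : (width n : ℝ) ≤ width n * y := le_mul_of_one_le_right hw hy
  rw [mul_assoc (2 * (n : ℝ) + 2)]
  refine mul_le_mul_of_nonneg_left ?_ (by positivity)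
  linarith

end

end MaxLeaf

open MaxLeaf RAM Polynomial in
theorem mainTheorem1 :
    ∃ (p : RAM.Prog) (time space : Polynomial ℕ), ∀ (n : ℕ) (G : Digraph (Fin n)),
      ∃ (s : RAM.State) (t : ℕ),
        RAM.Runs (space.eval n) p (RAM.input G) s t ∧
        (t : ℝ) ≤ (time.eval n : ℕ) * (1.9043 : ℝ) ^ n ∧
        RAM.IsMaxLeafOutput G s := by
  -- The exponent belongs to the fixed program, so the overhead `N ^ E` is polynomial in `n`. It is
  -- kept as an opaque number because its actual value plays no role.
  obtain ⟨E, hE⟩ : ∃ E, mainC.exp = E := ⟨_, rfl⟩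
  have hE0 : E ≠ 0 := hE ▸ exp_mainC_pos
  refine ⟨mainC.compile, (2 * X + 2) * (2 * ((X + 2) * (X + 2)) * ((5 * X + 8) *
    (40 * (X + 1) ^ 3)) + 3 + 20 * (X + 1) ^ 3) * (100 * (X + 2) ^ 3) ^ E,
    (100 * (X + 2) ^ 3) ^ E + 1, fun n G => ?_⟩
  -- A common bound for all values at the level of commands: table addresses, moduli and the input.
  -- The machine itself gets `N ^ E + 1` cells for intermediate results.
  set N := 100 * (n + 2) ^ 3 with hN
  have hM : ((100 * (X + 2) ^ 3) ^ E + 1 : ℕ[X]).eval n = N ^ E + 1 := by simp [hN]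
  have hT : ((2 * X + 2) * (2 * ((X + 2) * (X + 2)) * ((5 * X + 8) *
      (40 * (X + 1) ^ 3)) + 3 + 20 * (X + 1) ^ 3) * (100 * (X + 2) ^ 3) ^ E : ℕ[X]).eval n =
      (2 * n + 2) * (2 * ((n + 2) * (n + 2)) * ((5 * n + 8) * (40 * width n)) + 3 +
        20 * width n) * N ^ E := by simp [hN, width]
  rw [hM, hT]
  have hW : 30 * width n ≤ N := by
    rw [hN, width]
    exact Nat.mul_le_mul (by norm_num) (Nat.pow_le_pow_left (by omega) 3)
  have hmN : 2 * ((n + 2) * (n + 2)) + 1 ≤ N := by rw [hN]; nlinarith [Nat.zero_le (n ^ 3)]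
  have hnN : n * n ≤ N := by nlinarith
  have hn : n ≤ N := by nlinarith
  have hNM : N < N ^ E + 1 := Nat.lt_succ_of_le (Nat.le_self_pow hE0 N)
  obtain ⟨h', ⟨k, hk, R⟩, hout⟩ := run_mainC (g := arcs G) (h := input G) (arcs_lt G) hW hmN rfl
    rfl input_mem input_mem_eq_zero
  obtain ⟨s, t, hx, ht, hs⟩ := R.exec (M := N ^ E + 1) (by omega) wf_mainC
    ⟨fun x _ => (input_reg_le x).trans hn, fun a => (input_mem_le a).trans (by omega)⟩
    (by rw [hE]; exact Nat.lt_succ_self _) (input G) ⟨fun _ _ => rfl, rfl⟩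
  refine ⟨s, t, ⟨⟨fun x => ?_, fun a => ?_, fun a ha => input_mem_eq_zero a (by omega)⟩, hx⟩, ?_,
    isMaxLeafOutput hs hout⟩
  · exact ((input_reg_le x).trans hn).trans_lt hNM
  · exact ((input_mem_le a).trans (by omega : 1 ≤ N)).trans_lt hNM
  · rw [hE] at ht
    have h1 : (t : ℝ) ≤ (k : ℝ) * (N ^ E : ℕ) := by exact_mod_cast ht
    have h2 : (k : ℝ) ≤ ((2 * n + 2) * (solveTime n + 20 * width n) : ℕ) := by exact_mod_cast hk
    have h3 : (0 : ℝ) ≤ (N ^ E : ℕ) := Nat.cast_nonneg _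
    rw [Nat.cast_mul _ (N ^ E), mul_right_comm]
    exact h1.trans (mul_le_mul_of_nonneg_right (h2.trans (time_le n)) h3)
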